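/- **Conventions.** All vector spaces are over $\mathbb C$. A vertex operator algebra is a quadruple $(V,Y,\mathbf 1,\omega)$ with $V=\bigoplus_{n\in\mathbb Z}V_{(n)}$, $\dim V_{(n)}<\infty$, $V_{(n)}=0$ for $n\ll 0$, and a linear map $a\mapsto Y(a,x)=\sum_{n\in\mathbb Z}a_nx^{-n-1}\in(\mathrm{End}\,V)[[x,x^{-1}]]$ such that $Y(\mathbf 1,x)=1$, $Y(a,x)\mathbf 1\in V[[x]]$ has constant term $a$, $Y(a,x)b\in V((x))$, the Jacobi identity holds, the operators $L(n)$ given by $Y(\omega,x)=\sum_n L(n)x^{-n-2}$ satisfy the Virasoro relations for some central charge, $Y(L(-1)a,x)=\frac{d}{dx}Y(a,x)$, and $L(0)$ acts on $V_{(n)}$ as $n$. A $V$-module is a vector space $M$ with a linear map $a\mapsto Y_M(a,x)=\sum_n a_nx^{-n-1}\in(\mathrm{End}\,M)[[x,x^{-1}]]$ such that $Y_M(\mathbf 1,x)=1$, $Y_M(L(-1)a,x)=\frac{d}{dx}Y_M(a,x)$, $Y_M(a,x)u\in M((x))$, the Jacobi identity holds, and $M=\bigoplus_{h\in\mathbb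 C}M_{(h)}$, where $M_{(h)}$ is the $h$-eigenspace of $L(0)$, $\dim M_{(h)}<\infty$, and for each $h$ one has $M_{(h+n)}=0$ for all sufficiently negative integers $n$. A $V$-homomorphism is a linear map commuting with all $a_n$. The contragredient of $M$ is $M'=\bigoplus_h M_{(h)}^*$ with $\langle Y(a,x)u',w\rangle=\langle u',Y(e^{xL(1)}(-x^{-2})^{L(0)}a,x^{-1})w\rangle$. An intertwining operator of type $\binom{W_3}{W_1\,W_2}$ is a linear map $u\mapsto I(u,x)=\sum_{\alpha\in\mathbb C}u_\alpha x^{-\alpha-1}$ from $W_1$ to $\mathrm{Hom}(W_2,W_3)\{x\}$ such that for all $u\in W_1$, $w\in W_2$, $\alpha\in\mathbb C$ one has $u_{\alpha+n}w=0$ for all sufficiently large $n\in\mathbb Z$, $I(L(-1)u,x)=\frac{d}{dx}I(u,x)$, and for $a\in V$ $$x_0^{-1}\delta\!\left(\tfrac{x_1-x_2}{x_0}\right)Y(a,x_1)I(u,x_2)w-x_0^{-1}\delta\!\left(\tfrac{-x_2+x_1}{x_0}\right)I(u,x_2)Y(a,x_1)w=x_2^{-1}\delta\!\left(\tfrac{x_1-x_0}{x_2}\right)I(Y(a,x_0)u,x_2)w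 .$$ The dimension of the space of these is the fusion rule of that type. The transpose of such an $I$ is $I^t(u_2,x)u_1=e^{xL(-1)}I(u_1,e^{\pi i}x)u_2$ with $(e^{\pi i}x)^{\beta}=e^{\pi i\beta}x^\beta$, and the adjoint $I'$ is given by $\langle I'(u_1,x)u_3',u_2\rangle=\langle u_3',I(e^{xL(1)}(e^{\pi i}x^{-2})^{L(0)}u_1,x^{-1})u_2\rangle$ for $u_i\in W_i$, $u_3'\in W_3'$; it maps $W_1$ into $\mathrm{Hom}(W_3',W_2')\{x\}$. A tensor product for the ordered pair $(W_1,W_2)$ in the category of $V$-modules is a pair $(M,F)$ of a $V$-module $M$ and an intertwining operator $F$ of type $\binom{M}{W_1\,W_2}$ such that for every $V$-module $W$ and every intertwining operator $I$ of type $\binom{W}{W_1\,W_2}$ there is a unique $V$-homomorphism $\psi:M\to W$ with $I(u,x)w=\psi(F(u,x)w)$ for all $u\in W_1$, $w\in W_2$. For $V$-modules $W_1,W_2$ let $G(W_1,W_2)$ be the space of generalized intertwining operators, that is, of all $\Phi(x)=\sum_{\alpha\in\mathbb C}\Phi_\alpha x^{-\alpha-1}\in\mathrm{Hom}(W_1,W_2)\{x\}$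 such that: for all $\alpha\in\mathbb C$, $w\in W_1$ one has $\Phi_{\alpha+n}w=0$ for all sufficiently large $n\in\mathbb Z$; $[L(-1),\Phi(x)]=\Phi'(x)$; and for each $a\in V$ there is an integer $k>0$ with $(x_1-x_2)^kY(a,x_1)\Phi(x_2)=(x_1-x_2)^k\Phi(x_2)Y(a,x_1)$. The algebra $V$ acts by $$a_m\circ\Phi(x_2)=\mathrm{Res}_{x_1}\bigl((x_1-x_2)^mY(a,x_1)\Phi(x_2)-(-x_2+x_1)^m\Phi(x_2)Y(a,x_1)\bigr).$$ Let $\Delta(W_1,W_2)$ be the sum of all subspaces of $G(W_1,W_2)$ that are stable under this action and are $V$-modules for it, and let $\bar F(\Phi,x)=\Phi(x)$ for $\Phi\in\Delta(W_1,W_2)$. **Theorem.** Let $V$ be a vertex operator algebra such that (1) there are only finitely many irreducible $V$-modules up to equivalence, (2) every $V$-module is completely reducible (a direct sum of irreducible submodules), and (3) the fusion rule of every type $\binom{M_3}{M_1\,M_2}$ for $V$-modules $M_1,M_2,M_3$ is finite. Let $W_1$ and $W_2$ be $V$-modules. Then $\Delta(W_1,W_2)$ is a $V$-module, hence the largest $V$-module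 inside $G(W_1,W_2)$; the contragredients $W_2'$ and $\Delta(W_1,W_2)'$ are $V$-modules; and the pair $\bigl(\Delta(W_1,W_2)',(\bar F^{\,t})'(\cdot,x)\bigr)$ is a tensor product for the ordered pair $(W_1,W_2')$ in the category of $V$-modules. -/

import Mathlib

universe u v

namespace VOA

section Generalities

/-- The map `a ↦ ∑ᶠ i, φ i a`, linear as soon as each of these sums has only finitely many
nonzero terms. -/
noncomputable def finsumMap {A B : Type*} [AddCommGroup A] [Module ℂ A] [AddCommGroup B]
    [Module ℂ B] (φ : ℕ → A →ₗ[ℂ] B) (hφ : ∀ a, (Function.support fun i => φ i a).Finite) :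
    A →ₗ[ℂ] B where
  toFun a := ∑ᶠ i, φ i a
  map_add' a b := by
    simp only [map_add]
    exact finsum_add_distrib (hφ a) (hφ b)
  map_smul' c a := by
    simp only [map_smul, RingHom.id_apply]
    exact (smul_finsum' c (hφ a)).symm

theorem finite_support_of_eventually {B : Type*} [Zero B] (f : ℕ → B) (N : ℕ)
    (h : ∀ i, N ≤ i → f i = 0) : (Function.support f).Finite := by
  refine (Set.finite_lt_nat N).subset fun i hi => ?_
  by_contra hlt
  exact hi (h i (not_lt.mp hlt))

/-- A formal vertex operator map `a ↦ Y(a,x) = ∑_{n ∈ ℤ} a_n x^{-n-1}` from `V` to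
`(End M)[[x,x⁻¹]]`; the operator `a_n` is `Y a n`. -/
abbrev ModeMap (V M : Type*) [AddCommGroup V] [Module ℂ V] [AddCommGroup M] [Module ℂ M] :=
  V →ₗ[ℂ] ℤ → Module.End ℂ M

/-- A linear map `u ↦ I(u,x) = ∑_{α ∈ ℂ} u_α x^{-α-1}` from `A` to `Hom(B,C){x}`;
the operator `u_α` is `I u α`. -/
abbrev OperatorSeries (A B C : Type*) [AddCommGroup A] [Module ℂ A] [AddCommGroup B] [Module ℂ B]
    [AddCommGroup C] [Module ℂ C] :=
  A →ₗ[ℂ] ℂ → (B →ₗ[ℂ] C)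

/-- A subspace stable under all the operators `a_n`. -/
def IsInvariant {V M : Type*} [AddCommGroup V] [Module ℂ V] [AddCommGroup M] [Module ℂ M]
    (Y : ModeMap V M) (N : Submodule ℂ M) : Prop :=
  ∀ (a : V) (n : ℤ), ∀ u ∈ N, Y a n u ∈ N

/-- The restriction of a vertex operator map to an invariant subspace. -/
def restrictAction {V M : Type*} [AddCommGroup V] [Module ℂ V] [AddCommGroup M] [Module ℂ M]
    (Y : ModeMap V M) (N : Submodule ℂ M) (hN : IsInvariant Y N) : ModeMap V N where
  toFun a n := (Y a n).restrict (hN a n)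
  map_add' a b := by
    funext n; ext u; simp
  map_smul' c a := by
    funext n; ext u; simp

end Generalities

/-- A vertex operator algebra `(V, Y, 1, ω)`.  With `Y(a,x) = ∑ a_n x^{-n-1}`, `a_n = Y a n`,
and `Y(ω,x) = ∑ L(n) x^{-n-2}`, that is `L(n) = ω_{n+1}`. -/
class VertexOperatorAlgebra (V : Type u) [AddCommGroup V] [Module ℂ V] where
  Y : ModeMap V V
  one : V
  omega : V
  rank : ℂ
  /-- the homogeneous subspaces `V_(n)` -/
  homogeneous : ℤ → Submodule ℂ V
  isInternal : DirectSum.IsInternal homogeneous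
  finiteDimensional : ∀ n, FiniteDimensional ℂ (homogeneous n)
  lower_bound : ∃ N : ℤ, ∀ n < N, homogeneous n = ⊥
  /-- `Y(1,x) = 1` -/
  one_mode : ∀ n : ℤ, Y one n = if n = -1 then 1 else 0
  /-- `Y(a,x)1 ∈ V[[x]]`, with constant term `a` -/
  creation : ∀ a : V, (∀ n : ℤ, 0 ≤ n → Y a n one = 0) ∧ Y a (-1) one = a
  /-- `Y(a,x)b ∈ V((x))` -/
  truncation : ∀ a b : V, ∃ N : ℤ, ∀ n, N ≤ n → Y a n b = 0
  /-- The Jacobi identity, as the equality of the coefficients of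
  `x₀^{-l-1} x₁^{-m-1} x₂^{-n-1}`; binomial expressions are expanded in nonnegative powers of
  their second variable, and `x₂⁻¹ δ((x₁-x₀)/x₂) = x₁⁻¹ δ((x₂+x₀)/x₁)`. -/
  jacobi : ∀ (a b c : V) (l m n : ℤ),
    (∑ᶠ i : ℕ, ((-1 : ℂ) ^ i * (Ring.choose l i : ℤ)) • Y a (m + l - i) (Y b (n + i) c))
      - (∑ᶠ i : ℕ, ((-1 : ℂ) ^ (l + i) * (Ring.choose l i : ℤ)) •
          Y b (n + l - i) (Y a (m + i) c))
    = ∑ᶠ i : ℕ, ((Ring.choose m i : ℤ) : ℂ) • Y (Y a (l + i) b) (m + n - i) c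
  /-- `[L(m),L(n)] = (m-n) L(m+n) + (m³-m)/12 δ_{m+n,0} rank V` -/
  virasoro : ∀ m n : ℤ,
    Y omega (m + 1) * Y omega (n + 1) - Y omega (n + 1) * Y omega (m + 1)
      = ((m : ℂ) - n) • Y omega (m + n + 1)
        + (if m + n = 0 then ((m : ℂ) ^ 3 - m) / 12 * rank else 0) • (1 : Module.End ℂ V)
  /-- `Y(L(-1)a,x) = (d/dx) Y(a,x)` -/
  derivative : ∀ (a : V) (n : ℤ), Y (Y omega 0 a) n = (-(n : ℂ)) • Y a (n - 1)
  /-- `L(0)u = n u` for `u ∈ V_(n)` -/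
  weight : ∀ (n : ℤ), ∀ u ∈ homogeneous n, Y omega 1 u = (n : ℂ) • u

section Modules

variable (V : Type u) [AddCommGroup V] [Module ℂ V] [VertexOperatorAlgebra V]

/-- The Virasoro operator `L(n) = ω_{n+1}` defined by a vertex operator map. -/
def L {V : Type u} [AddCommGroup V] [Module ℂ V] [VertexOperatorAlgebra V]
    {M : Type v} [AddCommGroup M] [Module ℂ M] (Y : ModeMap V M) (n : ℤ) : Module.End ℂ M :=
  Y (VertexOperatorAlgebra.omega : V) (n + 1)

/-- The weight space `M_(h)`, the `h`-eigenspace of `L(0)`. -/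
def wtSpace {V : Type u} [AddCommGroup V] [Module ℂ V] [VertexOperatorAlgebra V]
    {M : Type v} [AddCommGroup M] [Module ℂ M] (Y : ModeMap V M) (h : ℂ) : Submodule ℂ M :=
  Module.End.eigenspace (L Y 0) h

/-- The axioms of a weak `V`-module. -/
structure IsWeakModule {V : Type u} [AddCommGroup V] [Module ℂ V] [VertexOperatorAlgebra V]
    {M : Type v} [AddCommGroup M] [Module ℂ M] (Y : ModeMap V M) : Prop where
  one_mode : ∀ n : ℤ, Y (VertexOperatorAlgebra.one : V) n = if n = -1 then 1 else 0
  derivative : ∀ (a : V) (n : ℤ),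
    Y (L (VertexOperatorAlgebra.Y (V := V)) (-1) a) n = (-(n : ℂ)) • Y a (n - 1)
  truncation : ∀ (a : V) (u : M), ∃ N : ℤ, ∀ n, N ≤ n → Y a n u = 0
  jacobi : ∀ (a b : V) (u : M) (l m n : ℤ),
    (∑ᶠ i : ℕ, ((-1 : ℂ) ^ i * (Ring.choose l i : ℤ)) • Y a (m + l - i) (Y b (n + i) u))
      - (∑ᶠ i : ℕ, ((-1 : ℂ) ^ (l + i) * (Ring.choose l i : ℤ)) •
          Y b (n + l - i) (Y a (m + i) u))
    = ∑ᶠ i : ℕ, ((Ring.choose m i : ℤ) : ℂ) •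
        Y (VertexOperatorAlgebra.Y a (l + i) b) (m + n - i) u

/-- The axioms of a `V`-module: a weak module that is the direct sum of its `L(0)`-eigenspaces
(distinct eigenspaces are always independent, so it is enough that they span), which are
finite-dimensional and vanish far enough down in each coset `h + ℤ`. -/
structure IsModule {V : Type u} [AddCommGroup V] [Module ℂ V] [VertexOperatorAlgebra V]
    {M : Type v} [AddCommGroup M] [Module ℂ M] (Y : ModeMap V M) : Prop
    extends IsWeakModule Y where
  iSup_wtSpace : ⨆ h : ℂ, wtSpace Y h = ⊤
  finiteDimensional : ∀ h : ℂ, FiniteDimensional ℂ (wtSpace Y h)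
  lower_bound : ∀ h : ℂ, ∃ N : ℤ, ∀ n : ℤ, n < N → wtSpace Y (h + n) = ⊥

/-- A `V`-module. -/
structure VModule where
  carrier : Type v
  [addCommGroup : AddCommGroup carrier]
  [module : Module ℂ carrier]
  Y : ModeMap V carrier
  isModule : IsModule Y

attribute [instance] VModule.addCommGroup VModule.module

instance : CoeSort (VModule.{u, v} V) (Type v) := ⟨VModule.carrier⟩

end Modules

section WeightLemmas

variable {V : Type u} [AddCommGroup V] [Module ℂ V] [VertexOperatorAlgebra V]

theorem L0_comm {M : Type v} [AddCommGroup M] [Module ℂ M] {Y : ModeMap V M}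
    (hY : IsWeakModule Y) (n : ℤ) {a : V} (ha : a ∈ VertexOperatorAlgebra.homogeneous n)
    (m : ℤ) (u : M) :
    L Y 0 (Y a m u) = Y a m (L Y 0 u) + ((n : ℂ) - m - 1) • Y a m u := by
  have hj := hY.jacobi VertexOperatorAlgebra.omega a u 0 1 m
  rw [finsum_eq_single _ 0, finsum_eq_single _ 0, finsum_eq_sum_of_support_subset (s := {0, 1})]
    at hj
  · have hd := hY.derivative a (1 + m)
    have hw := VertexOperatorAlgebra.weight n a ha
    simp only [L] at hd ⊢
    have e1 : (1 + m - 1 : ℤ) = m := by ring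
    simp [hw, e1] at hj
    have e2 : (-1 + 1 : ℤ) = 0 := rfl
    rw [e2, e1] at hd
    rw [hd] at hj
    rw [zero_add]
    rw [sub_eq_iff_eq_add] at hj
    rw [hj]
    simp only [LinearMap.smul_apply]
    push_cast
    module
  · intro i hi
    by_contra hne
    apply hi
    have : 2 ≤ i := by
      simp at hne; omega
    have h0 : Ring.choose (1 : ℤ) i = 0 := by
      have := Ring.choose_natCast (R := ℤ) 1 i
      rw [Nat.choose_eq_zero_of_lt (by omega)] at this
      simpa using this
    simp [h0]
  · intro i hi
    simp [Ring.choose_zero_pos ℤ (Nat.pos_of_ne_zero hi)]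
  · intro i hi
    simp [Ring.choose_zero_pos ℤ (Nat.pos_of_ne_zero hi)]

theorem mode_mem_wtSpace {M : Type v} [AddCommGroup M] [Module ℂ M] {Y : ModeMap V M}
    (hY : IsWeakModule Y) {n : ℤ} {a : V} (ha : a ∈ VertexOperatorAlgebra.homogeneous n)
    (m : ℤ) {h : ℂ} {u : M} (hu : u ∈ wtSpace Y h) :
    Y a m u ∈ wtSpace Y (h + n - m - 1) := by
  rw [wtSpace, Module.End.mem_eigenspace_iff] at hu ⊢
  rw [L0_comm hY n ha, hu, map_smul]
  module

theorem adjoint_isWeakModule : IsWeakModule (VertexOperatorAlgebra.Y (V := V)) where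
  one_mode := VertexOperatorAlgebra.one_mode
  derivative := VertexOperatorAlgebra.derivative
  truncation := VertexOperatorAlgebra.truncation
  jacobi := VertexOperatorAlgebra.jacobi

theorem mem_homogeneous_iff (n : ℤ) (a : V) :
    a ∈ VertexOperatorAlgebra.homogeneous n ↔
      a ∈ wtSpace (VertexOperatorAlgebra.Y (V := V)) n := by
  classical
  have key : ∀ n : ℤ, VertexOperatorAlgebra.homogeneous n ≤
      wtSpace (VertexOperatorAlgebra.Y (V := V)) n := fun n a ha => by
    rw [wtSpace, Module.End.mem_eigenspace_iff]
    exact VertexOperatorAlgebra.weight n a ha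
  refine ⟨fun h => key n h, fun h => ?_⟩
  have hind : iSupIndep fun n : ℤ => wtSpace (VertexOperatorAlgebra.Y (V := V)) (n : ℂ) :=
    (Module.End.eigenspaces_iSupIndep (L (VertexOperatorAlgebra.Y (V := V)) 0)).comp
      Int.cast_injective
  have htop : (⨆ n : ℤ, VertexOperatorAlgebra.homogeneous (V := V) n) = ⊤ :=
    VertexOperatorAlgebra.isInternal.submodule_iSup_eq_top
  have hsplit : VertexOperatorAlgebra.homogeneous n ⊔
      (⨆ (j : ℤ) (_ : j ≠ n), VertexOperatorAlgebra.homogeneous (V := V) j) = ⊤ := by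
    rw [eq_top_iff, ← htop]
    refine iSup_le fun j => ?_
    by_cases hj : j = n
    · subst hj; exact le_sup_left
    · exact le_sup_of_le_right (le_iSup₂_of_le j hj le_rfl)
  obtain ⟨b, hb, c, hc, hbc⟩ := Submodule.mem_sup.mp (hsplit ▸ Submodule.mem_top : a ∈ _)
  have hc1 : c ∈ wtSpace (VertexOperatorAlgebra.Y (V := V)) n := by
    have : c = a - b := by rw [← hbc]; abel
    rw [this]
    exact Submodule.sub_mem _ h (key n hb)
  have hc2 : c ∈ ⨆ (j : ℤ) (_ : j ≠ n), wtSpace (VertexOperatorAlgebra.Y (V := V)) (j : ℂ) :=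
    (iSup₂_mono fun j _ => key j) hc
  have : c = 0 := by
    have := (hind n)
    exact Submodule.disjoint_def.mp this c hc1 hc2
  rw [← hbc, this, add_zero]
  exact hb

theorem omega_mem : (VertexOperatorAlgebra.omega : V) ∈ VertexOperatorAlgebra.homogeneous 2 := by
  rw [mem_homogeneous_iff, wtSpace, Module.End.mem_eigenspace_iff]
  have hv := VertexOperatorAlgebra.virasoro (V := V) 0 (-2)
  have hc := VertexOperatorAlgebra.creation (VertexOperatorAlgebra.omega : V)
  have := congrArg (fun f => f (VertexOperatorAlgebra.one : V)) hv
  simp [hc.2, hc.1 1] at this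
  simpa [L] using this

theorem L1_mem_wtSpace {M : Type v} [AddCommGroup M] [Module ℂ M] {Y : ModeMap V M}
    (hY : IsWeakModule Y) {h : ℂ} {u : M} (hu : u ∈ wtSpace Y h) :
    L Y 1 u ∈ wtSpace Y (h - 1) := by
  have := mode_mem_wtSpace hY omega_mem (1 + 1) hu
  have e : h - 1 = h + ((2 : ℤ) : ℂ) - ((1 + 1 : ℤ) : ℂ) - 1 := by
    push_cast
    ring
  rw [e]
  exact this

theorem L1_pow_mem_wtSpace {M : Type v} [AddCommGroup M] [Module ℂ M] {Y : ModeMap V M}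
    (hY : IsWeakModule Y) (k : ℕ) {h : ℂ} {u : M} (hu : u ∈ wtSpace Y h) :
    (L Y 1 ^ k) u ∈ wtSpace Y (h - k) := by
  induction k with
  | zero => simpa using hu
  | succ k ih =>
    rw [pow_succ', Module.End.mul_apply]
    have := L1_mem_wtSpace hY ih
    convert this using 1
    push_cast
    congr 1
    ring

theorem L1_pow_eq_zero {M : Type v} [AddCommGroup M] [Module ℂ M] {Y : ModeMap V M}
    (hY : IsModule Y) {h : ℂ} {u : M} (hu : u ∈ wtSpace Y h) :
    ∃ N : ℕ, ∀ k, N ≤ k → (L Y 1 ^ k) u = 0 := by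
  obtain ⟨N, hN⟩ := hY.lower_bound h
  refine ⟨(1 - N).toNat, fun k hk => ?_⟩
  have h1 := L1_pow_mem_wtSpace hY.toIsWeakModule k hu
  have h2 := hN (-(k : ℤ)) (by omega)
  rw [show h - (k : ℂ) = h + ((-(k : ℤ) : ℤ) : ℂ) by push_cast; ring, h2] at h1
  simpa using h1

theorem L1_pow_mem_homogeneous (k : ℕ) {n : ℤ} {a : V}
    (ha : a ∈ VertexOperatorAlgebra.homogeneous n) :
    (L (VertexOperatorAlgebra.Y (V := V)) 1 ^ k) a ∈
      VertexOperatorAlgebra.homogeneous (n - k) := by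
  rw [mem_homogeneous_iff] at ha ⊢
  have := L1_pow_mem_wtSpace adjoint_isWeakModule k ha
  push_cast
  exact this

theorem L1_pow_eq_zero' {n : ℤ} {a : V} (ha : a ∈ VertexOperatorAlgebra.homogeneous n) :
    ∃ N : ℕ, ∀ k, N ≤ k → (L (VertexOperatorAlgebra.Y (V := V)) 1 ^ k) a = 0 := by
  obtain ⟨N, hN⟩ := VertexOperatorAlgebra.lower_bound (V := V)
  refine ⟨(n - N + 1).toNat, fun k hk => ?_⟩
  have h1 := L1_pow_mem_homogeneous k ha
  rw [hN _ (by omega)] at h1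
  simpa using h1

end WeightLemmas

section Homogeneous

/-- Gluing linear maps defined on the summands of an internal direct sum. -/
noncomputable def fromSummands {ι A B : Type*} [DecidableEq ι] [AddCommGroup A] [Module ℂ A]
    [AddCommGroup B] [Module ℂ B] (p : ι → Submodule ℂ A) (hp : DirectSum.IsInternal p)
    (φ : ∀ i, p i →ₗ[ℂ] B) : A →ₗ[ℂ] B :=
  DirectSum.toModule ℂ ι B φ ∘ₗ
    (LinearEquiv.ofBijective (DirectSum.coeLinearMap p) hp).symm.toLinearMap

theorem fromSummands_apply {ι A B : Type*} [DecidableEq ι] [AddCommGroup A] [Module ℂ A]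
    [AddCommGroup B] [Module ℂ B] (p : ι → Submodule ℂ A) (hp : DirectSum.IsInternal p)
    (φ : ∀ i, p i →ₗ[ℂ] B) (i : ι) (a : p i) : fromSummands p hp φ a = φ i a := by
  have : (LinearEquiv.ofBijective (DirectSum.coeLinearMap p) hp).symm (a : A)
      = DirectSum.lof ℂ ι (fun i => p i) i a :=
    (LinearEquiv.symm_apply_eq _).mpr (DirectSum.coeLinearMap_lof p i a).symm
  simp [fromSummands, this]

theorem isInternal_wtSpace {V : Type u} [AddCommGroup V] [Module ℂ V] [VertexOperatorAlgebra V]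
    {M : Type v} [AddCommGroup M] [Module ℂ M] {Y : ModeMap V M} (hY : IsModule Y) :
    DirectSum.IsInternal (wtSpace Y) :=
  DirectSum.isInternal_submodule_of_iSupIndep_of_iSup_eq_top
    (Module.End.eigenspaces_iSupIndep (L Y 0)) hY.iSup_wtSpace

end Homogeneous

section Contragredient

variable {V : Type u} [AddCommGroup V] [Module ℂ V] [VertexOperatorAlgebra V]

/-- The coefficient of `x^{-m-1}` in `Y(e^{xL(1)} (-x⁻²)^{L(0)} a, x⁻¹)`; for `a ∈ V_(n)` it is
`∑_k (-1)^n (1/k!) (L(1)^k a)_{2n-k-m-2}`. -/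
noncomputable def oppositeMode (M : VModule.{u, v} V) (m : ℤ) : V →ₗ[ℂ] Module.End ℂ M :=
  fromSummands VertexOperatorAlgebra.homogeneous VertexOperatorAlgebra.isInternal fun n =>
    finsumMap
      (fun k => ((-1 : ℂ) ^ n * (k.factorial : ℂ)⁻¹) •
        (LinearMap.proj (2 * n - k - m - 2) ∘ₗ M.Y ∘ₗ
          (L (VertexOperatorAlgebra.Y (V := V)) 1 ^ k) ∘ₗ
          (VertexOperatorAlgebra.homogeneous n).subtype))
      (fun a => by
        obtain ⟨N, hN⟩ := L1_pow_eq_zero' a.2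
        exact finite_support_of_eventually _ N fun k hk => by simp [hN k hk])

theorem oppositeMode_apply (M : VModule.{u, v} V) (m n : ℤ) {a : V}
    (ha : a ∈ VertexOperatorAlgebra.homogeneous n) :
    oppositeMode M m a = ∑ᶠ k : ℕ, ((-1 : ℂ) ^ n * (k.factorial : ℂ)⁻¹) •
      M.Y ((L (VertexOperatorAlgebra.Y (V := V)) 1 ^ k) a) (2 * n - k - m - 2) :=
  fromSummands_apply _ VertexOperatorAlgebra.isInternal _ n ⟨a, ha⟩

/-- The space `M' = ⨁_h M_(h)^*`, realized as the space of linear functionals on `M` that vanish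
on all but finitely many weight spaces. -/
def restrictedDual (M : VModule.{u, v} V) : Submodule ℂ (Module.Dual ℂ M) where
  carrier := {f | {h : ℂ | ∃ w ∈ wtSpace M.Y h, f w ≠ 0}.Finite}
  zero_mem' := by simp
  add_mem' {f g} hf hg := by
    refine (hf.union hg).subset ?_
    rintro h ⟨w, hw, hne⟩
    by_cases h0 : f w = 0
    · exact Or.inr ⟨w, hw, by simpa [h0] using hne⟩
    · exact Or.inl ⟨w, hw, h0⟩
  smul_mem' c f hf := by
    refine hf.subset ?_
    rintro h ⟨w, hw, hne⟩
    exact ⟨w, hw, fun h0 => hne (by simp [h0])⟩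

theorem oppositeMode_mem_wtSpace (M : VModule.{u, v} V) (m n : ℤ) {a : V}
    (ha : a ∈ VertexOperatorAlgebra.homogeneous n) {h : ℂ} {w : M} (hw : w ∈ wtSpace M.Y h) :
    oppositeMode M m a w ∈ wtSpace M.Y (h + m + 1 - n) := by
  rw [oppositeMode_apply M m n ha]
  refine finsum_induction (fun f : Module.End ℂ M => f w ∈ wtSpace M.Y (h + m + 1 - n)) ?_ ?_ ?_
  · simp
  · intro f g hf hg
    exact Submodule.add_mem _ hf hg
  · intro k
    refine Submodule.smul_mem _ _ ?_
    have := mode_mem_wtSpace M.isModule.toIsWeakModule (L1_pow_mem_homogeneous k ha)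
      (2 * n - k - m - 2) hw
    have e : h + m + 1 - n
        = h + ((n - k : ℤ) : ℂ) - ((2 * n - k - m - 2 : ℤ) : ℂ) - 1 := by
      push_cast
      ring
    rw [e]
    exact this

theorem oppositeMode_dual_mem (M : VModule.{u, v} V) (a : V) (m : ℤ) (f : Module.Dual ℂ M)
    (hf : f ∈ restrictedDual M) :
    Module.Dual.transpose (R := ℂ) (oppositeMode M m a) f ∈ restrictedDual M := by
  have htop : a ∈ ⨆ n, VertexOperatorAlgebra.homogeneous (V := V) n := by
    rw [VertexOperatorAlgebra.isInternal.submodule_iSup_eq_top]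
    trivial
  induction htop using Submodule.iSup_induction' with
  | mem n a ha =>
    have hinj : Function.Injective fun h : ℂ => h + m + 1 - n := fun x y hxy => by
      simpa using hxy
    refine (Set.Finite.preimage hinj.injOn hf).subset ?_
    rintro h ⟨w, hw, hne⟩
    exact ⟨oppositeMode M m a w, oppositeMode_mem_wtSpace M m n ha hw, hne⟩
  | zero => simp
  | add a b _ _ ha hb =>
    simpa using Submodule.add_mem _ ha hb

/-- The vertex operator map of the contragredient module, on `M'`:
`⟨Y(a,x)u', w⟩ = ⟨u', Y(e^{xL(1)} (-x⁻²)^{L(0)} a, x⁻¹) w⟩`. -/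
noncomputable def contragredientAction (M : VModule.{u, v} V) : ModeMap V (restrictedDual M) where
  toFun a m := (Module.Dual.transpose (R := ℂ) (oppositeMode M m a)).restrict
    (oppositeMode_dual_mem M a m)
  map_add' a b := by
    funext m; ext f w; simp
  map_smul' c a := by
    funext m; ext f w; simp

end Contragredient

section Intertwining

variable {V : Type u} [AddCommGroup V] [Module ℂ V] [VertexOperatorAlgebra V]

/-- The truncation condition: for all `u`, `w`, `α`, one has `u_{α+n} w = 0` for all sufficiently
large integers `n`. -/
def IsTruncated {A B C : Type*} [AddCommGroup A] [Module ℂ A] [AddCommGroup B] [Module ℂ B]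
    [AddCommGroup C] [Module ℂ C] (I : OperatorSeries A B C) : Prop :=
  ∀ (u : A) (w : B) (α : ℂ), ∃ N : ℤ, ∀ n : ℤ, N ≤ n → I u (α + n) w = 0

/-- Intertwining operators of type `(W₃ over W₁ W₂)`. -/
structure IsIntertwining (W₁ W₂ W₃ : VModule.{u, v} V) (I : OperatorSeries W₁ W₂ W₃) : Prop where
  truncated : IsTruncated I
  /-- `I(L(-1)u,x) = (d/dx) I(u,x)` -/
  derivative : ∀ (u : W₁) (α : ℂ), I (L W₁.Y (-1) u) α = (-α) • I u (α - 1)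
  /-- the Jacobi identity, coefficient of `x₀^{-l-1} x₁^{-m-1} x₂^{-α-1}` -/
  jacobi : ∀ (a : V) (u : W₁) (w : W₂) (l m : ℤ) (α : ℂ),
    (∑ᶠ i : ℕ, ((-1 : ℂ) ^ i * (Ring.choose l i : ℤ)) • W₃.Y a (m + l - i) (I u (α + i) w))
      - (∑ᶠ i : ℕ, ((-1 : ℂ) ^ (l + i) * (Ring.choose l i : ℤ)) •
          I u (α + l - i) (W₂.Y a (m + i) w))
    = ∑ᶠ i : ℕ, ((Ring.choose m i : ℤ) : ℂ) • I (W₁.Y a (l + i) u) (α + m - i) w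

/-- Linear maps commuting with all vertex operators. -/
def IsVHom (M N : VModule.{u, v} V) (f : M →ₗ[ℂ] N) : Prop :=
  ∀ (a : V) (n : ℤ) (w : M), f (M.Y a n w) = N.Y a n (f w)

/-- `(M, F)` is a tensor product for the ordered pair `(W₁, W₂)` in the category of
`V`-modules. -/
structure IsTensorProduct (W₁ W₂ M : VModule.{u, v} V) (F : OperatorSeries W₁ W₂ M) : Prop where
  isIntertwining : IsIntertwining W₁ W₂ M F
  universal : ∀ (W : VModule.{u, v} V) (I : OperatorSeries W₁ W₂ W), IsIntertwining W₁ W₂ W I →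
    ∃! ψ : M →ₗ[ℂ] W, IsVHom M W ψ ∧ ∀ (u : W₁) (α : ℂ) (w : W₂), I u α w = ψ (F u α w)

theorem truncated_nat {A B C : Type*} [AddCommGroup A] [Module ℂ A] [AddCommGroup B] [Module ℂ B]
    [AddCommGroup C] [Module ℂ C] {I : OperatorSeries A B C} (hI : IsTruncated I)
    (u : A) (w : B) (α : ℂ) : ∃ N : ℕ, ∀ k : ℕ, N ≤ k → I u (α + k) w = 0 := by
  obtain ⟨N, hN⟩ := hI u w α
  exact ⟨N.toNat, fun k hk => by simpa using hN k (by omega)⟩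

/-- The transpose operator `I^t(u₂,x)u₁ = e^{xL(-1)} I(u₁, e^{πi}x) u₂`, where
`(e^{πi}x)^{-α-1} = e^{-πi(α+1)} x^{-α-1}`.  The coefficient of `x^{-α-1}` is
`∑_k (1/k!) e^{-πi(α+k+1)} L(-1)^k (u₁)_{α+k} u₂`. -/
noncomputable def transpose {A B : Type*} [AddCommGroup A] [Module ℂ A] [AddCommGroup B]
    [Module ℂ B] (C : VModule.{u, v} V) (I : OperatorSeries A B C) (hI : IsTruncated I) :
    OperatorSeries B A C :=
  LinearMap.pi fun α => LinearMap.flip <|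
    { toFun := fun u₁ => finsumMap
        (fun k => ((k.factorial : ℂ)⁻¹ * Complex.exp (-(Real.pi * Complex.I * (α + k + 1)))) •
          ((L C.Y (-1) ^ k) ∘ₗ I u₁ (α + k)))
        (fun u₂ => by
          obtain ⟨N, hN⟩ := truncated_nat hI u₁ u₂ α
          exact finite_support_of_eventually _ N fun k hk => by simp [hN k hk])
      map_add' := fun u₁ u₁' => by
        ext u₂
        obtain ⟨N, hN⟩ := truncated_nat hI u₁ u₂ α
        obtain ⟨N', hN'⟩ := truncated_nat hI u₁' u₂ α
        simp only [finsumMap, LinearMap.coe_mk, AddHom.coe_mk, LinearMap.add_apply]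
        rw [← finsum_add_distrib]
        · simp
        · exact finite_support_of_eventually _ N fun k hk => by simp [hN k hk]
        · exact finite_support_of_eventually _ N' fun k hk => by simp [hN' k hk]
      map_smul' := fun c u₁ => by
        ext u₂
        obtain ⟨N, hN⟩ := truncated_nat hI u₁ u₂ α
        simp only [finsumMap, LinearMap.coe_mk, AddHom.coe_mk, LinearMap.smul_apply,
          RingHom.id_apply]
        rw [smul_finsum']
        · simp [smul_comm c]
        · exact finite_support_of_eventually _ N fun k hk => by simp [hN k hk] }

theorem transpose_apply {A B : Type*} [AddCommGroup A] [Module ℂ A] [AddCommGroup B]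
    [Module ℂ B] (C : VModule.{u, v} V) (I : OperatorSeries A B C) (hI : IsTruncated I)
    (u₂ : B) (α : ℂ) (u₁ : A) :
    transpose C I hI u₂ α u₁ = ∑ᶠ k : ℕ,
      ((k.factorial : ℂ)⁻¹ * Complex.exp (-(Real.pi * Complex.I * (α + k + 1)))) •
        (L C.Y (-1) ^ k) (I u₁ (α + k) u₂) := rfl

/-- The coefficient of `x^{-β-1}` in `I(e^{xL(1)} (e^{πi}x⁻²)^{L(0)} u, x⁻¹)`; for `u` of weight
`h` it is `∑_k e^{πih} (1/k!) (L(1)^k u)_{2h-k-β-2}`. -/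
noncomputable def oppositeOperator {B C : Type*} [AddCommGroup B] [Module ℂ B] [AddCommGroup C]
    [Module ℂ C] (A : VModule.{u, v} V) (I : OperatorSeries A B C) (β : ℂ) :
    A →ₗ[ℂ] B →ₗ[ℂ] C :=
  fromSummands (wtSpace A.Y) (isInternal_wtSpace A.isModule) fun h =>
    finsumMap
      (fun k => (Complex.exp (Real.pi * Complex.I * h) * (k.factorial : ℂ)⁻¹) •
        (LinearMap.proj (2 * h - k - β - 2) ∘ₗ I ∘ₗ (L A.Y 1 ^ k) ∘ₗ (wtSpace A.Y h).subtype))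
      (fun u => by
        obtain ⟨N, hN⟩ := L1_pow_eq_zero A.isModule u.2
        exact finite_support_of_eventually _ N fun k hk => by simp [hN k hk])

theorem oppositeOperator_apply {B C : Type*} [AddCommGroup B] [Module ℂ B] [AddCommGroup C]
    [Module ℂ C] (A : VModule.{u, v} V) (I : OperatorSeries A B C) (β : ℂ) {h : ℂ} {u : A}
    (hu : u ∈ wtSpace A.Y h) :
    oppositeOperator A I β u = ∑ᶠ k : ℕ,
      (Complex.exp (Real.pi * Complex.I * h) * (k.factorial : ℂ)⁻¹) •
        I ((L A.Y 1 ^ k) u) (2 * h - k - β - 2) :=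
  fromSummands_apply _ (isInternal_wtSpace A.isModule) _ h ⟨u, hu⟩

/-- The adjoint operator `⟨I'(u,x)f, w⟩ = ⟨f, I(e^{xL(1)} (e^{πi}x⁻²)^{L(0)} u, x⁻¹) w⟩`, on full
dual spaces. -/
noncomputable def adjointOperator {B C : Type*} [AddCommGroup B] [Module ℂ B] [AddCommGroup C]
    [Module ℂ C] (A : VModule.{u, v} V) (I : OperatorSeries A B C) :
    OperatorSeries A (Module.Dual ℂ C) (Module.Dual ℂ B) :=
  LinearMap.pi fun β => Module.Dual.transpose (R := ℂ) ∘ₗ oppositeOperator A I β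

theorem adjointOperator_apply {B C : Type*} [AddCommGroup B] [Module ℂ B] [AddCommGroup C]
    [Module ℂ C] (A : VModule.{u, v} V) (I : OperatorSeries A B C) (u : A) (β : ℂ)
    (f : Module.Dual ℂ C) (w : B) :
    adjointOperator A I u β f w = f (oppositeOperator A I β u w) := rfl

theorem jacobi_supports (W₁ W₂ W₃ : VModule.{u, v} V) {I : OperatorSeries W₁ W₂ W₃}
    (hI : IsTruncated I) (a : V) (u : W₁) (w : W₂) (l m : ℤ) (α : ℂ) (c : ℕ → ℂ) :
    (Function.support fun i : ℕ => c i • W₃.Y a (m + l - i) (I u (α + i) w)).Finite ∧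
    (Function.support fun i : ℕ => c i • I u (α + l - i) (W₂.Y a (m + i) w)).Finite ∧
    (Function.support fun i : ℕ => c i • I (W₁.Y a (l + i) u) (α + m - i) w).Finite := by
  obtain ⟨N₁, h₁⟩ := truncated_nat hI u w α
  obtain ⟨N₂, h₂⟩ := W₂.isModule.truncation a w
  obtain ⟨N₃, h₃⟩ := W₁.isModule.truncation a u
  exact ⟨finite_support_of_eventually _ N₁ fun k hk => by simp [h₁ k hk],
    finite_support_of_eventually _ (N₂ - m).toNat fun k hk => by simp [h₂ (m + k) (by omega)],
    finite_support_of_eventually _ (N₃ - l).toNat fun k hk => by simp [h₃ (l + k) (by omega)]⟩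

/-- The vector space of intertwining operators of type `(W₃ over W₁ W₂)`; its dimension is the
fusion rule of that type. -/
def intertwiningSpace (W₁ W₂ W₃ : VModule.{u, v} V) : Submodule ℂ (OperatorSeries W₁ W₂ W₃) where
  carrier := {I | IsIntertwining W₁ W₂ W₃ I}
  zero_mem' := ⟨fun _ _ _ => ⟨0, by simp⟩, by simp, by simp⟩
  add_mem' {I J} hI hJ := by
    refine ⟨fun u w α => ?_, fun u α => ?_, fun a u w l m α => ?_⟩
    · obtain ⟨N, hN⟩ := hI.truncated u w α
      obtain ⟨N', hN'⟩ := hJ.truncated u w α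
      exact ⟨max N N', fun n hn => by
        simp [hN n (le_trans (le_max_left _ _) hn), hN' n (le_trans (le_max_right _ _) hn)]⟩
    · simp only [LinearMap.add_apply, Pi.add_apply, hI.derivative, hJ.derivative, smul_add]
    · have sI := jacobi_supports W₁ W₂ W₃ hI.truncated a u w l m α
      have sJ := jacobi_supports W₁ W₂ W₃ hJ.truncated a u w l m α
      simp only [LinearMap.add_apply, Pi.add_apply, map_add, smul_add]
      rw [finsum_add_distrib (sI _).1 (sJ _).1, finsum_add_distrib (sI _).2.1 (sJ _).2.1,
        finsum_add_distrib (sI _).2.2 (sJ _).2.2, ← hI.jacobi, ← hJ.jacobi]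
      abel
  smul_mem' c I hI := by
    refine ⟨fun u w α => ?_, fun u α => ?_, fun a u w l m α => ?_⟩
    · obtain ⟨N, hN⟩ := hI.truncated u w α
      exact ⟨N, fun n hn => by simp [hN n hn]⟩
    · simp only [LinearMap.smul_apply, Pi.smul_apply, hI.derivative, smul_comm c]
    · have sI := jacobi_supports W₁ W₂ W₃ hI.truncated a u w l m α
      simp only [LinearMap.smul_apply, Pi.smul_apply, map_smul, smul_comm _ c]
      rw [← smul_finsum' c (sI _).1, ← smul_finsum' c (sI _).2.1,
        ← smul_finsum' c (sI _).2.2, ← hI.jacobi, smul_sub]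

end Intertwining

section Semisimplicity

variable {V : Type u} [AddCommGroup V] [Module ℂ V] [VertexOperatorAlgebra V]

/-- An irreducible submodule: a nonzero invariant subspace with no invariant subspaces other than
zero and itself. -/
def IsIrreducibleSubmodule (M : VModule.{u, v} V) (N : Submodule ℂ M) : Prop :=
  IsInvariant M.Y N ∧ N ≠ ⊥ ∧ ∀ P : Submodule ℂ M, IsInvariant M.Y P → P ≤ N → P = ⊥ ∨ P = N

def IsIrreducible (M : VModule.{u, v} V) : Prop := IsIrreducibleSubmodule M ⊤

/-- A module that is the direct sum of a family of irreducible submodules. -/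
def IsCompletelyReducible (M : VModule.{u, v} V) : Prop :=
  ∃ S : Set (Submodule ℂ M), (∀ N ∈ S, IsIrreducibleSubmodule M N) ∧ sSupIndep S ∧ sSup S = ⊤

def IsEquivalent (M N : VModule.{u, v} V) : Prop :=
  ∃ f : M ≃ₗ[ℂ] N, IsVHom M N f.toLinearMap

/-- There are only finitely many irreducible `V`-modules up to equivalence. -/
def FinitelyManyIrreducibles (V : Type u) [AddCommGroup V] [Module ℂ V]
    [VertexOperatorAlgebra V] : Prop :=
  ∃ (n : ℕ) (S : Fin n → VModule.{u, v} V), (∀ i, IsIrreducible (S i)) ∧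
    ∀ M : VModule.{u, v} V, IsIrreducible M → ∃ i, IsEquivalent M (S i)

end Semisimplicity

section GeneralizedIntertwining

variable {V : Type u} [AddCommGroup V] [Module ℂ V] [VertexOperatorAlgebra V]

/-- The space of all `Φ(x) = ∑_{α ∈ ℂ} Φ_α x^{-α-1} ∈ Hom(W₁,W₂){x}` such that for all `w`, `α`,
one has `Φ_{α+n} w = 0` for all sufficiently large integers `n`. -/
def fieldSpace (W₁ W₂ : VModule.{u, v} V) : Submodule ℂ (ℂ → (W₁ →ₗ[ℂ] W₂)) where
  carrier := {Φ | ∀ (α : ℂ) (w : W₁), ∃ N : ℤ, ∀ n : ℤ, N ≤ n → Φ (α + n) w = 0}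
  zero_mem' := fun _ _ => ⟨0, by simp⟩
  add_mem' {Φ Ψ} hΦ hΨ α w := by
    obtain ⟨N, hN⟩ := hΦ α w
    obtain ⟨N', hN'⟩ := hΨ α w
    exact ⟨max N N', fun n hn => by
      simp [hN n (le_trans (le_max_left _ _) hn), hN' n (le_trans (le_max_right _ _) hn)]⟩
  smul_mem' c Φ hΦ α w := by
    obtain ⟨N, hN⟩ := hΦ α w
    exact ⟨N, fun n hn => by simp [hN n hn]⟩

variable (W₁ W₂ : VModule.{u, v} V)

theorem circ_left_finite (a : V) (l : ℤ) (Φ : fieldSpace W₁ W₂) (α : ℂ) (w : W₁) :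
    (Function.support fun i : ℕ => ((-1 : ℂ) ^ i * (Ring.choose l i : ℤ)) •
      W₂.Y a (l - i) (Φ.1 (α + i) w)).Finite := by
  obtain ⟨N, hN⟩ := Φ.2 α w
  exact finite_support_of_eventually _ N.toNat fun k hk => by
    have := hN k (by omega)
    simp only [Int.cast_natCast] at this
    simp [this]

theorem circ_right_finite (a : V) (l : ℤ) (Φ : fieldSpace W₁ W₂) (α : ℂ) (w : W₁) :
    (Function.support fun i : ℕ => ((-1 : ℂ) ^ (l + i) * (Ring.choose l i : ℤ)) •
      Φ.1 (α + l - i) (W₁.Y a i w)).Finite := by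
  obtain ⟨N, hN⟩ := W₁.isModule.truncation a w
  exact finite_support_of_eventually _ N.toNat fun k hk => by simp [hN k (by omega)]

/-- The coefficient of `x₂^{-α-1}` in
`Res_{x₁} ((x₁-x₂)^l Y(a,x₁)Φ(x₂) - (-x₂+x₁)^l Φ(x₂)Y(a,x₁))`. -/
noncomputable def circCoeff (a : V) (l : ℤ) (Φ : fieldSpace W₁ W₂) (α : ℂ) : W₁ →ₗ[ℂ] W₂ :=
  finsumMap (fun i => ((-1 : ℂ) ^ i * (Ring.choose l i : ℤ)) • (W₂.Y a (l - i) ∘ₗ Φ.1 (α + i)))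
    (circ_left_finite W₁ W₂ a l Φ α)
  - finsumMap
    (fun i => ((-1 : ℂ) ^ (l + i) * (Ring.choose l i : ℤ)) • (Φ.1 (α + l - i) ∘ₗ W₁.Y a i))
    (circ_right_finite W₁ W₂ a l Φ α)

theorem circCoeff_apply (a : V) (l : ℤ) (Φ : fieldSpace W₁ W₂) (α : ℂ) (w : W₁) :
    circCoeff W₁ W₂ a l Φ α w =
      (∑ᶠ i : ℕ, ((-1 : ℂ) ^ i * (Ring.choose l i : ℤ)) • W₂.Y a (l - i) (Φ.1 (α + i) w))
      - ∑ᶠ i : ℕ, ((-1 : ℂ) ^ (l + i) * (Ring.choose l i : ℤ)) •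
          Φ.1 (α + l - i) (W₁.Y a i w) := rfl

theorem circCoeff_mem (a : V) (l : ℤ) (Φ : fieldSpace W₁ W₂) :
    circCoeff W₁ W₂ a l Φ ∈ fieldSpace W₁ W₂ := by
  intro α w
  obtain ⟨N₁, h₁⟩ := Φ.2 α w
  obtain ⟨K, hK⟩ := W₁.isModule.truncation a w
  have h₂ : ∀ i : ℕ, ∃ N : ℤ, ∀ n : ℤ, N ≤ n → Φ.1 (α + n) (W₁.Y a i w) = 0 :=
    fun i => Φ.2 α (W₁.Y a i w)
  choose N₂ h₂ using h₂
  obtain ⟨B, hB⟩ := ((Set.finite_lt_nat K.toNat).image fun i : ℕ => N₂ i + i - l).bddAbove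
  refine ⟨max N₁ B, fun n hn => ?_⟩
  rw [circCoeff_apply]
  have e₁ : ∀ i : ℕ, Φ.1 (α + n + i) w = 0 := fun i => by
    have := h₁ (n + i) (by have := le_trans (le_max_left _ _) hn; omega)
    push_cast at this
    rwa [add_assoc]
  have e₂ : ∀ i : ℕ, Φ.1 (α + n + l - i) (W₁.Y a i w) = 0 := fun i => by
    by_cases hi : i < K.toNat
    · have hBi : N₂ i + i - l ≤ B := hB ⟨i, hi, rfl⟩
      have := h₂ i (n + l - i) (by have := le_trans (le_max_right _ _) hn; omega)
      push_cast at this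
      rwa [show α + n + l - i = α + (n + l - i : ℂ) by ring]
    · rw [hK i (by omega), map_zero]
  simp [e₁, e₂]

/-- The action of `V` on the space of fields:
`a(l) ∘ Φ(x₂) = Res_{x₁} ((x₁-x₂)^l Y(a,x₁)Φ(x₂) - (-x₂+x₁)^l Φ(x₂)Y(a,x₁))`. -/
noncomputable def circ : ModeMap V (fieldSpace W₁ W₂) :=
  LinearMap.pi fun l => LinearMap.mk₂ ℂ
    (fun a Φ => (⟨circCoeff W₁ W₂ a l Φ, circCoeff_mem W₁ W₂ a l Φ⟩ : fieldSpace W₁ W₂))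
    (fun a b Φ => by
      ext α w
      simp only [Submodule.coe_add, Pi.add_apply, LinearMap.add_apply, circCoeff_apply]
      rw [← add_sub_add_comm,
        ← finsum_add_distrib (circ_left_finite W₁ W₂ a l Φ α w)
          (circ_left_finite W₁ W₂ b l Φ α w),
        ← finsum_add_distrib (circ_right_finite W₁ W₂ a l Φ α w)
          (circ_right_finite W₁ W₂ b l Φ α w)]
      simp)
    (fun c a Φ => by
      ext α w
      simp only [Submodule.coe_smul, Pi.smul_apply, LinearMap.smul_apply, circCoeff_apply]
      rw [smul_sub, smul_finsum' c (circ_left_finite W₁ W₂ a l Φ α w),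
        smul_finsum' c (circ_right_finite W₁ W₂ a l Φ α w)]
      simp [smul_comm c])
    (fun a Φ Ψ => by
      ext α w
      simp only [Submodule.coe_add, Pi.add_apply, LinearMap.add_apply, circCoeff_apply]
      rw [← add_sub_add_comm,
        ← finsum_add_distrib (circ_left_finite W₁ W₂ a l Φ α w)
          (circ_left_finite W₁ W₂ a l Ψ α w),
        ← finsum_add_distrib (circ_right_finite W₁ W₂ a l Φ α w)
          (circ_right_finite W₁ W₂ a l Ψ α w)]
      simp)
    (fun c a Φ => by
      ext α w
      simp only [Submodule.coe_smul, Pi.smul_apply, LinearMap.smul_apply, circCoeff_apply]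
      rw [smul_sub, smul_finsum' c (circ_left_finite W₁ W₂ a l Φ α w),
        smul_finsum' c (circ_right_finite W₁ W₂ a l Φ α w)]
      simp [smul_comm c])

theorem circ_apply (a : V) (l : ℤ) (Φ : fieldSpace W₁ W₂) (α : ℂ) (w : W₁) :
    (circ W₁ W₂ a l Φ).1 α w =
      (∑ᶠ i : ℕ, ((-1 : ℂ) ^ i * (Ring.choose l i : ℤ)) • W₂.Y a (l - i) (Φ.1 (α + i) w))
      - ∑ᶠ i : ℕ, ((-1 : ℂ) ^ (l + i) * (Ring.choose l i : ℤ)) •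
          Φ.1 (α + l - i) (W₁.Y a i w) := rfl

/-- The coefficient of `x₁^{-m-1} x₂^{-α-1}` in
`(x₁-x₂)^k Y(a,x₁)Φ(x₂) - (x₁-x₂)^k Φ(x₂)Y(a,x₁)`. -/
noncomputable def localityDefect (a : V) (Φ : ℂ → (W₁ →ₗ[ℂ] W₂)) (k : ℕ) (m : ℤ) (α : ℂ) :
    W₁ →ₗ[ℂ] W₂ :=
  ∑ i ∈ Finset.range (k + 1), ((-1 : ℂ) ^ i * (k.choose i : ℂ)) •
    (W₂.Y a (m + k - i) ∘ₗ Φ (α + i) - Φ (α + i) ∘ₗ W₁.Y a (m + k - i))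

/-- A generalized intertwining operator from `W₁` to `W₂` (the truncation condition being part of
membership in `fieldSpace`). -/
structure IsGeneralizedIntertwining (Φ : fieldSpace W₁ W₂) : Prop where
  /-- `[L(-1), Φ(x)] = Φ'(x)` -/
  derivative : ∀ α : ℂ,
    L W₂.Y (-1) ∘ₗ Φ.1 α - Φ.1 α ∘ₗ L W₁.Y (-1) = (-α) • Φ.1 (α - 1)
  /-- `(x₁-x₂)^k Y(a,x₁)Φ(x₂) = (x₁-x₂)^k Φ(x₂)Y(a,x₁)` for some `k > 0` -/
  locality : ∀ a : V, ∃ k : ℕ, 0 < k ∧ ∀ (m : ℤ) (α : ℂ), localityDefect W₁ W₂ a Φ.1 k m α = 0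

theorem localityDefect_succ (a : V) (Φ : ℂ → (W₁ →ₗ[ℂ] W₂)) (k : ℕ) (m : ℤ) (α : ℂ) :
    localityDefect W₁ W₂ a Φ (k + 1) m α =
      localityDefect W₁ W₂ a Φ k (m + 1) α - localityDefect W₁ W₂ a Φ k m (α + 1) := by
  have key : ∀ t : ℕ → (W₁ →ₗ[ℂ] W₂),
      ∑ i ∈ Finset.range (k + 1 + 1), ((-1 : ℂ) ^ i * ((k + 1).choose i : ℂ)) • t i
        = ∑ i ∈ Finset.range (k + 1), ((-1 : ℂ) ^ i * (k.choose i : ℂ)) • t i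
          - ∑ i ∈ Finset.range (k + 1), ((-1 : ℂ) ^ i * (k.choose i : ℂ)) • t (i + 1) := by
    intro t
    have h1 : ∑ i ∈ Finset.range (k + 1), ((-1 : ℂ) ^ i * (k.choose i : ℂ)) • t i
        = ∑ i ∈ Finset.range (k + 1 + 1), ((-1 : ℂ) ^ i * (k.choose i : ℂ)) • t i := by
      rw [Finset.sum_range_succ _ (k + 1)]
      simp
    rw [h1, Finset.sum_range_succ' _ (k + 1), Finset.sum_range_succ' _ (k + 1),
      add_sub_right_comm, ← Finset.sum_sub_distrib]
    congr 1
    · refine Finset.sum_congr rfl fun i _ => ?_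
      rw [Nat.choose_succ_succ, ← sub_smul]
      congr 1
      push_cast
      ring
    · simp
  unfold localityDefect
  rw [key]
  congr 1
  · refine Finset.sum_congr rfl fun i _ => ?_
    rw [show m + ((k + 1 : ℕ) : ℤ) - i = m + 1 + k - i by push_cast; ring]
  · refine Finset.sum_congr rfl fun i _ => ?_
    rw [show m + ((k + 1 : ℕ) : ℤ) - ((i + 1 : ℕ) : ℤ) = m + k - i by push_cast; ring,
      show α + ((i + 1 : ℕ) : ℂ) = α + 1 + i by push_cast; ring]

theorem localityDefect_mono (a : V) (Φ : ℂ → (W₁ →ₗ[ℂ] W₂)) {k k' : ℕ} (hk : k ≤ k')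
    (h : ∀ (m : ℤ) (α : ℂ), localityDefect W₁ W₂ a Φ k m α = 0) (m : ℤ) (α : ℂ) :
    localityDefect W₁ W₂ a Φ k' m α = 0 := by
  induction hk generalizing m α with
  | refl => exact h m α
  | step _ ih => rw [Nat.succ_eq_add_one, localityDefect_succ, ih, ih, sub_zero]

/-- The space `G(W₁,W₂)` of generalized intertwining operators from `W₁` to `W₂`. -/
def G : Submodule ℂ (fieldSpace W₁ W₂) where
  carrier := {Φ | IsGeneralizedIntertwining W₁ W₂ Φ}
  zero_mem' := ⟨by simp, fun a => ⟨1, one_pos, by simp [localityDefect]⟩⟩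
  add_mem' {Φ Ψ} hΦ hΨ := by
    refine ⟨fun α => ?_, fun a => ?_⟩
    · simp only [Submodule.coe_add, Pi.add_apply, LinearMap.comp_add, LinearMap.add_comp,
        smul_add, ← hΦ.derivative, ← hΨ.derivative]
      abel
    · obtain ⟨k, hk, h⟩ := hΦ.locality a
      obtain ⟨k', _, h'⟩ := hΨ.locality a
      refine ⟨max k k', lt_of_lt_of_le hk (le_max_left _ _), fun m α => ?_⟩
      have e := localityDefect_mono W₁ W₂ a Φ.1 (le_max_left k k') h m α
      have e' := localityDefect_mono W₁ W₂ a Ψ.1 (le_max_right k k') h' m α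
      have : localityDefect W₁ W₂ a (Φ + Ψ : fieldSpace W₁ W₂).1 (max k k') m α
          = localityDefect W₁ W₂ a Φ.1 (max k k') m α
            + localityDefect W₁ W₂ a Ψ.1 (max k k') m α := by
        simp only [localityDefect, Submodule.coe_add, Pi.add_apply, LinearMap.comp_add,
          LinearMap.add_comp, ← Finset.sum_add_distrib, ← smul_add]
        refine Finset.sum_congr rfl fun i _ => ?_
        congr 1
        abel
      rw [this, e, e', add_zero]
  smul_mem' c Φ hΦ := by
    refine ⟨fun α => ?_, fun a => ?_⟩
    · simp only [Submodule.coe_smul, Pi.smul_apply, LinearMap.comp_smul, LinearMap.smul_comp,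
        ← smul_sub, hΦ.derivative, smul_comm c]
    · obtain ⟨k, hk, h⟩ := hΦ.locality a
      refine ⟨k, hk, fun m α => ?_⟩
      have : localityDefect W₁ W₂ a (c • Φ : fieldSpace W₁ W₂).1 k m α
          = c • localityDefect W₁ W₂ a Φ.1 k m α := by
        simp only [localityDefect, Submodule.coe_smul, Pi.smul_apply, LinearMap.comp_smul,
          LinearMap.smul_comp, Finset.smul_sum, ← smul_sub, smul_comm c]
      rw [this, h, smul_zero]

/-- The subspace `N` is a `V`-module inside `G(W₁,W₂)`: it is contained in `G(W₁,W₂)`, stable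
under the action of `V`, and a `V`-module for the restricted action. -/
structure IsModuleInsideG (N : Submodule ℂ (fieldSpace W₁ W₂)) : Prop where
  le : N ≤ G W₁ W₂
  invariant : IsInvariant (circ W₁ W₂) N
  isModule : IsModule (restrictAction (circ W₁ W₂) N invariant)

/-- The sum `Δ(W₁,W₂)` of all `V`-modules inside `G(W₁,W₂)`. -/
def Delta : Submodule ℂ (fieldSpace W₁ W₂) := sSup {N | IsModuleInsideG W₁ W₂ N}

/-- The operator `F̄(Φ,x) = Φ(x)` on `Δ(W₁,W₂)`. -/
def barF : OperatorSeries (Delta W₁ W₂) W₁ W₂ :=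
  (fieldSpace W₁ W₂).subtype ∘ₗ (Delta W₁ W₂).subtype

theorem barF_truncated : IsTruncated (barF W₁ W₂) := fun Φ w α => Φ.1.2 α w

variable {W₁ W₂}

/-- A `V`-module inside `G(W₁,W₂)`, as a `V`-module. -/
noncomputable def IsModuleInsideG.toVModule {N : Submodule ℂ (fieldSpace W₁ W₂)}
    (hN : IsModuleInsideG W₁ W₂ N) : VModule.{u, v} V where
  carrier := N
  Y := restrictAction (circ W₁ W₂) N hN.invariant
  isModule := hN.isModule

end GeneralizedIntertwining

/-- The contragredient `M'` as a `V`-module, given that its vertex operator map satisfies the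
axioms of a `V`-module. -/
noncomputable def contragredient {V : Type u} [AddCommGroup V] [Module ℂ V] [VertexOperatorAlgebra V]
    (M : VModule.{u, v} V) (hM : IsModule (contragredientAction M)) : VModule.{u, v} V where
  carrier := restrictedDual M
  Y := contragredientAction M
  isModule := hM

end VOA

-- The space `Delta W₁ W₂` represents the functor sending a module `M` to the intertwining operators
-- of type `(W₂ over M W₁)`, and two dualities turn this into the universal property of a tensor
-- product.
--
-- Representability comes from reading an operator `I` as the map `u ↦ I(u,x)` into fields. The `m =
-- 0` components of the Jacobi identity say that this map is a homomorphism for `circ`, and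
-- truncation of the action on `u` gives locality, so the image is a module inside `G`
-- (`Inter.isModuleInsideG_range`). Conversely, evaluation on a module inside `G` is an intertwining
-- operator (`IsModuleInsideG.inter`), because locality and the definition of `circ` give enough
-- components to recover the whole Jacobi identity (`JacobiSummable.isJacobi_of_components`).
--
-- The finiteness hypotheses enter only in `isModuleInsideG_Delta`. A module inside `G` is a sum of
-- irreducibles, each the image of some `S i` under an intertwining operator. Such an operator is a
-- combination of finitely many fixed ones, so every module inside `G` lies in one finite sum of
-- images, which is itself a module and hence equals `Delta W₁ W₂`.
--
-- The dualities are the adjoint, which passes between types `(W over W₁ W₂')` and `(W₂ over W₁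
-- W')`, and the transpose, which passes on to `(W₂ over W' W₁)`. Both preserve intertwining
-- operators: for the adjoint this rests on `IsJacobi.opposite` and the conjugation of modes by
-- `e^{xL(1)}`, for the transpose on conjugation by `e^{xL(-1)}`. Both are invertible up to phases:
-- the adjoint is undone by the adjoint with the inverse phase, and the double transpose multiplies
-- the mode of index `α` by a function of period one, which can be divided out. With `Hom(W',Δ)`
-- turned into `Hom(Δ',W)` by double duality, an operator `I` of type `(W over W₁ W₂')` factors
-- through `(F̄^t)'` (`exists_hom_transposeAdjoint`). The factorization is unique because a field is
-- determined by its coefficients (`eq_zero_of_transposeAdjoint`).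
--
-- The contragredient axioms need no separate computation: the vertex operator map of `M` is an
-- intertwining operator of type `(M over V M)`, and the contragredient action is its adjoint.

universe w

namespace VOA

/-! ### Finite sums over the natural numbers and a binomial identity. -/

section FiniteSums

variable {B : Type*} [AddCommGroup B] [Module ℂ B]

theorem finsum_eq_sum_range {f : ℕ → B} {N : ℕ} (h : ∀ i, N ≤ i → f i = 0) :
    ∑ᶠ i, f i = ∑ i ∈ Finset.range N, f i :=
  finsum_eq_sum_of_support_subset _ fun i hi => by
    by_contra hlt
    exact hi (h i (by simpa using hlt))

theorem finsum_succ_shift {f : ℕ → B} (h : ∃ N, ∀ i, N ≤ i → f i = 0) :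
    ∑ᶠ i, f i = f 0 + ∑ᶠ i, f (i + 1) := by
  obtain ⟨N, hN⟩ := h
  rw [finsum_eq_sum_range (N := N + 1) fun i hi => hN i (by omega),
    finsum_eq_sum_range (N := N) fun i hi => hN _ (by omega), Finset.sum_range_succ', add_comm]

theorem finsum_finsum_antidiagonal {F : ℕ → ℕ → B} {N : ℕ} (h : ∀ i j, N ≤ i + j → F i j = 0) :
    ∑ᶠ i, ∑ᶠ j, F i j = ∑ᶠ s, ∑ p ∈ Finset.HasAntidiagonal.antidiagonal s, F p.1 p.2 := by
  rw [finsum_eq_sum_range (N := N) fun s hs => Finset.sum_eq_zero fun p hp => h _ _ (by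
      have := Finset.HasAntidiagonal.mem_antidiagonal.mp hp; omega),
    finsum_eq_sum_range (N := N) fun i hi => by
      rw [finsum_eq_sum_range (N := 0) fun j _ => h _ _ (by omega), Finset.range_zero,
        Finset.sum_empty]]
  rw [Finset.sum_congr rfl fun i _ => finsum_eq_sum_range (N := N) fun j hj => h i j (by omega)]
  rw [← Finset.sum_product', Finset.sum_sigma']
  refine Finset.sum_bij_ne_zero (fun p _ _ => ⟨p.1 + p.2, p⟩) ?_ ?_ ?_ ?_
  · intro p hp hne
    have : p.1 + p.2 < N := by
      by_contra hlt
      exact hne (h _ _ (by omega))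
    simp [this]
  · intro p _ _ q _ _ heq
    simp only [Sigma.mk.injEq] at heq
    exact eq_of_heq heq.2
  · rintro ⟨s, p⟩ hp hne
    simp only [Finset.mem_sigma, Finset.mem_range, Finset.HasAntidiagonal.mem_antidiagonal] at hp
    obtain ⟨hs, rfl⟩ := hp
    exact ⟨p, by simp; omega, hne, rfl⟩
  · intros; rfl

theorem map_finsum_nat {C : Type*} [AddCommGroup C] [Module ℂ C] (φ : B →ₗ[ℂ] C) {f : ℕ → B}
    (h : ∃ N, ∀ i, N ≤ i → f i = 0) : φ (∑ᶠ i, f i) = ∑ᶠ i, φ (f i) := by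
  obtain ⟨N, hN⟩ := h
  rw [finsum_eq_sum_range hN, finsum_eq_sum_range (N := N) fun i hi => by rw [hN i hi, map_zero],
    map_sum]

/-- On the antidiagonal `i + j = s`, upper negation turns `C(m+l-i, j)` into `(-1)^j C(s-m-l-1, j)`,
whose upper entry no longer depends on `i`. Vandermonde then gives `(-1)^s C(s-m-1, s)`, and a
second negation finishes. This identity drives both the adjoint and the transpose. -/
theorem sum_antidiagonal_choose_mul_choose (l m : ℤ) (s : ℕ) :
    ∑ p ∈ Finset.HasAntidiagonal.antidiagonal s,
      (-1) ^ p.1 * Ring.choose l p.1 * Ring.choose (m + l - p.1) p.2 = Ring.choose m s := by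
  have h1 : ∀ p ∈ Finset.HasAntidiagonal.antidiagonal s,
      (-1) ^ p.1 * Ring.choose l p.1 * Ring.choose (m + l - p.1) p.2
        = (-1) ^ s * (Ring.choose l p.1 * Ring.choose (s - m - l - 1) p.2) := by
    rintro ⟨i, j⟩ hp
    have hs : i + j = s := Finset.HasAntidiagonal.mem_antidiagonal.mp hp
    have := Ring.choose_neg (R := ℤ) (i - m - l) j
    rw [show -((i : ℤ) - m - l) = m + l - i by ring,
      show (i : ℤ) - m - l + j - 1 = s - m - l - 1 by rw [← hs]; push_cast; ring] at this
    simp only [this, ← hs, Units.smul_def, Int.coe_negOnePow_natCast, smul_eq_mul]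
    push_cast
    ring_nf
  rw [Finset.sum_congr rfl h1, ← Finset.mul_sum, ← Ring.add_choose_eq _ (Commute.all _ _)]
  have := Ring.choose_neg (R := ℤ) (-m) s
  rw [neg_neg] at this
  rw [this, show l + (s - m - l - 1) = -m + s - 1 by ring]
  simp [Units.smul_def, Int.coe_negOnePow_natCast]

end FiniteSums

/-! ### The Jacobi identity for three abstract families of vectors. -/

section JacobiIdentity

variable {C : Type*} [AddCommGroup C] [Module ℂ C]

/-- The first sum in the Jacobi identity, for `X p α = a_p I(u)_α w`. -/
noncomputable def jacobiLeft (X : ℤ → ℂ → C) (l m : ℤ) (α : ℂ) : C :=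
  ∑ᶠ i : ℕ, ((-1 : ℂ) ^ i * (Ring.choose l i : ℤ)) • X (m + l - i) (α + i)

/-- The second sum in the Jacobi identity, for `Y p α = I(u)_α a_p w`. -/
noncomputable def jacobiMiddle (Y : ℤ → ℂ → C) (l m : ℤ) (α : ℂ) : C :=
  ∑ᶠ i : ℕ, ((-1 : ℂ) ^ (l + i) * (Ring.choose l i : ℤ)) • Y (m + i) (α + l - i)

/-- The third sum in the Jacobi identity, for `Z p α = I(a_p u)_α w`. -/
noncomputable def jacobiRight (Z : ℤ → ℂ → C) (l m : ℤ) (α : ℂ) : C :=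
  ∑ᶠ i : ℕ, ((Ring.choose m i : ℤ) : ℂ) • Z (l + i) (α + m - i)

/-- The truncation conditions that make the sums in the Jacobi identity finite. -/
structure JacobiSummable (X Y Z : ℤ → ℂ → C) : Prop where
  left : ∀ (m : ℤ) (α : ℂ), ∃ N : ℕ, ∀ i : ℕ, N ≤ i → X (m - i) (α + i) = 0
  middle : ∀ (m : ℤ) (α : ℂ), ∃ N : ℕ, ∀ i : ℕ, N ≤ i → Y (m + i) (α - i) = 0
  right : ∃ N : ℤ, ∀ p, N ≤ p → ∀ α, Z p α = 0

/-- The Jacobi identity for three families of vectors. -/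
structure IsJacobi (X Y Z : ℤ → ℂ → C) : Prop extends JacobiSummable X Y Z where
  jacobi : ∀ (l m : ℤ) (α : ℂ), jacobiLeft X l m α - jacobiMiddle Y l m α = jacobiRight Z l m α

variable {X Y Z X' Y' Z' : ℤ → ℂ → C}

namespace JacobiSummable

theorem right_nat (h : JacobiSummable X Y Z) (l : ℤ) :
    ∃ N : ℕ, ∀ i : ℕ, N ≤ i → ∀ α, Z (l + i) α = 0 := by
  obtain ⟨N, hN⟩ := h.right
  exact ⟨(N - l).toNat, fun i hi => hN _ (by omega)⟩

theorem add (h : JacobiSummable X Y Z) (h' : JacobiSummable X' Y' Z') :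
    JacobiSummable (X + X') (Y + Y') (Z + Z') := by
  refine ⟨fun m α => ?_, fun m α => ?_, ?_⟩
  · obtain ⟨N, hN⟩ := h.left m α
    obtain ⟨N', hN'⟩ := h'.left m α
    exact ⟨max N N', fun i hi => by simp [hN i (by omega), hN' i (by omega)]⟩
  · obtain ⟨N, hN⟩ := h.middle m α
    obtain ⟨N', hN'⟩ := h'.middle m α
    exact ⟨max N N', fun i hi => by simp [hN i (by omega), hN' i (by omega)]⟩
  · obtain ⟨N, hN⟩ := h.right
    obtain ⟨N', hN'⟩ := h'.right
    exact ⟨max N N', fun i hi α => by simp [hN i (by omega), hN' i (by omega)]⟩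

theorem map {D : Type*} [AddCommGroup D] [Module ℂ D] (h : JacobiSummable X Y Z)
    (φ : C →ₗ[ℂ] D) :
    JacobiSummable (fun p α => φ (X p α)) (fun p α => φ (Y p α)) (fun p α => φ (Z p α)) := by
  refine ⟨fun m α => ?_, fun m α => ?_, ?_⟩
  · obtain ⟨N, hN⟩ := h.left m α
    exact ⟨N, fun i hi => by simp [hN i hi]⟩
  · obtain ⟨N, hN⟩ := h.middle m α
    exact ⟨N, fun i hi => by simp [hN i hi]⟩
  · obtain ⟨N, hN⟩ := h.right
    exact ⟨N, fun i hi α => by simp [hN i hi]⟩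

theorem left_eventually (h : JacobiSummable X Y Z) (l m : ℤ) (α : ℂ) :
    ∃ N : ℕ, ∀ i : ℕ, N ≤ i → X (m + l - i) (α + i) = 0 := h.left (m + l) α

theorem middle_eventually (h : JacobiSummable X Y Z) (l m : ℤ) (α : ℂ) :
    ∃ N : ℕ, ∀ i : ℕ, N ≤ i → Y (m + i) (α + l - i) = 0 := h.middle m (α + l)

theorem left_support (h : JacobiSummable X Y Z) (l m : ℤ) (α : ℂ) (c : ℕ → ℂ) :
    (Function.support fun i : ℕ => c i • X (m + l - i) (α + i)).Finite := by
  obtain ⟨N, hN⟩ := h.left_eventually l m α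
  exact finite_support_of_eventually _ N fun i hi => by simp [hN i hi]

theorem middle_support (h : JacobiSummable X Y Z) (l m : ℤ) (α : ℂ) (c : ℕ → ℂ) :
    (Function.support fun i : ℕ => c i • Y (m + i) (α + l - i)).Finite := by
  obtain ⟨N, hN⟩ := h.middle_eventually l m α
  exact finite_support_of_eventually _ N fun i hi => by simp [hN i hi]

theorem right_support (h : JacobiSummable X Y Z) (l m : ℤ) (α : ℂ) (c : ℕ → ℂ) :
    (Function.support fun i : ℕ => c i • Z (l + i) (α + m - i)).Finite := by
  obtain ⟨N, hN⟩ := h.right_nat l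
  exact finite_support_of_eventually _ N fun i hi => by simp [hN i hi]

theorem map_jacobiLeft {D : Type*} [AddCommGroup D] [Module ℂ D] (h : JacobiSummable X Y Z)
    (φ : C →ₗ[ℂ] D) (l m : ℤ) (α : ℂ) :
    φ (jacobiLeft X l m α) = jacobiLeft (fun p α => φ (X p α)) l m α := by
  obtain ⟨N, hN⟩ := h.left_eventually l m α
  rw [jacobiLeft, map_finsum_nat φ ⟨N, fun i hi => by rw [hN i hi, smul_zero]⟩]
  simp only [map_smul, jacobiLeft]

theorem map_jacobiMiddle {D : Type*} [AddCommGroup D] [Module ℂ D] (h : JacobiSummable X Y Z)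
    (φ : C →ₗ[ℂ] D) (l m : ℤ) (α : ℂ) :
    φ (jacobiMiddle Y l m α) = jacobiMiddle (fun p α => φ (Y p α)) l m α := by
  obtain ⟨N, hN⟩ := h.middle_eventually l m α
  rw [jacobiMiddle, map_finsum_nat φ ⟨N, fun i hi => by rw [hN i hi, smul_zero]⟩]
  simp only [map_smul, jacobiMiddle]

theorem map_jacobiRight {D : Type*} [AddCommGroup D] [Module ℂ D] (h : JacobiSummable X Y Z)
    (φ : C →ₗ[ℂ] D) (l m : ℤ) (α : ℂ) :
    φ (jacobiRight Z l m α) = jacobiRight (fun p α => φ (Z p α)) l m α := by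
  obtain ⟨N, hN⟩ := h.right_nat l
  rw [jacobiRight, map_finsum_nat φ ⟨N, fun i hi => by rw [hN i hi, smul_zero]⟩]
  simp only [map_smul, jacobiRight]

/-- The Jacobi identity may be tested after applying a separating family of linear maps. -/
theorem isJacobi_of_separating (h : JacobiSummable X Y Z) {ι : Type*} {D : ι → Type*}
    [∀ i, AddCommGroup (D i)] [∀ i, Module ℂ (D i)] (φ : ∀ i, C →ₗ[ℂ] D i)
    (hφ : ∀ x y, (∀ i, φ i x = φ i y) → x = y)
    (hj : ∀ i, IsJacobi (fun p α => φ i (X p α)) (fun p α => φ i (Y p α))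
      (fun p α => φ i (Z p α))) : IsJacobi X Y Z where
  toJacobiSummable := h
  jacobi l m α := hφ _ _ fun i => by
    rw [map_sub, h.map_jacobiLeft, h.map_jacobiMiddle, h.map_jacobiRight, (hj i).jacobi]

end JacobiSummable

namespace IsJacobi

theorem add (h : IsJacobi X Y Z) (h' : IsJacobi X' Y' Z') :
    IsJacobi (X + X') (Y + Y') (Z + Z') where
  toJacobiSummable := h.toJacobiSummable.add h'.toJacobiSummable
  jacobi l m α := by
    have e := h.jacobi l m α
    have e' := h'.jacobi l m α
    simp only [jacobiLeft, jacobiMiddle, jacobiRight, Pi.add_apply, smul_add] at e e' ⊢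
    rw [finsum_add_distrib (h.left_support l m α _) (h'.left_support l m α _),
      finsum_add_distrib (h.middle_support l m α _) (h'.middle_support l m α _),
      finsum_add_distrib (h.right_support l m α _) (h'.right_support l m α _), ← e, ← e']
    abel

theorem map {D : Type*} [AddCommGroup D] [Module ℂ D] (h : IsJacobi X Y Z) (φ : C →ₗ[ℂ] D) :
    IsJacobi (fun p α => φ (X p α)) (fun p α => φ (Y p α)) (fun p α => φ (Z p α)) where
  toJacobiSummable := h.toJacobiSummable.map φ
  jacobi l m α := by
    rw [← h.map_jacobiLeft φ, ← h.map_jacobiMiddle φ, ← h.map_jacobiRight φ, ← map_sub, h.jacobi]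

theorem smul (h : IsJacobi X Y Z) (c : ℂ) : IsJacobi (c • X) (c • Y) (c • Z) :=
  h.map (c • LinearMap.id)

theorem zero : IsJacobi (0 : ℤ → ℂ → C) 0 0 where
  left _ _ := ⟨0, fun _ _ => rfl⟩
  middle _ _ := ⟨0, fun _ _ => rfl⟩
  right := ⟨0, fun _ _ _ => rfl⟩
  jacobi l m α := by simp [jacobiLeft, jacobiMiddle, jacobiRight]

theorem sum {ι : Type*} (s : Finset ι) {X Y Z : ι → ℤ → ℂ → C}
    (h : ∀ i ∈ s, IsJacobi (X i) (Y i) (Z i)) :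
    IsJacobi (∑ i ∈ s, X i) (∑ i ∈ s, Y i) (∑ i ∈ s, Z i) := by
  classical
  induction s using Finset.induction_on with
  | empty => simpa using zero
  | insert i s hi ih =>
    simp only [Finset.sum_insert hi]
    exact (h i (Finset.mem_insert_self i s)).add
      (ih fun j hj => h j (Finset.mem_insert_of_mem hj))

/-- The Jacobi identity is preserved by multiplication of the modes by a function of period
one. -/
theorem periodic (h : IsJacobi X Y Z) {c : ℂ → ℂ} (hc : ∀ (α : ℂ) (n : ℤ), c (α + n) = c α) :
    IsJacobi (fun p α => c α • X p α) (fun p α => c α • Y p α) (fun p α => c α • Z p α) := by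
  have hn : ∀ (α : ℂ) (n : ℕ), c (α + n) = c α := fun α n => by simpa using hc α n
  have hs : ∀ (α : ℂ) (n : ℕ), c (α - n) = c α := fun α n => by
    simpa [sub_eq_add_neg] using hc α (-n)
  refine ⟨⟨fun m α => ?_, fun m α => ?_, ?_⟩, fun l m α => ?_⟩
  · obtain ⟨N, hN⟩ := h.left m α
    exact ⟨N, fun i hi => by simp [hN i hi]⟩
  · obtain ⟨N, hN⟩ := h.middle m α
    exact ⟨N, fun i hi => by simp [hN i hi]⟩
  · obtain ⟨N, hN⟩ := h.right
    exact ⟨N, fun i hi α => by simp [hN i hi]⟩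
  · have e := congrArg (c α • ·) (h.jacobi l m α)
    simp only [smul_sub] at e
    simp only [jacobiLeft, jacobiMiddle, jacobiRight, hn, hs, hc, smul_comm _ (c α)] at e ⊢
    rw [← smul_finsum' _ (h.left_support l m α _), ← smul_finsum' _ (h.middle_support l m α _),
      ← smul_finsum' _ (h.right_support l m α _)]
    exact e

end IsJacobi

end JacobiIdentity

/-! ### Recursion and reflection symmetry of the Jacobi identity. -/

section JacobiRecursion

variable {C : Type*} [AddCommGroup C] [Module ℂ C] {X Y Z : ℤ → ℂ → C}

theorem finsum_choose_succ (l : ℤ) {t : ℕ → C} (ht : ∃ N, ∀ i, N ≤ i → t i = 0) :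
    ∑ᶠ i : ℕ, ((Ring.choose (l + 1) i : ℤ) : ℂ) • t i
      = (∑ᶠ i : ℕ, ((Ring.choose l i : ℤ) : ℂ) • t i)
        + ∑ᶠ i : ℕ, ((Ring.choose l i : ℤ) : ℂ) • t (i + 1) := by
  obtain ⟨N, hN⟩ := ht
  have h0 : ∀ (c : ℕ → ℂ) i, N ≤ i → c i • t i = 0 := fun c i hi => by rw [hN i hi, smul_zero]
  have h1 : ∀ (c : ℕ → ℂ) i, N ≤ i → c i • t (i + 1) = 0 := fun c i hi => by
    rw [hN _ (by omega), smul_zero]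
  rw [finsum_succ_shift ⟨N, h0 _⟩, finsum_succ_shift (f := fun i => ((Ring.choose l i : ℤ) : ℂ) • t i)
    ⟨N, h0 _⟩, add_assoc, ← finsum_add_distrib (finite_support_of_eventually _ N fun i hi => by
      rw [hN _ (by omega), smul_zero]) (finite_support_of_eventually _ N (h1 _))]
  congr 1
  · simp
  · refine finsum_congr fun i => ?_
    rw [Ring.choose_succ_succ, ← add_smul]
    congr 1
    push_cast
    ring

/-- This is `(x₁-x₂)^{l+1} = (x₁-x₂)(x₁-x₂)^l` in coefficients: multiplication by `x₁` raises `m`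
and multiplication by `x₂` raises `α`. The middle and right terms obey the same recursion. -/
theorem jacobiLeft_succ (h : JacobiSummable X Y Z) (l m : ℤ) (α : ℂ) :
    jacobiLeft X (l + 1) m α = jacobiLeft X l (m + 1) α - jacobiLeft X l m (α + 1) := by
  have key : ∀ l m α, jacobiLeft X l m α
      = ∑ᶠ i : ℕ, ((Ring.choose l i : ℤ) : ℂ) • ((-1 : ℂ) ^ i • X (m + l - i) (α + i)) :=
    fun l m α => finsum_congr fun i => by rw [smul_smul, mul_comm]
  rw [key, finsum_choose_succ, key, key, sub_eq_add_neg, ← finsum_neg_distrib]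
  · congr 1
    · refine finsum_congr fun i => ?_
      rw [show m + (l + 1) - (i : ℤ) = m + 1 + l - i by ring]
    · refine finsum_congr fun i => ?_
      rw [show m + (l + 1) - ((i + 1 : ℕ) : ℤ) = m + l - i by push_cast; ring,
        show α + ((i + 1 : ℕ) : ℂ) = α + 1 + i by push_cast; ring, pow_succ, ← smul_neg, ← neg_smul]
      simp
  · obtain ⟨N, hN⟩ := h.left_eventually (l + 1) m α
    exact ⟨N, fun i hi => by rw [hN i hi, smul_zero]⟩

theorem neg_one_zpow_add (l : ℤ) (i : ℕ) : (-1 : ℂ) ^ (l + i) = (-1) ^ l * (-1) ^ i := by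
  rw [zpow_add₀ (by norm_num), zpow_natCast]

theorem jacobiMiddle_succ (h : JacobiSummable X Y Z) (l m : ℤ) (α : ℂ) :
    jacobiMiddle Y (l + 1) m α = jacobiMiddle Y l (m + 1) α - jacobiMiddle Y l m (α + 1) := by
  have key : ∀ l m α, jacobiMiddle Y l m α
      = ∑ᶠ i : ℕ, ((Ring.choose l i : ℤ) : ℂ) • ((-1 : ℂ) ^ (l + i) • Y (m + i) (α + l - i)) :=
    fun l m α => finsum_congr fun i => by rw [smul_smul, mul_comm]
  rw [key, finsum_choose_succ, key, key, sub_eq_add_neg, ← finsum_neg_distrib, add_comm]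
  · congr 1
    · refine finsum_congr fun i => ?_
      rw [show m + ((i + 1 : ℕ) : ℤ) = m + 1 + i by push_cast; ring,
        show α + ((l + 1 : ℤ) : ℂ) - ((i + 1 : ℕ) : ℂ) = α + l - i by push_cast; ring,
        neg_one_zpow_add, neg_one_zpow_add, zpow_add₀ (by norm_num)]
      simp [pow_succ]
    · refine finsum_congr fun i => ?_
      rw [show α + ((l + 1 : ℤ) : ℂ) - i = α + 1 + l - i by push_cast; ring, ← smul_neg, ← neg_smul,
        neg_one_zpow_add, neg_one_zpow_add, zpow_add₀ (by norm_num)]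
      simp
  · obtain ⟨N, hN⟩ := h.middle_eventually (l + 1) m α
    exact ⟨N, fun i hi => by rw [hN i hi, smul_zero]⟩

/-- Here Pascal's rule is applied to `m` rather than to `l`: in this term `x₁` is expanded as `x₂ +
x₀`, so that `x₀ = x₁ - x₂` again. -/
theorem jacobiRight_succ (h : JacobiSummable X Y Z) (l m : ℤ) (α : ℂ) :
    jacobiRight Z (l + 1) m α = jacobiRight Z l (m + 1) α - jacobiRight Z l m (α + 1) := by
  obtain ⟨N, hN⟩ := h.right_nat l
  rw [jacobiRight, jacobiRight, finsum_choose_succ _ ⟨N, fun i hi => hN i hi _⟩]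
  have : jacobiRight Z l m (α + 1)
      = ∑ᶠ i : ℕ, ((Ring.choose m i : ℤ) : ℂ) • Z (l + i) (α + ((m + 1 : ℤ) : ℂ) - i) :=
    finsum_congr fun i => by
      rw [show α + ((m + 1 : ℤ) : ℂ) - (i : ℂ) = α + 1 + m - i by push_cast; ring]
  rw [this, add_sub_cancel_left]
  refine finsum_congr fun i => ?_
  rw [show l + 1 + (i : ℤ) = l + ((i + 1 : ℕ) : ℤ) by push_cast; ring,
    show α + ((m + 1 : ℤ) : ℂ) - ((i + 1 : ℕ) : ℂ) = α + m - i by push_cast; ring]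

/-- The Jacobi identity follows from its components with large `l` and its components with
`m = 0`. -/
theorem JacobiSummable.isJacobi_of_components (h : JacobiSummable X Y Z) {K : ℤ}
    (hK : ∀ l, K ≤ l → ∀ (m : ℤ) (α : ℂ),
      jacobiLeft X l m α - jacobiMiddle Y l m α = jacobiRight Z l m α)
    (h0 : ∀ (l : ℤ) (α : ℂ), jacobiLeft X l 0 α - jacobiMiddle Y l 0 α = jacobiRight Z l 0 α) :
    IsJacobi X Y Z where
  toJacobiSummable := h
  jacobi := by
    set T : ℤ → ℤ → ℂ → C := fun l m α =>
      jacobiLeft X l m α - jacobiMiddle Y l m α - jacobiRight Z l m α with hT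
    have hrec : ∀ l m α, T (l + 1) m α = T l (m + 1) α - T l m (α + 1) := fun l m α => by
      simp only [hT, jacobiLeft_succ h, jacobiMiddle_succ h, jacobiRight_succ h]
      abel
    have hdown : ∀ n : ℕ, ∀ l, K - n ≤ l → ∀ m α, T l m α = 0 := by
      intro n
      induction n with
      | zero => exact fun l hl m α => sub_eq_zero.mpr (hK l (by simpa using hl) m α)
      | succ n ih =>
        intro l hl
        -- Once the defect `T` vanishes at `l + 1`, the recursion makes `T l` depend only on `m +
        -- α`. Its vanishing at `m = 0` for all `α` then spreads to every `m`.
        have hstep : ∀ m α, T l (m + 1) α = T l m (α + 1) := fun m α => by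
          have := hrec l m α
          rw [ih (l + 1) (by push_cast at hl; omega)] at this
          exact (sub_eq_zero.mp this.symm)
        intro m
        induction m using Int.induction_on with
        | zero => exact fun α => sub_eq_zero.mpr (h0 l α)
        | succ m ihm => exact fun α => by rw [hstep, ihm]
        | pred m ihm =>
          intro α
          have := hstep (-m - 1) (α - 1)
          rw [sub_add_cancel, sub_add_cancel, ihm] at this
          exact this.symm
    intro l m α
    exact sub_eq_zero.mp (hdown (K - l).toNat l (by omega) m α)

/-- The symmetry of the Jacobi identity that underlies contragredient modules and adjoint
intertwining operators. -/
theorem IsJacobi.opposite (h : IsJacobi X Y Z) (P : ℤ) (Q : ℂ) :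
    IsJacobi (fun p α => Y (P - p) (Q - α)) (fun p α => X (P - p) (Q - α))
      (fun p α => (-(-1 : ℂ) ^ p) • ∑ᶠ i : ℕ, ((Ring.choose (P - p) i : ℤ) : ℂ) •
        Z (p + i) (P + Q - 2 * p - i - α)) := by
  refine ⟨⟨fun m α => ?_, fun m α => ?_, ?_⟩, fun l m α => ?_⟩
  · obtain ⟨N, hN⟩ := h.middle (P - m) (Q - α)
    refine ⟨N, fun i hi => ?_⟩
    rw [← hN i hi]
    ring_nf
  · obtain ⟨N, hN⟩ := h.left (P - m) (Q - α)
    refine ⟨N, fun i hi => ?_⟩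
    rw [← hN i hi]
    ring_nf
  · obtain ⟨N, hN⟩ := h.right
    refine ⟨N, fun p hp α => ?_⟩
    simp only [fun i : ℕ => hN (p + i) (by omega), smul_zero, finsum_zero]
  · have hL : jacobiLeft (fun p α => Y (P - p) (Q - α)) l m α
        = (-1 : ℂ) ^ l • jacobiMiddle Y l (P - l - m) (Q - α - l) := by
      rw [jacobiLeft, jacobiMiddle, smul_finsum' _ (h.middle_support l _ _ _)]
      refine finsum_congr fun i => ?_
      rw [smul_smul, neg_one_zpow_add, ← mul_assoc, ← mul_assoc, ← mul_zpow]
      simp only [mul_neg, mul_one, neg_neg, one_zpow, one_mul]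
      congr 2 <;> ring
    have hM : jacobiMiddle (fun p α => X (P - p) (Q - α)) l m α
        = (-1 : ℂ) ^ l • jacobiLeft X l (P - l - m) (Q - α - l) := by
      rw [jacobiLeft, jacobiMiddle, smul_finsum' _ (h.left_support l _ _ _)]
      refine finsum_congr fun i => ?_
      rw [smul_smul, neg_one_zpow_add, ← mul_assoc]
      congr 2 <;> ring
    rw [hL, hM, ← smul_sub, ← neg_sub, h.jacobi, smul_neg, ← neg_smul]
    obtain ⟨N, hN⟩ := h.right_nat l
    have hZ : ∀ (c : ℂ) (i j : ℕ) α, N ≤ i + j → c • Z (l + i + j) α = 0 := fun c i j α hij => by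
      have := hN (i + j) hij α
      rw [show l + (i : ℤ) + j = l + ((i + j : ℕ) : ℤ) by push_cast; ring, this, smul_zero]
    have hin : ∀ i : ℕ, ((Ring.choose m i : ℤ) : ℂ) • ((-(-1 : ℂ) ^ (l + i)) •
          ∑ᶠ j : ℕ, ((Ring.choose (P - (l + i)) j : ℤ) : ℂ) •
            Z (l + i + j) (P + Q - 2 * ((l + i : ℤ) : ℂ) - j - (α + m - i)))
        = (-(-1 : ℂ) ^ l) • ∑ᶠ j : ℕ, (((-1) ^ i * Ring.choose m i *
            Ring.choose (P - l - m + m - i) j : ℤ) : ℂ) •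
              Z (l + i + j) (P + Q - 2 * l - m - α - (i + j : ℕ)) := fun i => by
      rw [smul_smul, smul_finsum' _ (finite_support_of_eventually _ N fun j hj =>
          hZ _ i j _ (by omega)),
        smul_finsum' _ (finite_support_of_eventually _ N fun j hj => hZ _ i j _ (by omega))]
      refine finsum_congr fun j => ?_
      rw [smul_smul, smul_smul, neg_one_zpow_add]
      congr 1
      · rw [show P - (l + (i : ℤ)) = P - l - m + m - i by ring]
        push_cast
        ring
      · congr 1
        push_cast
        ring
    -- The right side has become a double sum whose vectors depend only on `i + j`. On each
    -- antidiagonal `sum_antidiagonal_choose_mul_choose` collapses the coefficients to the single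
    -- binomial `C(P-l-m, s)`.
    rw [jacobiRight, jacobiRight, finsum_congr hin]
    rw [← smul_finsum' _ (finite_support_of_eventually _ N fun i hi => by
      exact finsum_eq_zero_of_forall_eq_zero fun j => hZ _ i j _ (by omega))]
    rw [finsum_finsum_antidiagonal (N := N) fun i j hij => hZ _ i j _ hij]
    congr 1
    refine finsum_congr fun s => ?_
    rw [← sum_antidiagonal_choose_mul_choose m (P - l - m) s]
    push_cast
    rw [Finset.sum_smul]
    refine Finset.sum_congr rfl fun p hp => ?_
    have hs := Finset.HasAntidiagonal.mem_antidiagonal.mp hp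
    rw [← hs]
    congr 2
    · push_cast; ring
    · push_cast; ring

end JacobiRecursion

/-! ### Special components of the Jacobi identity. -/

section JacobiComponents

variable {C : Type*} [AddCommGroup C] [Module ℂ C]

theorem jacobiLeft_zero (X : ℤ → ℂ → C) (m : ℤ) (α : ℂ) : jacobiLeft X 0 m α = X m α := by
  rw [jacobiLeft, finsum_eq_sum_range (N := 1) fun i hi => by
    simp [Ring.choose_zero_pos ℤ (show 0 < i by omega)]]
  simp

theorem jacobiMiddle_zero (Y : ℤ → ℂ → C) (m : ℤ) (α : ℂ) : jacobiMiddle Y 0 m α = Y m α := by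
  rw [jacobiMiddle, finsum_eq_sum_range (N := 1) fun i hi => by
    simp [Ring.choose_zero_pos ℤ (show 0 < i by omega)]]
  simp

theorem jacobiRight_zero (Z : ℤ → ℂ → C) (l : ℤ) (α : ℂ) : jacobiRight Z l 0 α = Z l α := by
  rw [jacobiRight, finsum_eq_sum_range (N := 1) fun i hi => by
    simp [Ring.choose_zero_pos ℤ (show 0 < i by omega)]]
  simp

theorem choose_natCast_int (n k : ℕ) : Ring.choose (n : ℤ) k = (n.choose k : ℤ) :=
  Ring.choose_natCast (R := ℤ) n k

theorem jacobiRight_natCast (Z : ℤ → ℂ → C) (l : ℤ) (n : ℕ) (α : ℂ) :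
    jacobiRight Z l n α
      = ∑ i ∈ Finset.range (n + 1), (n.choose i : ℂ) • Z (l + i) (α + n - i) := by
  rw [jacobiRight, finsum_eq_sum_range (N := n + 1) fun i hi => by
    rw [choose_natCast_int, Nat.choose_eq_zero_of_lt (by omega)]; simp]
  refine Finset.sum_congr rfl fun i _ => ?_
  rw [choose_natCast_int]
  simp

end JacobiComponents

/-! ### Divided powers and conjugation by exponentials. -/

section DividedPowers

variable {A B : Type*} [AddCommGroup A] [Module ℂ A] [AddCommGroup B] [Module ℂ B]

/-- The divided power `T^k / k!`. -/
noncomputable def dpow (T : Module.End ℂ A) (k : ℕ) : Module.End ℂ A :=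
  (k.factorial : ℂ)⁻¹ • T ^ k

theorem dpow_zero (T : Module.End ℂ A) (x : A) : dpow T 0 x = x := by simp [dpow]

theorem apply_dpow (T : Module.End ℂ A) (k : ℕ) (x : A) :
    T (dpow T k x) = ((k : ℂ) + 1) • dpow T (k + 1) x := by
  have : (k : ℂ) + 1 ≠ 0 := by exact_mod_cast k.succ_ne_zero
  simp only [dpow, LinearMap.smul_apply, map_smul, smul_smul, Nat.factorial_succ, pow_succ',
    Module.End.mul_apply]
  congr 1
  push_cast
  field_simp

theorem dpow_apply (T : Module.End ℂ A) (k : ℕ) (x : A) :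
    dpow T k (T x) = ((k : ℂ) + 1) • dpow T (k + 1) x := by
  have : (k : ℂ) + 1 ≠ 0 := by exact_mod_cast k.succ_ne_zero
  simp only [dpow, LinearMap.smul_apply, smul_smul, Nat.factorial_succ, pow_succ,
    Module.End.mul_apply]
  congr 1
  push_cast
  field_simp

theorem dpow_dpow (T : Module.End ℂ A) (j k : ℕ) (x : A) :
    dpow T j (dpow T k x) = ((j + k).choose j : ℂ) • dpow T (j + k) x := by
  simp only [dpow, LinearMap.smul_apply, map_smul, smul_smul, pow_add, Module.End.mul_apply]
  congr 1
  have h : ((j + k).choose j * j.factorial * k.factorial : ℂ) = (j + k).factorial := by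
    rw [Nat.choose_symm_add]
    exact_mod_cast Nat.add_choose_mul_factorial_mul_factorial j k
  have h1 : (j.factorial : ℂ) ≠ 0 := by exact_mod_cast j.factorial_ne_zero
  have h2 : (k.factorial : ℂ) ≠ 0 := by exact_mod_cast k.factorial_ne_zero
  have h3 : ((j + k).factorial : ℂ) ≠ 0 := by exact_mod_cast (j + k).factorial_ne_zero
  rw [eq_comm, mul_inv_eq_iff_eq_mul₀ h3, ← h]
  field_simp

theorem sum_antidiagonal_shift_left (t : ℕ) (c : ℕ → ℕ → ℂ) (G : ℕ → ℕ → B) :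
    ∑ p ∈ Finset.HasAntidiagonal.antidiagonal t, c p.1 p.2 • G (p.1 + 1) p.2
      = ∑ p ∈ Finset.HasAntidiagonal.antidiagonal (t + 1),
        (if p.1 = 0 then 0 else c (p.1 - 1) p.2) • G p.1 p.2 := by
  rw [Finset.Nat.sum_antidiagonal_succ]
  simp

theorem sum_antidiagonal_shift_right (t : ℕ) (c : ℕ → ℕ → ℂ) (G : ℕ → ℕ → B) :
    ∑ p ∈ Finset.HasAntidiagonal.antidiagonal t, c p.1 p.2 • G p.1 (p.2 + 1)
      = ∑ p ∈ Finset.HasAntidiagonal.antidiagonal (t + 1),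
        (if p.2 = 0 then 0 else c p.1 (p.2 - 1)) • G p.1 p.2 := by
  rw [Finset.Nat.sum_antidiagonal_succ']
  simp

theorem sum_antidiagonal_leibniz (s : ℕ) (G : ℕ → ℕ → B) :
    ∑ p ∈ Finset.HasAntidiagonal.antidiagonal s,
        (((p.2 : ℂ) + 1) • G p.1 (p.2 + 1) + ((p.1 : ℂ) + 1) • G (p.1 + 1) p.2)
      = ((s : ℂ) + 1) • ∑ p ∈ Finset.HasAntidiagonal.antidiagonal (s + 1), G p.1 p.2 := by
  rw [Finset.sum_add_distrib, sum_antidiagonal_shift_right s (fun _ k => (k : ℂ) + 1) G,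
    sum_antidiagonal_shift_left s (fun t _ => (t : ℂ) + 1) G, ← Finset.sum_add_distrib,
    Finset.smul_sum]
  refine Finset.sum_congr rfl fun p hp => ?_
  have hs : ((p.1 : ℂ) + p.2) = s + 1 := by
    exact_mod_cast Finset.HasAntidiagonal.mem_antidiagonal.mp hp
  rw [← add_smul, ← hs]
  obtain ⟨i, j⟩ := p
  congr 1
  rcases i with _ | i <;> rcases j with _ | j <;> simp [add_comm]

/-- The hypothesis makes `F t` the `t`-th divided power of `F ↦ TF - FS` applied to `F 0`, so this
is the coefficient form of `e^{xT} F₀ = (∑ x^t F_t) e^{xS}`. Multiplication by `s + 1` reduces the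
induction to a Leibniz rule on antidiagonals. -/
theorem dpow_comm_left {S : Module.End ℂ A} {T : Module.End ℂ B} {F : ℕ → A →ₗ[ℂ] B}
    (h : ∀ t x, T (F t x) = F t (S x) + ((t : ℂ) + 1) • F (t + 1) x) (s : ℕ) (x : A) :
    dpow T s (F 0 x)
      = ∑ p ∈ Finset.HasAntidiagonal.antidiagonal s, F p.2 (dpow S p.1 x) := by
  induction s with
  | zero => simp [dpow_zero]
  | succ s ih =>
    have hs : (s : ℂ) + 1 ≠ 0 := by exact_mod_cast s.succ_ne_zero
    refine (smul_right_injective B hs) ?_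
    simp only
    rw [← apply_dpow, ih, map_sum, ← sum_antidiagonal_leibniz s fun k t => F t (dpow S k x)]
    refine Finset.sum_congr rfl fun p _ => ?_
    rw [h, apply_dpow, map_smul, add_comm]

/-- The mirror image: `F₀ e^{xS} = e^{xT} ∑ x^t F_t`, where `F t` is a divided power of `F ↦ FS -
TF`. -/
theorem dpow_comm_right {S : Module.End ℂ A} {T : Module.End ℂ B} {F : ℕ → A →ₗ[ℂ] B}
    (h : ∀ t x, F t (S x) = T (F t x) + ((t : ℂ) + 1) • F (t + 1) x) (s : ℕ) (x : A) :
    F 0 (dpow S s x)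
      = ∑ p ∈ Finset.HasAntidiagonal.antidiagonal s, dpow T p.1 (F p.2 x) := by
  induction s generalizing x with
  | zero => simp [dpow_zero]
  | succ s ih =>
    have hs : (s : ℂ) + 1 ≠ 0 := by exact_mod_cast s.succ_ne_zero
    refine (smul_right_injective B hs) ?_
    simp only
    rw [← map_smul, ← dpow_apply, ih,
      ← sum_antidiagonal_leibniz s fun k t => dpow T k (F t x)]
    refine Finset.sum_congr rfl fun p _ => ?_
    rw [h, map_add, dpow_apply, map_smul, add_comm]

theorem succ_mul_choose_succ (r : ℤ) (i : ℕ) :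
    ((i : ℤ) + 1) * Ring.choose r (i + 1) = (r - i) * Ring.choose r i := by
  have := Ring.choose_smul_choose r (Nat.le_succ i)
  simp only [Nat.succ_eq_add_one, Nat.choose_succ_self_right, Nat.add_sub_cancel_left,
    Ring.choose_one_right, nsmul_eq_mul] at this
  push_cast at this
  rw [this, mul_comm]

end DividedPowers

/-! ### Intertwining operators and their commutators with `L(-1)`, `L(0)`, `L(1)`. -/

section Inter

variable {V : Type u} [AddCommGroup V] [Module ℂ V] [VertexOperatorAlgebra V]

/-- Intertwining operators, for modules in arbitrary universes. -/
structure Inter {A : Type*} [AddCommGroup A] [Module ℂ A] {B : Type*} [AddCommGroup B] [Module ℂ B]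
    {C : Type*} [AddCommGroup C] [Module ℂ C] (YA : ModeMap V A) (YB : ModeMap V B)
    (YC : ModeMap V C) (I : OperatorSeries A B C) : Prop where
  truncated : IsTruncated I
  derivative : ∀ (u : A) (α : ℂ), I (L YA (-1) u) α = (-α) • I u (α - 1)
  isJacobi : ∀ (a : V) (u : A) (w : B), IsJacobi (fun p α => YC a p (I u α w))
    (fun p α => I u α (YB a p w)) (fun p α => I (YA a p u) α w)

variable {A : Type*} [AddCommGroup A] [Module ℂ A] {B : Type*} [AddCommGroup B] [Module ℂ B]
    {C : Type*} [AddCommGroup C] [Module ℂ C] {YA : ModeMap V A} {YB : ModeMap V B}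
    {YC : ModeMap V C} {I : OperatorSeries A B C}

theorem jacobiSummable_of_truncated (hA : ∀ a u, ∃ N : ℤ, ∀ n, N ≤ n → YA a n u = 0)
    (hB : ∀ a w, ∃ N : ℤ, ∀ n, N ≤ n → YB a n w = 0)
    (hI : IsTruncated I) (a : V) (u : A) (w : B) :
    JacobiSummable (fun p α => YC a p (I u α w))
      (fun p α => I u α (YB a p w)) (fun p α => I (YA a p u) α w) := by
  refine ⟨fun m α => ?_, fun m α => ?_, ?_⟩
  · obtain ⟨N, hN⟩ := truncated_nat hI u w α
    exact ⟨N, fun i hi => by rw [hN i hi, map_zero]⟩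
  · obtain ⟨N, hN⟩ := hB a w
    exact ⟨(N - m).toNat, fun i hi => by rw [hN _ (by omega), map_zero]⟩
  · obtain ⟨N, hN⟩ := hA a u
    exact ⟨N, fun i hi α => by simp [hN i hi]⟩

theorem isIntertwining_iff_inter {W₁ W₂ W₃ : VModule.{u, v} V} {I : OperatorSeries W₁ W₂ W₃} :
    IsIntertwining W₁ W₂ W₃ I ↔ Inter W₁.Y W₂.Y W₃.Y I :=
  ⟨fun h => ⟨h.truncated, h.derivative, fun a u w =>
    ⟨jacobiSummable_of_truncated W₁.isModule.truncation W₂.isModule.truncation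
      h.truncated a u w, h.jacobi a u w⟩⟩,
  fun h => ⟨h.truncated, h.derivative, fun a u w => (h.isJacobi a u w).jacobi⟩⟩

namespace Inter

/-- For `l = 0` both sums on the left of the Jacobi identity have a single term. The cases `a = ω`,
`n = 0, 1, 2` give the three Virasoro commutators below. -/
theorem commutator (h : Inter YA YB YC I) (a : V) (u : A) (w : B) (n : ℕ) (α : ℂ) :
    YC a n (I u α w) - I u α (YB a n w)
      = ∑ i ∈ Finset.range (n + 1), (n.choose i : ℂ) • I (YA a i u) (α + n - i) w := by
  have := (h.isJacobi a u w).jacobi 0 n α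
  rw [jacobiLeft_zero, jacobiMiddle_zero, jacobiRight_natCast] at this
  simpa using this

theorem L_neg_one (h : Inter YA YB YC I) (u : A) (w : B) (α : ℂ) :
    L YC (-1) (I u α w) - I u α (L YB (-1) w) = (-α) • I u (α - 1) w := by
  have := h.commutator VertexOperatorAlgebra.omega u w 0 α
  rw [← LinearMap.smul_apply, ← Pi.smul_apply, Pi.smul_apply, ← h.derivative]
  simpa [L] using this

theorem L_zero (h : Inter YA YB YC I) (u : A) (w : B) (α : ℂ) :
    L YC 0 (I u α w) = I u α (L YB 0 w) + I (L YA 0 u) α w - (α + 1) • I u α w := by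
  have := h.commutator VertexOperatorAlgebra.omega u w 1 α
  have hd := h.derivative u (α + 1)
  simp only [L, zero_add, neg_add_cancel] at hd ⊢
  simp [Finset.sum_range_succ, hd] at this
  rw [sub_eq_iff_eq_add] at this
  rw [this]
  module

theorem L_one (h : Inter YA YB YC I) (u : A) (w : B) (α : ℂ) :
    L YC 1 (I u α w) = I u α (L YB 1 w) + I (L YA 1 u) α w + (2 : ℂ) • I (L YA 0 u) (α + 1) w
      - (α + 2) • I u (α + 1) w := by
  have := h.commutator VertexOperatorAlgebra.omega u w 2 α
  have hd := h.derivative u (α + 2)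
  simp only [L, zero_add, neg_add_cancel] at hd ⊢
  rw [show α + 2 - 1 = α + 1 by ring] at hd
  simp [Finset.sum_range_succ, hd, show α + 2 - 1 = α + 1 by ring] at this
  rw [sub_eq_iff_eq_add] at this
  rw [show (1 + 1 : ℤ) = 2 by rfl, this]
  module

theorem mem_wtSpace (h : Inter YA YB YC I) {h₁ h₂ : ℂ} {u : A} (hu : u ∈ wtSpace YA h₁) {w : B}
    (hw : w ∈ wtSpace YB h₂) (α : ℂ) : I u α w ∈ wtSpace YC (h₁ + h₂ - α - 1) := by
  rw [wtSpace, Module.End.mem_eigenspace_iff] at hu hw ⊢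
  rw [h.L_zero, hu, hw]
  simp only [map_smul, Pi.smul_apply, LinearMap.smul_apply]
  module

end Inter

/-- A vertex operator map on a module, regarded as a series indexed by complex numbers. -/
noncomputable def modeSeries {M : Type*} [AddCommGroup M] [Module ℂ M] (Y : ModeMap V M) :
    OperatorSeries V M M where
  toFun a := Function.extend (Int.cast : ℤ → ℂ) (Y a) 0
  map_add' a b := by
    rw [map_add, ← Function.extend_add, add_zero]
  map_smul' c a := by
    rw [map_smul, RingHom.id_apply, ← Function.extend_smul, smul_zero]

section ModeSeries

variable {M : Type*} [AddCommGroup M] [Module ℂ M] {Y : ModeMap V M}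

theorem modeSeries_intCast (Y : ModeMap V M) (a : V) (n : ℤ) : modeSeries Y a (n : ℂ) = Y a n :=
  Int.cast_injective.extend_apply _ _ _

theorem modeSeries_eq_zero (Y : ModeMap V M) (a : V) {α : ℂ} (hα : ∀ n : ℤ, (n : ℂ) ≠ α) :
    modeSeries Y a α = 0 :=
  Function.extend_apply' _ _ _ fun ⟨n, hn⟩ => hα n hn

/-- This lets results on intertwining operators apply to the action itself. At indices outside `ℤ`
every term vanishes, since all sums stay in one coset of `ℤ`. -/
theorem modeSeries_inter (hY : IsWeakModule Y) :
    Inter (VertexOperatorAlgebra.Y (V := V)) Y Y (modeSeries Y) := by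
  have hT : IsTruncated (modeSeries Y) := by
    intro a u α
    by_cases hα : ∃ n : ℤ, (n : ℂ) = α
    · obtain ⟨k, rfl⟩ := hα
      obtain ⟨N, hN⟩ := hY.truncation a u
      refine ⟨N - k, fun n hn => ?_⟩
      rw [← Int.cast_add, modeSeries_intCast, hN _ (by omega)]
    · refine ⟨0, fun n _ => ?_⟩
      rw [modeSeries_eq_zero, LinearMap.zero_apply]
      intro k hk
      exact hα ⟨k - n, by push_cast; rw [hk]; ring⟩
  refine ⟨hT, fun a α => ?_, fun a b u =>
    ⟨jacobiSummable_of_truncated adjoint_isWeakModule.truncation hY.truncation hT a b u, fun l m α => ?_⟩⟩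
  · by_cases hα : ∃ n : ℤ, (n : ℂ) = α
    · obtain ⟨k, rfl⟩ := hα
      have := hY.derivative a k
      rw [modeSeries_intCast, this, show (k : ℂ) - 1 = ((k - 1 : ℤ) : ℂ) by push_cast; rfl,
        modeSeries_intCast]
    · have h1 : ∀ n : ℤ, (n : ℂ) ≠ α := fun n hn => hα ⟨n, hn⟩
      have h2 : ∀ n : ℤ, (n : ℂ) ≠ α - 1 := fun n hn => hα ⟨n + 1, by push_cast; rw [hn]; ring⟩
      rw [modeSeries_eq_zero Y _ h1, modeSeries_eq_zero Y _ h2, smul_zero]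
  · by_cases hα : ∃ n : ℤ, (n : ℂ) = α
    · obtain ⟨k, rfl⟩ := hα
      simp only [jacobiLeft, jacobiMiddle, jacobiRight]
      have e1 : ∀ i : ℕ, (k : ℂ) + i = ((k + i : ℤ) : ℂ) := fun i => by push_cast; rfl
      have e2 : ∀ i : ℕ, (k : ℂ) + l - i = ((k + l - i : ℤ) : ℂ) := fun i => by push_cast; rfl
      have e3 : ∀ i : ℕ, (k : ℂ) + m - i = ((m + k - i : ℤ) : ℂ) := fun i => by push_cast; ring
      simp only [e1, e2, e3, modeSeries_intCast]
      exact hY.jacobi a b u l m k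
    · have e : ∀ n : ℤ, ∀ b, modeSeries Y b (α + n) = 0 := fun n b =>
        modeSeries_eq_zero Y b fun k hk => hα ⟨k - n, by push_cast; rw [hk]; ring⟩
      have e1 : ∀ (i : ℕ) b, modeSeries Y b (α + i) = 0 := fun i b => by simpa using e i b
      have e2 : ∀ (l : ℤ) (i : ℕ) b, modeSeries Y b (α + l - i) = 0 := fun l i b => by
        have := e (l - i) b
        push_cast at this
        rwa [add_sub_assoc]
      simp [jacobiLeft, jacobiMiddle, jacobiRight, e1, e2]

/-- The Jacobi identity for modules, from the one for series indexed by complex numbers. -/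
theorem jacobi_of_isJacobi {C : Type*} [AddCommGroup C] [Module ℂ C] {X' Y' Z' : ℤ → ℂ → C}
    (h : IsJacobi X' Y' Z') (l m n : ℤ) :
    (∑ᶠ i : ℕ, ((-1 : ℂ) ^ i * (Ring.choose l i : ℤ)) • X' (m + l - i) ((n + i : ℤ) : ℂ))
      - (∑ᶠ i : ℕ, ((-1 : ℂ) ^ (l + i) * (Ring.choose l i : ℤ)) •
          Y' (m + i) ((n + l - i : ℤ) : ℂ))
    = ∑ᶠ i : ℕ, ((Ring.choose m i : ℤ) : ℂ) • Z' (l + i) ((m + n - i : ℤ) : ℂ) := by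
  have := h.jacobi l m n
  simp only [jacobiLeft, jacobiMiddle, jacobiRight] at this
  push_cast
  rw [add_comm (m : ℂ)]
  exact this

end ModeSeries
end Inter

/-! ### Commutation of modes with `e^{xL(1)}` and `e^{xL(-1)}`. -/

section ModeCommutators

variable {V : Type u} [AddCommGroup V] [Module ℂ V] [VertexOperatorAlgebra V]
  {M : Type*} [AddCommGroup M] [Module ℂ M] {Y : ModeMap V M}

theorem L_one_mode (hY : IsWeakModule Y) {p : ℤ} {a : V}
    (ha : a ∈ VertexOperatorAlgebra.homogeneous p) (q : ℤ) (x : M) :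
    L Y 1 (Y a q x) = Y a q (L Y 1 x) + (2 * p - q - 2 : ℂ) • Y a (q + 1) x
      + Y (L (VertexOperatorAlgebra.Y (V := V)) 1 a) q x := by
  have h := (modeSeries_inter hY).L_one a x q
  have hw : L (VertexOperatorAlgebra.Y (V := V)) 0 a = (p : ℂ) • a :=
    VertexOperatorAlgebra.weight p a ha
  rw [show (q : ℂ) + 1 = ((q + 1 : ℤ) : ℂ) by push_cast; rfl, hw, map_smul] at h
  simp only [Pi.smul_apply, modeSeries_intCast, LinearMap.smul_apply] at h
  rw [h]
  module

theorem L_neg_one_mode (hY : IsWeakModule Y) (a : V) (q : ℤ) (x : M) :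
    L Y (-1) (Y a q x) = Y a q (L Y (-1) x) + (-q : ℂ) • Y a (q - 1) x := by
  have h := (modeSeries_inter hY).L_neg_one a x q
  rw [show (q : ℂ) - 1 = ((q - 1 : ℤ) : ℂ) by push_cast; rfl, modeSeries_intCast,
    modeSeries_intCast] at h
  rw [← h]
  abel

theorem one_mem_homogeneous :
    (VertexOperatorAlgebra.one : V) ∈ VertexOperatorAlgebra.homogeneous 0 := by
  rw [mem_homogeneous_iff, wtSpace, Module.End.mem_eigenspace_iff]
  simpa [L] using (VertexOperatorAlgebra.creation (VertexOperatorAlgebra.omega : V)).1 1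

theorem L_one_one : L (VertexOperatorAlgebra.Y (V := V)) 1 VertexOperatorAlgebra.one = 0 := by
  simpa [L] using (VertexOperatorAlgebra.creation (VertexOperatorAlgebra.omega : V)).1 2

/-- Apply `[L(1), L(-2)] = 3 L(-1)` to the vacuum, which `L(1)` and `L(-1)` annihilate. -/
theorem L_one_omega : L (VertexOperatorAlgebra.Y (V := V)) 1 VertexOperatorAlgebra.omega = 0 := by
  have hv := VertexOperatorAlgebra.virasoro (V := V) 1 (-2)
  have hc := VertexOperatorAlgebra.creation (VertexOperatorAlgebra.omega : V)
  have := congrArg (fun f => f (VertexOperatorAlgebra.one : V)) hv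
  simp [hc.2, hc.1 2, hc.1 0] at this
  simpa [L] using this

theorem dpow_L_one_mem (hY : IsWeakModule Y) (k : ℕ) {h : ℂ} {x : M} (hx : x ∈ wtSpace Y h) :
    dpow (L Y 1) k x ∈ wtSpace Y (h - k) :=
  Submodule.smul_mem _ _ (L1_pow_mem_wtSpace hY k hx)

theorem dpow_L_one_mem_homogeneous (k : ℕ) {n : ℤ} {a : V}
    (ha : a ∈ VertexOperatorAlgebra.homogeneous n) :
    dpow (L (VertexOperatorAlgebra.Y (V := V)) 1) k a ∈
      VertexOperatorAlgebra.homogeneous (n - k) :=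
  Submodule.smul_mem _ _ (L1_pow_mem_homogeneous k ha)

theorem L_one_L_neg_one (hY : IsWeakModule Y) (x : M) :
    L Y 1 (L Y (-1) x) = L Y (-1) (L Y 1 x) + (2 : ℂ) • L Y 0 x := by
  have := L_one_mode hY omega_mem 0 x
  rw [L_one_omega] at this
  simp only [map_zero, Pi.zero_apply, LinearMap.zero_apply, add_zero] at this
  norm_num at this
  simpa [L] using this

/-- Moving `L(-1)` past `s + 1` factors `L(1)` costs `2L(0)` at the weights `h, h-1, …, h-s`. These
contributions add up to `(s+1)(2h-s)`, and the divided power removes the factor `s + 1`. -/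
theorem dpow_L_one_L_neg_one (hY : IsWeakModule Y) {h : ℂ} {x : M} (hx : x ∈ wtSpace Y h)
    (s : ℕ) : dpow (L Y 1) (s + 1) (L Y (-1) x)
      = L Y (-1) (dpow (L Y 1) (s + 1) x) + (2 * h - s) • dpow (L Y 1) s x := by
  have key : ∀ k, L Y 1 (L Y (-1) (dpow (L Y 1) k x))
      = ((k : ℂ) + 1) • L Y (-1) (dpow (L Y 1) (k + 1) x)
        + (2 * (h - k)) • dpow (L Y 1) k x := fun k => by
    have hk := dpow_L_one_mem hY k hx
    rw [wtSpace, Module.End.mem_eigenspace_iff] at hk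
    rw [L_one_L_neg_one hY, hk, apply_dpow, map_smul, smul_smul]
  induction s with
  | zero =>
    have := apply_dpow (L Y 1) 0 (L Y (-1) x)
    have h0 := key 0
    simp only [dpow_zero, Nat.cast_zero, zero_add, one_smul, sub_zero] at this h0 ⊢
    rw [← this, h0]
  | succ s ih =>
    have hs : ((s + 1 : ℕ) : ℂ) + 1 ≠ 0 := by exact_mod_cast (s + 1).succ_ne_zero
    refine smul_right_injective M hs ?_
    simp only
    rw [← apply_dpow, ih, map_add, map_smul, key, apply_dpow]
    push_cast
    module

/-- The commutation of `e^{x L(1)}` with the mode `a_l`. -/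
theorem dpow_L_one_mode (hY : IsWeakModule Y) {p : ℤ} {a : V}
    (ha : a ∈ VertexOperatorAlgebra.homogeneous p) (l : ℤ) (s : ℕ) (x : M) :
    dpow (L Y 1) s (Y a l x) = ∑ r ∈ Finset.HasAntidiagonal.antidiagonal s,
      ∑ t ∈ Finset.HasAntidiagonal.antidiagonal r.2,
        ((Ring.choose (2 * p - t.1 - 2 - l) t.2 : ℤ) : ℂ) •
          Y (dpow (L (VertexOperatorAlgebra.Y (V := V)) 1) t.1 a) (l + t.2)
            (dpow (L Y 1) r.1 x) := by
  -- The family `F s` is the closed form of the divided powers of `ad L(1)` on the mode `a_l`. It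
  -- remains to check that it obeys the recursion.
  have h := dpow_comm_left (S := L Y 1) (T := L Y 1)
    (F := fun s => ∑ t ∈ Finset.HasAntidiagonal.antidiagonal s,
        ((Ring.choose (2 * p - t.1 - 2 - l) t.2 : ℤ) : ℂ) •
          Y (dpow (L (VertexOperatorAlgebra.Y (V := V)) 1) t.1 a) (l + t.2)) ?_ s x
  · simpa [dpow_zero] using h
  intro s x
  simp only [LinearMap.sum_apply, LinearMap.smul_apply, map_sum, map_smul]
  set G : ℕ → ℕ → M := fun j i =>
    Y (dpow (L (VertexOperatorAlgebra.Y (V := V)) 1) j a) (l + i) x with hG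
  have key : ∀ j i : ℕ, L Y 1 (Y (dpow (L (VertexOperatorAlgebra.Y (V := V)) 1) j a) (l + i) x)
      = Y (dpow (L (VertexOperatorAlgebra.Y (V := V)) 1) j a) (l + i) (L Y 1 x)
        + ((2 * (p - j) - (l + i) - 2 : ℂ) • G j (i + 1) + ((j : ℂ) + 1) • G (j + 1) i) :=
    fun j i => by
      rw [L_one_mode hY (dpow_L_one_mem_homogeneous j ha), apply_dpow, map_smul, add_assoc]
      simp only [hG, Pi.smul_apply, LinearMap.smul_apply]
      push_cast
      rw [add_assoc]
  simp only [key, smul_add, Finset.sum_add_distrib, smul_smul]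
  congr 1
  rw [sum_antidiagonal_shift_right s (fun j i => ((Ring.choose (2 * p - j - 2 - l) i : ℤ) : ℂ)
      * (2 * (p - j) - (l + i) - 2)) G,
    sum_antidiagonal_shift_left s (fun j i => ((Ring.choose (2 * p - j - 2 - l) i : ℤ) : ℂ)
      * (j + 1)) G, ← Finset.sum_add_distrib, Finset.smul_sum]
  refine Finset.sum_congr rfl fun r hr => ?_
  have hs : (s : ℂ) + 1 = r.1 + r.2 := by
    exact_mod_cast (Finset.HasAntidiagonal.mem_antidiagonal.mp hr).symm
  rw [smul_smul, ← add_smul, hs]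
  obtain ⟨j, i⟩ := r
  congr 1
  have succ_mul : ∀ (r : ℤ) (i : ℕ), ((i : ℂ) + 1) * (Ring.choose r (i + 1) : ℤ)
      = (r - i) * (Ring.choose r i : ℤ) := fun r i => by
    exact_mod_cast succ_mul_choose_succ r i
  -- With `r = 2p-j-2-l`, the coefficients agree when `C(r,i-1)(r-j-i+1) + j C(r+1,i) = (i+j)
  -- C(r,i)`. This follows from Pascal's rule and `i C(r,i) = (r-i+1) C(r,i-1)`; the boundary cases
  -- are treated apart.
  rcases j with _ | j <;> rcases i with _ | i
  · simp
  · have := succ_mul (2 * p - 2 - l) i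
    simp only [Nat.add_one_ne_zero, if_true, if_false, Nat.add_sub_cancel]
    push_cast at this ⊢
    simp only [sub_zero, zero_add, add_zero]
    rw [this]
    ring
  · simp
  · have := succ_mul (2 * p - (j + 1) - 2 - l) i
    have h2 := Ring.choose_succ_succ (2 * p - (j + 1) - 2 - l) i
    rw [show 2 * p - (j + 1) - 2 - l + 1 = 2 * p - j - 2 - l by ring] at h2
    simp only [Nat.add_one_ne_zero, if_false, Nat.add_sub_cancel, h2]
    push_cast at this ⊢
    linear_combination (-1 : ℂ) * this

/-- The commutation of `e^{x L(-1)}` with the mode `a_q`. -/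
theorem mode_dpow_L_neg_one (hY : IsWeakModule Y) (a : V) (q : ℤ) (s : ℕ) (x : M) :
    Y a q (dpow (L Y (-1)) s x) = ∑ r ∈ Finset.HasAntidiagonal.antidiagonal s,
      ((Ring.choose q r.2 : ℤ) : ℂ) • dpow (L Y (-1)) r.1 (Y a (q - r.2) x) := by
  -- Each commutator with `L(-1)` lowers the mode and multiplies by its index, so the divided powers
  -- are `C(q,t) a_{q-t}`.
  have h := dpow_comm_right (S := L Y (-1)) (T := L Y (-1))
    (F := fun t => ((Ring.choose q t : ℤ) : ℂ) • Y a (q - t)) ?_ s x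
  · simpa using h
  intro t x
  have h2 : ((t : ℂ) + 1) * (Ring.choose q (t + 1) : ℤ) = (q - t) * (Ring.choose q t : ℤ) := by
    exact_mod_cast succ_mul_choose_succ q t
  simp only [LinearMap.smul_apply, map_smul, L_neg_one_mode hY, smul_add, smul_smul, h2]
  rw [show q - ((t + 1 : ℕ) : ℤ) = q - t - 1 by push_cast; ring]
  push_cast
  module

end ModeCommutators

/-! ### Opposite operators and their involutivity. -/

section Opposite

variable {V : Type u} [AddCommGroup V] [Module ℂ V] [VertexOperatorAlgebra V]

theorem homogeneous_induction {P : V → Prop} (a : V)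
    (mem : ∀ (n : ℤ), ∀ a ∈ VertexOperatorAlgebra.homogeneous (V := V) n, P a) (zero : P 0)
    (add : ∀ a b, P a → P b → P (a + b)) : P a := by
  have htop : a ∈ ⨆ n, VertexOperatorAlgebra.homogeneous (V := V) n := by
    rw [VertexOperatorAlgebra.isInternal.submodule_iSup_eq_top]
    trivial
  exact Submodule.iSup_induction _ (motive := P) htop mem zero add

theorem wtSpace_induction {A : Type*} [AddCommGroup A] [Module ℂ A] {Y : ModeMap V A}
    (hY : IsModule Y) {P : A → Prop} (u : A) (mem : ∀ (h : ℂ), ∀ u ∈ wtSpace Y h, P u)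
    (zero : P 0) (add : ∀ u u', P u → P u' → P (u + u')) : P u := by
  have htop : u ∈ ⨆ h, wtSpace Y h := by
    rw [hY.iSup_wtSpace]
    trivial
  exact Submodule.iSup_induction _ (motive := P) htop mem zero add

theorem dpow_L_one_eventually {A : Type*} [AddCommGroup A] [Module ℂ A] {Y : ModeMap V A}
    (hY : IsModule Y) {h : ℂ} {u : A} (hu : u ∈ wtSpace Y h) :
    ∃ N : ℕ, ∀ k, N ≤ k → dpow (L Y 1) k u = 0 := by
  obtain ⟨N, hN⟩ := L1_pow_eq_zero hY hu
  exact ⟨N, fun k hk => by rw [dpow, LinearMap.smul_apply, hN k hk, smul_zero]⟩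

theorem dpow_L_one_eventually_homogeneous {n : ℤ} {a : V}
    (ha : a ∈ VertexOperatorAlgebra.homogeneous n) :
    ∃ N : ℕ, ∀ k, N ≤ k → dpow (L (VertexOperatorAlgebra.Y (V := V)) 1) k a = 0 := by
  obtain ⟨N, hN⟩ := L1_pow_eq_zero' ha
  exact ⟨N, fun k hk => by rw [dpow, LinearMap.smul_apply, hN k hk, smul_zero]⟩

theorem oppositeMode_apply_sum (M : VModule.{u, v} V) (m n : ℤ) {a : V}
    (ha : a ∈ VertexOperatorAlgebra.homogeneous n) {N : ℕ}
    (hN : ∀ k, N ≤ k → dpow (L (VertexOperatorAlgebra.Y (V := V)) 1) k a = 0) (x : M) :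
    oppositeMode M m a x = (-1 : ℂ) ^ n • ∑ k ∈ Finset.range N,
      M.Y (dpow (L (VertexOperatorAlgebra.Y (V := V)) 1) k a) (2 * n - k - 2 - m) x := by
  have e : ∀ k : ℕ, ((-1 : ℂ) ^ n * (k.factorial : ℂ)⁻¹) •
      M.Y ((L (VertexOperatorAlgebra.Y (V := V)) 1 ^ k) a) (2 * n - k - m - 2)
        = (-1 : ℂ) ^ n • M.Y (dpow (L (VertexOperatorAlgebra.Y (V := V)) 1) k a)
          (2 * n - k - 2 - m) := fun k => by
    rw [mul_smul, dpow, LinearMap.smul_apply, map_smul, Pi.smul_apply,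
      sub_right_comm (2 * n - k : ℤ)]
  rw [oppositeMode_apply M m n ha, finsum_congr e, finsum_eq_sum_range (N := N) fun k hk => by
    rw [hN k hk, map_zero, Pi.zero_apply, smul_zero], ← Finset.smul_sum]
  simp

variable {A : VModule.{u, w} V} {B : Type*} [AddCommGroup B] [Module ℂ B] {C : Type*}
  [AddCommGroup C] [Module ℂ C]

/-- The operator `I(e^{xL(1)} κ x^{-2L(0)} u, x⁻¹)`, where `κ` is a function of the weight. -/
noncomputable def opp (κ : ℂ → ℂ) (A : VModule.{u, w} V) (I : OperatorSeries A B C) :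
    OperatorSeries A B C :=
  LinearMap.pi fun β => fromSummands (wtSpace A.Y) (isInternal_wtSpace A.isModule) fun h =>
    finsumMap
      (fun k => (κ h * (k.factorial : ℂ)⁻¹) •
        (LinearMap.proj (2 * h - k - β - 2) ∘ₗ I ∘ₗ (L A.Y 1 ^ k) ∘ₗ (wtSpace A.Y h).subtype))
      (fun u => by
        obtain ⟨N, hN⟩ := L1_pow_eq_zero A.isModule u.2
        exact finite_support_of_eventually _ N fun k hk => by simp [hN k hk])

theorem opp_apply (κ : ℂ → ℂ) (I : OperatorSeries A B C) (β : ℂ) {h : ℂ} {u : A}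
    (hu : u ∈ wtSpace A.Y h) :
    opp κ A I u β = ∑ᶠ k : ℕ, (κ h * (k.factorial : ℂ)⁻¹) •
        I ((L A.Y 1 ^ k) u) (2 * h - k - β - 2) :=
  fromSummands_apply _ (isInternal_wtSpace A.isModule) _ h ⟨u, hu⟩

theorem opp_apply_sum (κ : ℂ → ℂ) (I : OperatorSeries A B C) (β : ℂ) {h : ℂ} {u : A}
    (hu : u ∈ wtSpace A.Y h) {N : ℕ} (hN : ∀ k, N ≤ k → dpow (L A.Y 1) k u = 0) (x : B) :
    opp κ A I u β x = κ h • ∑ k ∈ Finset.range N,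
      I (dpow (L A.Y 1) k u) (2 * h - k - 2 - β) x := by
  have e : ∀ k : ℕ, (κ h * (k.factorial : ℂ)⁻¹) • I ((L A.Y 1 ^ k) u) (2 * h - k - β - 2)
      = κ h • I (dpow (L A.Y 1) k u) (2 * h - k - 2 - β) := fun k => by
    rw [mul_smul, dpow, LinearMap.smul_apply, map_smul, Pi.smul_apply,
      sub_right_comm (2 * h - k : ℂ)]
  rw [opp_apply κ I β hu, finsum_congr e, finsum_eq_sum_range (N := N) fun k hk => by
    rw [hN k hk, map_zero, Pi.zero_apply, smul_zero], ← Finset.smul_sum]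
  simp

/-- The operation `opp` only combines modes of the operator and acts on its first argument, so it is
natural in the source and target spaces. -/
theorem opp_comp {D : Type*} [AddCommGroup D] [Module ℂ D] {E : Type*} [AddCommGroup E]
    [Module ℂ E] (κ : ℂ → ℂ) (I : OperatorSeries A B C) (J : OperatorSeries A D E)
    (φ : B →ₗ[ℂ] D) (ψ : C →ₗ[ℂ] E) (h : ∀ u β x, ψ (I u β x) = J u β (φ x)) (u : A) (β : ℂ)
    (x : B) : ψ (opp κ A I u β x) = opp κ A J u β (φ x) := by
  induction u using wtSpace_induction A.isModule with
  | mem r u hu =>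
    obtain ⟨N, hN⟩ := dpow_L_one_eventually A.isModule hu
    rw [opp_apply_sum κ I β hu hN, opp_apply_sum κ J β hu hN, map_smul, map_sum]
    simp only [h]
  | zero => simp
  | add u u' hu hu' => simp [hu, hu']

theorem neg_one_pow_sum_choose (s : ℕ) :
    ∑ p ∈ Finset.HasAntidiagonal.antidiagonal s, (-1 : ℂ) ^ p.1 * ((p.1 + p.2).choose p.2 : ℂ)
      = if s = 0 then 1 else 0 := by
  have h := Int.alternating_sum_range_choose (n := s)
  rw [Finset.Nat.sum_antidiagonal_eq_sum_range_succ
    (f := fun i j => (-1 : ℂ) ^ i * ((i + j).choose j : ℂ))]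
  have h2 : ((∑ m ∈ Finset.range (s + 1), (-1 : ℤ) ^ m * (s.choose m : ℤ) : ℤ) : ℂ)
      = if s = 0 then 1 else 0 := by
    rw [h]; split_ifs <;> simp
  rw [← h2]
  push_cast
  refine Finset.sum_congr rfl fun i hi => ?_
  have hi' : i ≤ s := by simpa [Nat.lt_succ_iff] using hi
  rw [Nat.add_sub_cancel' hi', Nat.choose_symm hi']

/-- The sign rule for `κ` gives `κ(h-k) = (-1)^k κ(h)`, which reverses the sign of one of the two
exponentials in `L(1)`. They cancel through `∑ (-1)^k C(s,k) = 0` for `s > 0`, and only the product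
of phases survives. -/
theorem opp_opp {κ κ' : ℂ → ℂ} (hκ : ∀ h, κ (h + 1) = -κ h) (I : OperatorSeries A B C) {h : ℂ}
    {u : A} (hu : u ∈ wtSpace A.Y h) (β : ℂ) (x : B) :
    opp κ' A (opp κ A I) u β x = (κ' h * κ h) • I u β x := by
  have hκn : ∀ k : ℕ, κ (h - k) = (-1) ^ k * κ h := fun k => by
    induction k with
    | zero => simp
    | succ k ih =>
      have := hκ (h - (k + 1 : ℕ))
      rw [show h - ((k + 1 : ℕ) : ℂ) + 1 = h - k by push_cast; ring, ih] at this
      rw [pow_succ]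
      linear_combination this
  obtain ⟨N, hN⟩ := dpow_L_one_eventually A.isModule hu
  have hin : ∀ k : ℕ, opp κ A I (dpow (L A.Y 1) k u) (2 * h - k - 2 - β) x
      = ∑ᶠ j : ℕ, ((-1 : ℂ) ^ k * κ h * ((k + j).choose j : ℂ)) •
        I (dpow (L A.Y 1) (k + j) u) (β - ((k + j : ℕ) : ℂ)) x := fun k => by
    rw [opp_apply_sum κ I _ (dpow_L_one_mem A.isModule.toIsWeakModule k hu) (N := N) fun j hj => by
        rw [dpow_dpow, hN _ (by omega), smul_zero],
      finsum_eq_sum_range (N := N) fun j hj => by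
        rw [hN _ (by omega), map_zero, Pi.zero_apply, LinearMap.zero_apply, smul_zero], hκn,
      Finset.smul_sum]
    refine Finset.sum_congr rfl fun j _ => ?_
    rw [dpow_dpow, map_smul, Pi.smul_apply, LinearMap.smul_apply, smul_smul, add_comm j k,
      show 2 * (h - k) - j - 2 - (2 * h - k - 2 - β) = β - ((k + j : ℕ) : ℂ) by push_cast; ring]
  rw [opp_apply_sum κ' _ β hu hN, Finset.sum_congr rfl fun k _ => hin k,
    ← finsum_eq_sum_range fun k hk => finsum_eq_zero_of_forall_eq_zero fun j => by
      rw [hN _ (by omega), map_zero, Pi.zero_apply, LinearMap.zero_apply, smul_zero],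
    finsum_finsum_antidiagonal (N := N) fun k j hkj => by
      rw [hN _ hkj, map_zero, Pi.zero_apply, LinearMap.zero_apply, smul_zero]]
  have hs : ∀ s : ℕ, ∑ p ∈ Finset.HasAntidiagonal.antidiagonal s,
      ((-1 : ℂ) ^ p.1 * κ h * ((p.1 + p.2).choose p.2 : ℂ)) •
        I (dpow (L A.Y 1) (p.1 + p.2) u) (β - ((p.1 + p.2 : ℕ) : ℂ)) x
      = (if s = 0 then κ h else 0) • I (dpow (L A.Y 1) s u) (β - s) x := fun s => by
    have : (if s = 0 then κ h else 0) = κ h * (if s = 0 then 1 else 0) := by split_ifs <;> simp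
    rw [this, ← neg_one_pow_sum_choose, Finset.mul_sum, Finset.sum_smul]
    refine Finset.sum_congr rfl fun p hp => ?_
    rw [Finset.HasAntidiagonal.mem_antidiagonal.mp hp]
    congr 1
    ring
  rw [finsum_congr hs, finsum_eq_sum_range (N := 1) fun s hs => by
    rw [if_neg (by omega), zero_smul]]
  simp [dpow_zero, smul_smul]

end Opposite

/-! ### Jacobi identity and derivative property for opposite operators. -/

section OppositeJacobi

variable {V : Type u} [AddCommGroup V] [Module ℂ V] [VertexOperatorAlgebra V]
  {A : VModule.{u, w} V}

theorem phase_sub_int {κ : ℂ → ℂ} (hκ : ∀ h, κ (h + 1) = -κ h) (h : ℂ) (n : ℤ) :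
    κ (h + n) = (-1) ^ n * κ h := by
  induction n using Int.induction_on with
  | zero => simp
  | succ n ih =>
    rw [zpow_add_one₀ (by norm_num)]
    push_cast at ih ⊢
    rw [← add_assoc, hκ, ih]
    ring
  | pred n ih =>
    have := hκ (h + ((-n - 1 : ℤ) : ℂ))
    rw [zpow_sub_one₀ (by norm_num)]
    push_cast at ih this ⊢
    rw [show h + (-n - 1) + 1 = h + -(n : ℂ) by ring, ih] at this
    rw [inv_neg, inv_one]
    linear_combination this

section

variable {B C : Type*} [AddCommGroup B] [Module ℂ B] [AddCommGroup C] [Module ℂ C]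

/-- The opposite operator on `a_q u`. -/
theorem opp_mode {κ : ℂ → ℂ} (hκ : ∀ h, κ (h + 1) = -κ h) (I : OperatorSeries A B C)
    {p : ℤ} {a : V} (ha : a ∈ VertexOperatorAlgebra.homogeneous p) {h : ℂ} {u : A}
    (hu : u ∈ wtSpace A.Y h) {Na Nu : ℕ}
    (hNa : ∀ k, Na ≤ k → dpow (L (VertexOperatorAlgebra.Y (V := V)) 1) k a = 0)
    (hNu : ∀ k, Nu ≤ k → dpow (L A.Y 1) k u = 0) (q : ℤ) (α : ℂ) (x : B) :
    opp κ A I (A.Y a q u) α x = (κ h * (-1) ^ p) • ∑ k ∈ Finset.range Nu, ∑ j ∈ Finset.range Na,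
      (-(-1 : ℂ) ^ q) • ∑ᶠ i : ℕ, ((Ring.choose (2 * p - j - 2 - q) i : ℤ) : ℂ) •
        I (A.Y (dpow (L (VertexOperatorAlgebra.Y (V := V)) 1) j a) (q + i)
          (dpow (L A.Y 1) k u))
          (((2 * p - j - 2 : ℤ) : ℂ) + (2 * h - k - 2) - 2 * q - i - α) x := by
  have hY := A.isModule.toIsWeakModule
  -- A bound uniform in `k` and `j` exists because only `k < Nu` and `j < Na` give nonzero vectors.
  have hNi : ∃ Ni : ℕ, ∀ k j i : ℕ, Ni ≤ i →
      A.Y (dpow (L (VertexOperatorAlgebra.Y (V := V)) 1) j a) (q + i) (dpow (L A.Y 1) k u) = 0 := by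
    have h1 : ∀ k j, ∃ Ni : ℕ, ∀ i : ℕ, Ni ≤ i →
      A.Y (dpow (L (VertexOperatorAlgebra.Y (V := V)) 1) j a) (q + i)
        (dpow (L A.Y 1) k u) = 0 := fun k j => by
      obtain ⟨N, hN⟩ := hY.truncation (dpow (L (VertexOperatorAlgebra.Y (V := V)) 1) j a)
        (dpow (L A.Y 1) k u)
      exact ⟨(N - q).toNat, fun i hi => hN _ (by omega)⟩
    choose N hN using h1
    refine ⟨(Finset.range Nu).sup fun k => (Finset.range Na).sup fun j => N k j,
      fun k j i hi => ?_⟩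
    by_cases hk : Nu ≤ k
    · rw [hNu k hk, map_zero]
    by_cases hj : Na ≤ j
    · rw [hNa j hj, map_zero, Pi.zero_apply, LinearMap.zero_apply]
    refine hN k j i (le_trans ?_ hi)
    exact le_trans (Finset.le_sup (f := fun j => N k j) (Finset.mem_range.mpr (not_le.mp hj)))
      (Finset.le_sup (f := fun k => (Finset.range Na).sup fun j => N k j)
        (Finset.mem_range.mpr (not_le.mp hk)))
  obtain ⟨Ni, hNi⟩ := hNi
  set F : ℕ → ℕ → ℕ → C := fun k j i => ((Ring.choose (2 * p - j - 2 - q) i : ℤ) : ℂ) •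
        I (A.Y (dpow (L (VertexOperatorAlgebra.Y (V := V)) 1) j a) (q + i)
          (dpow (L A.Y 1) k u))
          (((2 * p - j - 2 : ℤ) : ℂ) + (2 * h - k - 2) - 2 * q - i - α) x with hF
  have hFi : ∀ k j i, Ni ≤ i → F k j i = 0 := fun k j i hi => by
    rw [hF]; simp only [hNi k j i hi, map_zero, Pi.zero_apply, LinearMap.zero_apply, smul_zero]
  have hFj : ∀ k j i, Na ≤ j → F k j i = 0 := fun k j i hj => by
    rw [hF]; simp only [hNa j hj, map_zero, Pi.zero_apply, LinearMap.zero_apply, smul_zero]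
  have hFk : ∀ k j i, Nu ≤ k → F k j i = 0 := fun k j i hk => by
    rw [hF]; simp only [hNu k hk, map_zero, Pi.zero_apply, LinearMap.zero_apply, smul_zero]
  have hmem := mode_mem_wtSpace hY ha q hu
  have hd : ∀ s, dpow (L A.Y 1) s (A.Y a q u) = ∑ r ∈ Finset.HasAntidiagonal.antidiagonal s,
      ∑ t ∈ Finset.HasAntidiagonal.antidiagonal r.2,
        ((Ring.choose (2 * p - t.1 - 2 - q) t.2 : ℤ) : ℂ) •
          A.Y (dpow (L (VertexOperatorAlgebra.Y (V := V)) 1) t.1 a) (q + t.2)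
            (dpow (L A.Y 1) r.1 u) := fun s => dpow_L_one_mode hY ha q s u
  have hN : ∀ s, Nu + (Na + Ni) ≤ s → dpow (L A.Y 1) s (A.Y a q u) = 0 := fun s hs => by
    rw [hd]
    refine Finset.sum_eq_zero fun r hr => Finset.sum_eq_zero fun t ht => ?_
    have hr := Finset.HasAntidiagonal.mem_antidiagonal.mp hr
    have ht := Finset.HasAntidiagonal.mem_antidiagonal.mp ht
    by_cases hk : Nu ≤ r.1
    · rw [hNu _ hk, map_zero, smul_zero]
    by_cases hj : Na ≤ t.1
    · rw [hNa _ hj, map_zero, Pi.zero_apply, LinearMap.zero_apply, smul_zero]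
    rw [hNi _ _ _ (by omega), smul_zero]
  rw [opp_apply_sum κ I α hmem hN]
  have hterm : ∀ s : ℕ, I (dpow (L A.Y 1) s (A.Y a q u)) (2 * (h + p - q - 1) - s - 2 - α) x
      = ∑ r ∈ Finset.HasAntidiagonal.antidiagonal s,
        ∑ t ∈ Finset.HasAntidiagonal.antidiagonal r.2, F r.1 t.1 t.2 := fun s => by
    rw [hd, map_sum, Finset.sum_apply, LinearMap.sum_apply]
    refine Finset.sum_congr rfl fun r hr => ?_
    rw [map_sum, Finset.sum_apply, LinearMap.sum_apply]
    refine Finset.sum_congr rfl fun t ht => ?_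
    rw [map_smul, Pi.smul_apply, LinearMap.smul_apply, hF]
    simp only
    have hr := Finset.HasAntidiagonal.mem_antidiagonal.mp hr
    have ht := Finset.HasAntidiagonal.mem_antidiagonal.mp ht
    rw [show 2 * (h + p - q - 1) - s - 2 - α
      = ((2 * p - t.1 - 2 : ℤ) : ℂ) + (2 * h - r.1 - 2) - 2 * q - t.2 - α by
        rw [← hr, ← ht]; push_cast; ring]
  -- The weight of `a_q u` is `h + p - q - 1`. Its phase is the source of the sign `-(-1)^q` in
  -- `IsJacobi.opposite`.
  have hphase : κ (h + p - q - 1) = κ h * (-1) ^ p * (-(-1) ^ q) := by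
    have := phase_sub_int hκ h (p - q - 1)
    push_cast at this
    rw [show h + p - q - 1 = h + (p - q - 1 : ℂ) by ring, this, zpow_sub_one₀ (by norm_num),
      zpow_sub₀ (by norm_num), div_eq_mul_inv, ← inv_zpow, inv_neg, inv_one]
    ring
  rw [Finset.sum_congr rfl fun s _ => hterm s]
  rw [← finsum_eq_sum_range (N := Nu + (Na + Ni)) fun s hs => by
    rw [← hterm, hN s hs, map_zero, Pi.zero_apply, LinearMap.zero_apply]]
  -- The sum over `s = k + j + i` is unfolded into independent sums over the power `k` on `u`, the
  -- power `j` on `a` and the binomial index `i`.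
  rw [← finsum_finsum_antidiagonal (N := Nu + (Na + Ni)) (F := fun k t =>
    ∑ t ∈ Finset.HasAntidiagonal.antidiagonal t, F k t.1 t.2) fun k t hkt =>
      Finset.sum_eq_zero fun t ht => by
        have ht := Finset.HasAntidiagonal.mem_antidiagonal.mp ht
        by_cases hk : Nu ≤ k
        · exact hFk _ _ _ hk
        by_cases hj : Na ≤ t.1
        · exact hFj _ _ _ hj
        exact hFi _ _ _ (by omega)]
  have hk : ∀ k, ∑ᶠ t : ℕ, ∑ t ∈ Finset.HasAntidiagonal.antidiagonal t, F k t.1 t.2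
      = ∑ j ∈ Finset.range Na, ∑ᶠ i, F k j i := fun k => by
    rw [← finsum_finsum_antidiagonal (N := Na + Ni) (F := F k) fun j i hji => by
        by_cases hj : Na ≤ j
        · exact hFj _ _ _ hj
        exact hFi _ _ _ (by omega),
      finsum_eq_sum_range (N := Na) fun j hj => finsum_eq_zero_of_forall_eq_zero fun i =>
        hFj _ _ _ hj]
  rw [finsum_congr hk, finsum_eq_sum_range (N := Nu) fun k hk => Finset.sum_eq_zero fun j _ =>
    finsum_eq_zero_of_forall_eq_zero fun i => hFk _ _ _ hk, hphase, mul_smul]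
  simp only [Finset.smul_sum, hF]

end

/-- The Jacobi identity for opposite operators. -/
theorem Inter.opp_isJacobi {B C : VModule.{u, v} V} {I : OperatorSeries A B C}
    (hI : Inter A.Y B.Y C.Y I) {κ : ℂ → ℂ} (hκ : ∀ h, κ (h + 1) = -κ h) (a : V) (u : A) (x : B) :
    IsJacobi (fun p α => opp κ A I u α (oppositeMode B p a x))
      (fun p α => oppositeMode C p a (opp κ A I u α x))
      (fun p α => opp κ A I (A.Y a p u) α x) := by
  induction a using homogeneous_induction with
  | zero =>
    simpa [Pi.zero_def] using IsJacobi.zero (C := C)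
  | add a b ha hb =>
    simpa [Pi.add_def] using ha.add hb
  | mem p a ha =>
  induction u using wtSpace_induction A.isModule with
  | zero => simpa [Pi.zero_def] using IsJacobi.zero (C := C)
  | add u u' hu hu' =>
    simpa [Pi.add_def] using hu.add hu'
  | mem h u hu =>
  obtain ⟨Na, hNa⟩ := dpow_L_one_eventually_homogeneous ha
  obtain ⟨Nu, hNu⟩ := dpow_L_one_eventually A.isModule hu
  -- For fixed `j` and `k` the opposite of `a` reflects modes in `P = 2p-j-2` and that of `u`
  -- reflects them in `Q = 2h-k-2`. The claim is a finite sum of reflected Jacobi identities, one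
  -- for each pair.
  have key := (IsJacobi.sum (Finset.range Nu) fun k _ => IsJacobi.sum (Finset.range Na) fun j _ =>
    (hI.isJacobi (dpow (L (VertexOperatorAlgebra.Y (V := V)) 1) j a)
      (dpow (L A.Y 1) k u) x).opposite (2 * p - j - 2) (2 * h - k - 2)).smul (κ h * (-1) ^ p)
  convert key using 1
  · funext q α
    simp only [Pi.smul_apply, Finset.sum_apply]
    rw [opp_apply_sum κ I α hu hNu, oppositeMode_apply_sum B q p ha hNa]
    simp only [map_smul, map_sum, ← Finset.smul_sum, smul_smul]
  · funext q α
    simp only [Pi.smul_apply, Finset.sum_apply]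
    rw [opp_apply_sum κ I α hu hNu, oppositeMode_apply_sum C q p ha hNa, Finset.sum_comm]
    simp only [map_smul, map_sum, ← Finset.smul_sum, smul_smul, mul_comm]
  · funext q α
    simp only [Pi.smul_apply, Finset.sum_apply]
    exact opp_mode hκ I ha hu hNa hNu q α x

/-- At level `k` the derivative property of `I` contributes `-(2h-k-β)` and the commutator of `L(1)`
powers with `L(-1)` contributes `2h-k`. They sum to `β`, and the rule `κ(h+1) = -κ(h)` supplies the
sign. -/
theorem opp_L_neg_one {B C : Type*} [AddCommGroup B] [Module ℂ B] [AddCommGroup C] [Module ℂ C]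
    {I : OperatorSeries A B C}
    (hI : ∀ (u : A) (α : ℂ), I (L A.Y (-1) u) α = (-α) • I u (α - 1)) {κ : ℂ → ℂ}
    (hκ : ∀ h, κ (h + 1) = -κ h) (u : A) (β : ℂ) :
    opp κ A I (L A.Y (-1) u) β = (-β) • opp κ A I u (β - 1) := by
  ext x
  have hY := A.isModule.toIsWeakModule
  induction u using wtSpace_induction A.isModule with
  | zero => simp
  | add u u' hu hu' => simp only [map_add, Pi.add_apply, LinearMap.add_apply, smul_add] at *
                       rw [hu, hu']
  | mem h u hu =>
  obtain ⟨N, hN⟩ := dpow_L_one_eventually A.isModule hu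
  have hmem : L A.Y (-1) u ∈ wtSpace A.Y (h + 1) := by
    have := mode_mem_wtSpace hY omega_mem 0 hu
    rw [show h + ((2 : ℤ) : ℂ) - ((0 : ℤ) : ℂ) - 1 = h + 1 by push_cast; ring] at this
    exact this
  -- One power more than for `u`: the divided power of order `k + 1` on `L(-1)u` involves the one of
  -- order `k` on `u`.
  have hN' : ∀ k, N + 1 ≤ k → dpow (L A.Y 1) k (L A.Y (-1) u) = 0 := fun k hk => by
    obtain ⟨k, rfl⟩ := Nat.exists_eq_add_of_le' (le_trans (Nat.le_add_left 1 N) hk)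
    rw [dpow_L_one_L_neg_one hY hu, hN _ (by omega), hN _ (by omega), map_zero, smul_zero,
      add_zero]
  rw [opp_apply_sum κ I β hmem hN', LinearMap.smul_apply, opp_apply_sum κ I (β - 1) hu hN, hκ,
    Finset.sum_range_succ']
  have e : ∀ k : ℕ, I (dpow (L A.Y 1) (k + 1) (L A.Y (-1) u))
      (2 * (h + 1) - ((k + 1 : ℕ) : ℂ) - 2 - β) x
      = (-(2 * h - ((k + 1 : ℕ) : ℂ) - β)) •
          I (dpow (L A.Y 1) (k + 1) u) (2 * h - ((k + 1 : ℕ) : ℂ) - 2 - (β - 1)) x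
        + (2 * h - k) • I (dpow (L A.Y 1) k u) (2 * h - k - 2 - (β - 1)) x := fun k => by
    rw [dpow_L_one_L_neg_one hY hu, map_add, Pi.add_apply, LinearMap.add_apply, hI, map_smul,
      Pi.smul_apply, LinearMap.smul_apply, LinearMap.smul_apply,
      show 2 * (h + 1) - ((k + 1 : ℕ) : ℂ) - 2 - β - 1
        = 2 * h - ((k + 1 : ℕ) : ℂ) - 2 - (β - 1) by ring,
      show 2 * (h + 1) - ((k + 1 : ℕ) : ℂ) - 2 - β = 2 * h - k - 2 - (β - 1) by push_cast; ring]
    push_cast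
    module
  have e0 : I (dpow (L A.Y 1) 0 (L A.Y (-1) u)) (2 * (h + 1) - ((0 : ℕ) : ℂ) - 2 - β) x
      = (-(2 * h - ((0 : ℕ) : ℂ) - β)) •
        I (dpow (L A.Y 1) 0 u) (2 * h - ((0 : ℕ) : ℂ) - 2 - (β - 1)) x := by
    rw [dpow_zero, dpow_zero, hI, LinearMap.smul_apply,
      show 2 * (h + 1) - ((0 : ℕ) : ℂ) - 2 - β - 1 = 2 * h - ((0 : ℕ) : ℂ) - 2 - (β - 1) by ring]
    module
  rw [Finset.sum_congr rfl fun k _ => e k, e0, Finset.sum_add_distrib, add_right_comm,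
    ← Finset.sum_range_succ' (fun k : ℕ => (-(2 * h - (k : ℂ) - β)) •
        I (dpow (L A.Y 1) k u) (2 * h - (k : ℂ) - 2 - (β - 1)) x), Finset.sum_range_succ,
    hN N le_rfl]
  simp only [map_zero, Pi.zero_apply, LinearMap.zero_apply, smul_zero, add_zero]
  rw [← Finset.sum_add_distrib, smul_comm (-β), neg_smul, ← smul_neg, ← Finset.sum_neg_distrib,
    Finset.smul_sum (r := -β)]
  congr 1
  refine Finset.sum_congr rfl fun k _ => ?_
  module

end OppositeJacobi

/-! ### Weight decompositions, and the vertex operator algebra as a module over itself. -/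

section Weights

variable {V : Type u} [AddCommGroup V] [Module ℂ V] [VertexOperatorAlgebra V]
  {M : Type*} [AddCommGroup M] [Module ℂ M] {Y : ModeMap V M}

/-- Eigenspaces are independent, so subspaces of them that already span the whole space leave no
room. -/
theorem eigenspace_eq_of_le {T : Module.End ℂ M} {q : ℂ → Submodule ℂ M}
    (hq : ∀ h, q h ≤ Module.End.eigenspace T h) (htop : ⨆ h, q h = ⊤) (h : ℂ) :
    Module.End.eigenspace T h = q h := by
  refine le_antisymm (fun x hx => ?_) (hq h)
  have hsplit : q h ⊔ (⨆ (j : ℂ) (_ : j ≠ h), q j) = ⊤ := by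
    rw [eq_top_iff, ← htop]
    refine iSup_le fun j => ?_
    by_cases hj : j = h
    · subst hj; exact le_sup_left
    · exact le_sup_of_le_right (le_iSup₂_of_le j hj le_rfl)
  obtain ⟨b, hb, c, hc, hbc⟩ := Submodule.mem_sup.mp (hsplit ▸ Submodule.mem_top : x ∈ _)
  have hc1 : c ∈ Module.End.eigenspace T h := by
    rw [show c = x - b by rw [← hbc]; abel]
    exact Submodule.sub_mem _ hx (hq h hb)
  have hc2 : c ∈ ⨆ (j : ℂ) (_ : j ≠ h), Module.End.eigenspace T j := (iSup₂_mono fun j _ => hq j) hc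
  have : c = 0 :=
    Submodule.disjoint_def.mp (Module.End.eigenspaces_iSupIndep T h) c hc1 hc2
  rw [← hbc, this, add_zero]
  exact hb

/-- The projection to a weight space. -/
noncomputable def wtComponent (hY : IsModule Y) (h : ℂ) : M →ₗ[ℂ] wtSpace Y h :=
  DirectSum.component ℂ ℂ (fun h => wtSpace Y h) h ∘ₗ
    (LinearEquiv.ofBijective (DirectSum.coeLinearMap (wtSpace Y))
      (isInternal_wtSpace hY)).symm.toLinearMap

theorem wtComponent_lof (hY : IsModule Y) {h : ℂ} (x : wtSpace Y h) :
    (LinearEquiv.ofBijective (DirectSum.coeLinearMap (wtSpace Y)) (isInternal_wtSpace hY)).symm x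
      = DirectSum.lof ℂ ℂ (fun h => wtSpace Y h) h x :=
  (LinearEquiv.symm_apply_eq _).mpr (DirectSum.coeLinearMap_lof _ h x).symm

theorem wtComponent_self (hY : IsModule Y) {h : ℂ} {x : M} (hx : x ∈ wtSpace Y h) :
    wtComponent hY h x = ⟨x, hx⟩ := by
  have := wtComponent_lof hY ⟨x, hx⟩
  simp only [wtComponent, LinearMap.comp_apply, LinearEquiv.coe_coe, this,
    DirectSum.component.lof_self]

theorem wtComponent_of_ne (hY : IsModule Y) {h h' : ℂ} (hne : h' ≠ h) {x : M}
    (hx : x ∈ wtSpace Y h') : wtComponent hY h x = 0 := by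
  have := wtComponent_lof hY ⟨x, hx⟩
  simp only [wtComponent, LinearMap.comp_apply, LinearEquiv.coe_coe, this]
  rw [DirectSum.component.of, dif_neg hne]

/-- Allowing every larger set `t` lets two vectors use a common finite set of weights in the
additive step. -/
theorem exists_sum_wtComponent (hY : IsModule Y) (x : M) :
    ∃ s : Finset ℂ, ∀ t, s ⊆ t → ∑ h ∈ t, (wtComponent hY h x : M) = x := by
  classical
  induction x using wtSpace_induction hY with
  | mem h x hx =>
    refine ⟨{h}, fun t ht => ?_⟩
    rw [Finset.sum_eq_single_of_mem h (ht (Finset.mem_singleton_self h)), wtComponent_self hY hx]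
    intro h' _ hne
    rw [wtComponent_of_ne hY hne.symm hx, Submodule.coe_zero]
  | zero => exact ⟨∅, fun t _ => by simp⟩
  | add x y hx hy =>
    obtain ⟨s, hs⟩ := hx
    obtain ⟨s', hs'⟩ := hy
    refine ⟨s ∪ s', fun t ht => ?_⟩
    simp only [map_add, Submodule.coe_add, Finset.sum_add_distrib]
    rw [hs t (Finset.union_subset_left ht), hs' t (Finset.union_subset_right ht)]

/-- The grading by `ℤ` is spread over `ℂ` as `q`, zero off the integers. By `eigenspace_eq_of_le`
these are all the weight spaces. -/
theorem adjoint_isModule : IsModule (VertexOperatorAlgebra.Y (V := V)) := by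
  set q : ℂ → Submodule ℂ V := fun h =>
    ⨆ (n : ℤ) (_ : (n : ℂ) = h), VertexOperatorAlgebra.homogeneous (V := V) n with hq
  have hle : ∀ h, q h ≤ wtSpace (VertexOperatorAlgebra.Y (V := V)) h := fun h =>
    iSup₂_le fun n hn x hx => by
      subst hn
      exact (mem_homogeneous_iff n x).mp hx
  have htop : ⨆ h, q h = ⊤ := by
    rw [eq_top_iff, ← VertexOperatorAlgebra.isInternal.submodule_iSup_eq_top]
    exact iSup_le fun n => le_iSup_of_le (n : ℂ) (le_iSup₂_of_le n rfl le_rfl)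
  have hwt : ∀ n : ℤ, wtSpace (VertexOperatorAlgebra.Y (V := V)) n
      = VertexOperatorAlgebra.homogeneous n := fun n => by
    ext x
    exact (mem_homogeneous_iff n x).symm
  have hbot : ∀ h : ℂ, (∀ n : ℤ, (n : ℂ) ≠ h) →
      wtSpace (VertexOperatorAlgebra.Y (V := V)) h = ⊥ := fun h hh => by
    rw [wtSpace, eigenspace_eq_of_le hle htop h, hq, eq_bot_iff]
    exact iSup₂_le fun n hn => absurd hn (hh n)
  refine ⟨adjoint_isWeakModule, ?_, fun h => ?_, fun h => ?_⟩
  · rw [eq_top_iff, ← htop]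
    exact iSup_mono hle
  · by_cases hh : ∃ n : ℤ, (n : ℂ) = h
    · obtain ⟨n, rfl⟩ := hh
      rw [hwt]
      exact VertexOperatorAlgebra.finiteDimensional n
    · rw [hbot h fun n hn => hh ⟨n, hn⟩]
      infer_instance
  · by_cases hh : ∃ n : ℤ, (n : ℂ) = h
    · obtain ⟨k, rfl⟩ := hh
      obtain ⟨N, hN⟩ := VertexOperatorAlgebra.lower_bound (V := V)
      refine ⟨N - k, fun n hn => ?_⟩
      rw [← Int.cast_add, hwt, hN _ (by omega)]
    · refine ⟨0, fun n _ => hbot _ fun k hk => hh ⟨k - n, ?_⟩⟩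
      push_cast
      rw [hk]
      ring

/-- A vertex operator algebra as a module over itself. -/
abbrev adjointModule (V : Type u) [AddCommGroup V] [Module ℂ V] [VertexOperatorAlgebra V] :
    VModule.{u, u} V where
  carrier := V
  Y := VertexOperatorAlgebra.Y
  isModule := adjoint_isModule

/-- The phase `(e^{πi})^h`. -/
noncomputable def phase (h : ℂ) : ℂ := Complex.exp (Real.pi * Complex.I * h)

theorem phase_add_one (h : ℂ) : phase (h + 1) = -phase h := by
  rw [phase, mul_add, mul_one, Complex.exp_add, Complex.exp_pi_mul_I, phase]
  ring

theorem phase_zero : phase 0 = 1 := by simp [phase]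

theorem phase_intCast (n : ℤ) : phase n = (-1) ^ n := by
  have := phase_sub_int phase_add_one 0 n
  rwa [zero_add, phase_zero, mul_one] at this

end Weights

/-! ### Adjoint operators between restricted duals. -/

section Adjoint

variable {V : Type u} [AddCommGroup V] [Module ℂ V] [VertexOperatorAlgebra V]
  {A : VModule.{u, w} V}

/-- Integer weights have phase `(-1)^n`, so the contragredient action is the adjoint of the vertex
operator map. This is what reduces contragredients to adjoints. -/
theorem opp_modeSeries_intCast (M : VModule.{u, v} V) (a : V) (m : ℤ) (x : M) :
    opp phase (adjointModule V) (modeSeries M.Y) a (m : ℂ) x = oppositeMode M m a x := by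
  induction a using homogeneous_induction with
  | mem n a ha =>
    obtain ⟨N, hN⟩ := dpow_L_one_eventually_homogeneous ha
    rw [opp_apply_sum (A := adjointModule V) phase (modeSeries M.Y) m
      ((mem_homogeneous_iff n a).mp ha) hN, oppositeMode_apply_sum M m n ha hN, phase_intCast]
    congr 1
    refine Finset.sum_congr rfl fun k _ => ?_
    rw [show (2 * (n : ℂ) - k - 2 - m) = ((2 * n - k - 2 - m : ℤ) : ℂ) by push_cast; ring,
      modeSeries_intCast]
  | zero =>
    have : opp phase (adjointModule V) (modeSeries M.Y) (0 : V) = 0 := map_zero _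
    rw [this, map_zero]
    rfl
  | add a b ha hb =>
    have : opp phase (adjointModule V) (modeSeries M.Y) (a + b : V)
      = opp phase (adjointModule V) (modeSeries M.Y) a
        + opp phase (adjointModule V) (modeSeries M.Y) b := map_add _ _ _
    rw [this, map_add, Pi.add_apply, LinearMap.add_apply, LinearMap.add_apply, ha, hb]

theorem opp_modeSeries_eq_zero (M : VModule.{u, v} V) (a : V) {α : ℂ}
    (hα : ∀ n : ℤ, (n : ℂ) ≠ α) (x : M) :
    opp phase (adjointModule V) (modeSeries M.Y) a α x = 0 := by
  induction a using homogeneous_induction with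
  | mem n a ha =>
    obtain ⟨N, hN⟩ := dpow_L_one_eventually_homogeneous ha
    rw [opp_apply_sum (A := adjointModule V) phase (modeSeries M.Y) α
      ((mem_homogeneous_iff n a).mp ha) hN, Finset.sum_eq_zero, smul_zero]
    intro k _
    rw [modeSeries_eq_zero, LinearMap.zero_apply]
    intro j hj
    refine hα (2 * n - k - 2 - j) ?_
    push_cast
    rw [hj]
    ring
  | zero =>
    have : opp phase (adjointModule V) (modeSeries M.Y) (0 : V) = 0 := map_zero _
    rw [this]
    rfl
  | add a b ha hb =>
    have : opp phase (adjointModule V) (modeSeries M.Y) (a + b : V)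
      = opp phase (adjointModule V) (modeSeries M.Y) a
        + opp phase (adjointModule V) (modeSeries M.Y) b := map_add _ _ _
    rw [this, Pi.add_apply, LinearMap.add_apply, ha, hb, add_zero]

/-- A family of operators that respects weights as an intertwining operator does. -/
def IsGraded {A B C : Type*} [AddCommGroup A] [Module ℂ A] [AddCommGroup B] [Module ℂ B]
    [AddCommGroup C] [Module ℂ C] (YA : ModeMap V A) (YB : ModeMap V B) (YC : ModeMap V C)
    (I : OperatorSeries A B C) : Prop :=
  ∀ (h₁ h₂ : ℂ), ∀ u ∈ wtSpace YA h₁, ∀ w ∈ wtSpace YB h₂, ∀ α : ℂ,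
    I u α w ∈ wtSpace YC (h₁ + h₂ - α - 1)

theorem Inter.isGraded {A B C : Type*} [AddCommGroup A] [Module ℂ A] [AddCommGroup B] [Module ℂ B]
    [AddCommGroup C] [Module ℂ C] {YA : ModeMap V A} {YB : ModeMap V B} {YC : ModeMap V C}
    {I : OperatorSeries A B C} (hI : Inter YA YB YC I) : IsGraded YA YB YC I :=
  fun _ _ _ hu _ hw α => hI.mem_wtSpace hu hw α

variable {B C : VModule.{u, v} V} {I : OperatorSeries A B C}

/-- The loss of weight `k` under `L(1)^k` is offset by the lower mode index, so all terms have the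
same weight. -/
theorem opp_mem_wtSpace (hI : IsGraded A.Y B.Y C.Y I) (κ : ℂ → ℂ) {h h₂ : ℂ} {u : A}
    (hu : u ∈ wtSpace A.Y h) {x : B} (hx : x ∈ wtSpace B.Y h₂) (β : ℂ) :
    opp κ A I u β x ∈ wtSpace C.Y (h₂ - h + β + 1) := by
  obtain ⟨N, hN⟩ := dpow_L_one_eventually A.isModule hu
  rw [opp_apply_sum κ I β hu hN]
  refine Submodule.smul_mem _ _ (Submodule.sum_mem _ fun k _ => ?_)
  have := hI _ _ _ (dpow_L_one_mem A.isModule.toIsWeakModule k hu) x hx (2 * h - k - 2 - β)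
  rwa [show h - (k : ℂ) + h₂ - (2 * h - k - 2 - β) - 1 = h₂ - h + β + 1 by ring] at this

theorem opp_dual_mem (hI : IsGraded A.Y B.Y C.Y I) (κ : ℂ → ℂ) (u : A) (β : ℂ)
    (f : Module.Dual ℂ C) (hf : f ∈ restrictedDual C) :
    Module.Dual.transpose (R := ℂ) (opp κ A I u β) f ∈ restrictedDual B := by
  induction u using wtSpace_induction A.isModule with
  | mem h u hu =>
    have hinj : Function.Injective fun h₂ : ℂ => h₂ - h + β + 1 := fun x y hxy => by
      simpa using hxy
    refine (Set.Finite.preimage hinj.injOn hf).subset ?_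
    rintro h₂ ⟨x, hx, hne⟩
    exact ⟨opp κ A I u β x, opp_mem_wtSpace hI κ hu hx β, hne⟩
  | zero => simp
  | add u u' hu hu' => simpa using Submodule.add_mem _ hu hu'

/-- The adjoint of an intertwining operator, between restricted duals. -/
noncomputable def restrictedAdjoint (κ : ℂ → ℂ) (hI : IsGraded A.Y B.Y C.Y I) :
    OperatorSeries A (restrictedDual C) (restrictedDual B) where
  toFun u β := (Module.Dual.transpose (R := ℂ) (opp κ A I u β)).restrict (opp_dual_mem hI κ u β)
  map_add' u u' := by
    funext β; ext f x; simp
  map_smul' c u := by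
    funext β; ext f x; simp

theorem restrictedAdjoint_apply (κ : ℂ → ℂ) (hI : IsGraded A.Y B.Y C.Y I) (u : A) (β : ℂ)
    (f : restrictedDual C) (x : B) :
    (restrictedAdjoint κ hI u β f).1 x = f.1 (opp κ A I u β x) := rfl

/-- The functional `f` sees only finitely many weights `s`. At index `β + n` it can be reached only
from weight `s + h - β - 1 - n` of `B`, where there is nothing for large `n`. -/
theorem restrictedAdjoint_truncated (κ : ℂ → ℂ) (hI : IsGraded A.Y B.Y C.Y I) :
    IsTruncated (restrictedAdjoint κ hI) := by
  intro u f β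
  induction u using wtSpace_induction A.isModule with
  | mem h u hu =>
    have hS : {h : ℂ | ∃ w ∈ wtSpace C.Y h, f.1 w ≠ 0}.Finite := f.2
    choose N hN using fun s : ℂ => B.isModule.lower_bound (s + h - β - 1)
    obtain ⟨K, hK⟩ := (hS.image N).bddBelow
    -- The number `K` bounds the thresholds of the finitely many cosets from below, and `n ≥ 1 - K`
    -- gives `-n < K`.
    refine ⟨1 - K, fun n hn => ?_⟩
    ext x
    induction x using wtSpace_induction B.isModule with
    | mem h₂ x hx =>
      by_contra hne
      have hs : h₂ - h + (β + n) + 1 ∈ {h : ℂ | ∃ w ∈ wtSpace C.Y h, f.1 w ≠ 0} :=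
        ⟨_, opp_mem_wtSpace hI κ hu hx (β + n), hne⟩
      have hb := hN (h₂ - h + (β + n) + 1) (-n) (by
        have : K ≤ N (h₂ - h + (β + n) + 1) := hK ⟨_, hs, rfl⟩
        omega)
      rw [show h₂ - h + (β + n) + 1 + h - β - 1 + ((-n : ℤ) : ℂ) = h₂ by push_cast; ring] at hb
      rw [hb, Submodule.mem_bot] at hx
      exact hne (by simp [hx])
    | zero => simp
    | add x y hx hy =>
      rw [map_add, hx, hy, map_add]
  | zero => exact ⟨0, fun n _ => by simp⟩
  | add u u' hu hu' =>
    obtain ⟨N, hN⟩ := hu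
    obtain ⟨N', hN'⟩ := hu'
    refine ⟨max N N', fun n hn => ?_⟩
    rw [map_add, Pi.add_apply, LinearMap.add_apply, hN n (le_trans (le_max_left _ _) hn),
      hN' n (le_trans (le_max_right _ _) hn), add_zero]

theorem modeSeries_contragredientAction (M : VModule.{u, v} V) (a : V) (α : ℂ)
    (f : restrictedDual M) (x : M) :
    (modeSeries (contragredientAction M) a α f).1 x
      = f.1 (opp phase (adjointModule V) (modeSeries M.Y) a α x) := by
  by_cases hα : ∃ n : ℤ, (n : ℂ) = α
  · obtain ⟨n, rfl⟩ := hα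
    rw [modeSeries_intCast, opp_modeSeries_intCast]
    rfl
  · have h : ∀ n : ℤ, (n : ℂ) ≠ α := fun n hn => hα ⟨n, hn⟩
    rw [modeSeries_eq_zero _ _ h, opp_modeSeries_eq_zero M a h, map_zero]
    rfl

theorem contragredientAction_truncation (M : VModule.{u, v} V) (a : V) (f : restrictedDual M) :
    ∃ N : ℤ, ∀ n, N ≤ n → contragredientAction M a n f = 0 := by
  obtain ⟨N, hN⟩ := restrictedAdjoint_truncated (A := adjointModule V) phase
    (modeSeries_inter M.isModule.toIsWeakModule).isGraded a f 0
  refine ⟨N, fun n hn => ?_⟩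
  have := hN n hn
  rw [zero_add] at this
  rw [← this]
  ext x
  rw [restrictedAdjoint_apply, opp_modeSeries_intCast]
  rfl

/-- Evaluation at a vector, as a functional on the restricted dual. -/
def evalAt (M : VModule.{u, v} V) : M →ₗ[ℂ] Module.Dual ℂ (restrictedDual M) :=
  (restrictedDual M).subtype.flip

theorem eq_of_evalAt_eq {M : VModule.{u, v} V} {f g : restrictedDual M}
    (h : ∀ x, evalAt M x f = evalAt M x g) : f = g :=
  Subtype.ext (LinearMap.ext h)

/-- The adjoint of an intertwining operator is an intertwining operator. -/
theorem Inter.restrictedAdjoint {κ : ℂ → ℂ} (hκ : ∀ h, κ (h + 1) = -κ h)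
    (hI : Inter A.Y B.Y C.Y I) :
    Inter A.Y (contragredientAction C) (contragredientAction B)
      (restrictedAdjoint κ hI.isGraded) where
  truncated := restrictedAdjoint_truncated κ hI.isGraded
  derivative u α := by
    ext f x
    have := congrArg (fun φ => f.1 (φ x)) (opp_L_neg_one hI.derivative hκ u α)
    simpa [restrictedAdjoint_apply] using this
  -- Dualization reverses the order of composition. Evaluated at a vector, the identity is `f`
  -- applied to `Inter.opp_isJacobi`.
  isJacobi a u f :=
    (jacobiSummable_of_truncated A.isModule.truncation (contragredientAction_truncation C)
      (restrictedAdjoint_truncated κ hI.isGraded) a u f).isJacobi_of_separating (evalAt B)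
      (fun _ _ => eq_of_evalAt_eq) fun x => (hI.opp_isJacobi hκ a u x).map f.1

end Adjoint

/-! ### The contragredient module. -/

section Contragredient

variable {V : Type u} [AddCommGroup V] [Module ℂ V] [VertexOperatorAlgebra V]

/-- The derivative property and the Jacobi identity are read off from the adjoint of the vertex
operator map, which is an intertwining operator of type `(M over V M)`. -/
theorem contragredientAction_isWeakModule (M : VModule.{u, v} V) :
    IsWeakModule (contragredientAction M) := by
  have hI := modeSeries_inter M.isModule.toIsWeakModule
  have hadj := Inter.restrictedAdjoint (A := adjointModule V) (B := M) (C := M) phase_add_one hI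
  have hmode : ∀ (a : V) (n : ℤ), restrictedAdjoint (A := adjointModule V) phase hI.isGraded a (n : ℂ)
      = contragredientAction M a n := fun a n => by
    ext f x
    rw [restrictedAdjoint_apply, opp_modeSeries_intCast]
    rfl
  refine ⟨fun n => ?_, fun a n => ?_, contragredientAction_truncation M, fun a b f l m n => ?_⟩
  · have hN : ∀ k, 1 ≤ k → dpow (L (VertexOperatorAlgebra.Y (V := V)) 1) k
        VertexOperatorAlgebra.one = 0 := fun k hk => by
      obtain ⟨k, rfl⟩ := Nat.exists_eq_add_of_le' hk
      rw [dpow, pow_succ, LinearMap.smul_apply, Module.End.mul_apply, L_one_one, map_zero,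
        smul_zero]
    ext f x
    have h1 := oppositeMode_apply_sum M n 0 one_mem_homogeneous hN x
    simp only [Finset.range_one, Finset.sum_singleton, dpow_zero, zpow_zero, one_smul,
      M.isModule.one_mode] at h1
    have h2 : (contragredientAction M VertexOperatorAlgebra.one n f).1 x
        = f.1 (oppositeMode M n VertexOperatorAlgebra.one x) := rfl
    rw [h2, h1]
    by_cases hn : n = -1
    · subst hn; simp
    · rw [if_neg (by simp; omega), if_neg hn]; simp
  · have := hadj.derivative a n
    rw [show (n : ℂ) - 1 = ((n - 1 : ℤ) : ℂ) by push_cast; rfl, hmode, hmode] at this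
    exact this
  · have := jacobi_of_isJacobi (hadj.isJacobi a b f) l m n
    simp only [hmode] at this
    exact this

/-- Since `L(1)ω = 0` and `ω` has weight 2, the opposite of `ω_1` has the single term `ω_1`, with
sign `(-1)^2`. -/
theorem L_zero_contragredient (M : VModule.{u, v} V) (f : restrictedDual M) (x : M) :
    (L (contragredientAction M) 0 f).1 x = f.1 (L M.Y 0 x) := by
  have hN : ∀ k, 1 ≤ k → dpow (L (VertexOperatorAlgebra.Y (V := V)) 1) k
      VertexOperatorAlgebra.omega = 0 := fun k hk => by
    obtain ⟨k, rfl⟩ := Nat.exists_eq_add_of_le' hk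
    rw [dpow, pow_succ, LinearMap.smul_apply, Module.End.mul_apply, L_one_omega, map_zero,
      smul_zero]
  have h1 := oppositeMode_apply_sum M 1 2 omega_mem hN x
  have h2 : (L (contragredientAction M) 0 f).1 x
      = f.1 (oppositeMode M 1 VertexOperatorAlgebra.omega x) := rfl
  rw [h2, h1]
  simp [dpow_zero, L]

theorem mem_wtSpace_contragredient_iff (M : VModule.{u, v} V) (h : ℂ) (f : restrictedDual M) :
    f ∈ wtSpace (contragredientAction M) h ↔ ∀ h', h' ≠ h → ∀ x ∈ wtSpace M.Y h', f.1 x = 0 := by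
  rw [wtSpace, Module.End.mem_eigenspace_iff]
  refine ⟨fun hf h' hne x hx => ?_, fun hf => ?_⟩
  · have h1 := congrArg (fun g => g.1 x) hf
    simp only [L_zero_contragredient] at h1
    rw [wtSpace, Module.End.mem_eigenspace_iff] at hx
    rw [hx, map_smul, Submodule.coe_smul, LinearMap.smul_apply, ← sub_eq_zero, ← sub_smul] at h1
    exact (smul_eq_zero.mp h1).resolve_left (sub_ne_zero.mpr hne)
  · ext x
    rw [L_zero_contragredient]
    induction x using wtSpace_induction M.isModule with
    | mem h' x hx =>
      have hx' := hx
      rw [wtSpace, Module.End.mem_eigenspace_iff] at hx'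
      rw [hx', map_smul, Submodule.coe_smul, LinearMap.smul_apply]
      by_cases hne : h' = h
      · rw [hne]
      · rw [hf h' hne x hx, smul_zero, smul_zero]
    | zero => simp
    | add x y hx hy => rw [map_add, map_add, hx, hy, map_add]

/-- A functional on a weight space, extended by zero to the other weight spaces. -/
noncomputable def extendDual (M : VModule.{u, v} V) (h : ℂ) :
    Module.Dual ℂ (wtSpace M.Y h) →ₗ[ℂ] restrictedDual M :=
  LinearMap.codRestrict _ (Module.Dual.transpose (R := ℂ) (wtComponent M.isModule h)) fun g => by
    refine (Set.finite_singleton h).subset ?_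
    rintro h' ⟨x, hx, hne⟩
    by_contra hh
    refine hne ?_
    rw [Module.Dual.transpose_apply, LinearMap.comp_apply, wtComponent_of_ne _ hh hx, map_zero]

theorem extendDual_apply (M : VModule.{u, v} V) (h : ℂ) (g : Module.Dual ℂ (wtSpace M.Y h))
    (x : M) : (extendDual M h g).1 x = g (wtComponent M.isModule h x) := rfl

theorem extendDual_mem (M : VModule.{u, v} V) (h : ℂ) (g : Module.Dual ℂ (wtSpace M.Y h)) :
    extendDual M h g ∈ wtSpace (contragredientAction M) h := by
  rw [mem_wtSpace_contragredient_iff]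
  intro h' hne x hx
  rw [extendDual_apply, wtComponent_of_ne _ hne hx, map_zero]

theorem extendDual_domRestrict (M : VModule.{u, v} V) {h : ℂ} {f : restrictedDual M}
    (hf : f ∈ wtSpace (contragredientAction M) h) :
    extendDual M h (f.1.domRestrict (wtSpace M.Y h)) = f := by
  rw [mem_wtSpace_contragredient_iff] at hf
  ext x
  rw [extendDual_apply]
  induction x using wtSpace_induction M.isModule with
  | mem h' x hx =>
    by_cases hne : h' = h
    · subst hne
      rw [wtComponent_self _ hx]
      rfl
    · rw [wtComponent_of_ne _ hne hx, map_zero, hf h' hne x hx]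
  | zero => simp
  | add x y hx hy => rw [map_add, map_add, hx, hy, map_add]

/-- The contragredient of a module is a module. -/
theorem contragredientAction_isModule (M : VModule.{u, v} V) :
    IsModule (contragredientAction M) where
  toIsWeakModule := contragredientAction_isWeakModule M
  iSup_wtSpace := by
    rw [eq_top_iff]
    rintro f -
    have hS : {h : ℂ | ∃ w ∈ wtSpace M.Y h, f.1 w ≠ 0}.Finite := f.2
    have hf : f = ∑ h ∈ hS.toFinset, extendDual M h (f.1.domRestrict (wtSpace M.Y h)) := by
      ext x
      rw [AddSubmonoidClass.coe_finsetSum, LinearMap.sum_apply]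
      simp only [extendDual_apply]
      induction x using wtSpace_induction M.isModule with
      | mem h x hx =>
        by_cases hx0 : f.1 x = 0
        · rw [hx0, Finset.sum_eq_zero]
          intro h' _
          by_cases hne : h = h'
          · subst hne
            rw [wtComponent_self _ hx]
            exact hx0
          · rw [wtComponent_of_ne _ hne hx, map_zero]
        · rw [Finset.sum_eq_single_of_mem h (hS.mem_toFinset.mpr ⟨x, hx, hx0⟩),
            wtComponent_self _ hx]
          · rfl
          · intro h' _ hne
            rw [wtComponent_of_ne _ hne.symm hx, map_zero]
      | zero => simp
      | add x y hx hy => simp only [map_add, Finset.sum_add_distrib, ← hx, ← hy]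
    rw [hf]
    exact Submodule.sum_mem _ fun h _ => Submodule.mem_iSup_of_mem h (extendDual_mem M h _)
  finiteDimensional h := by
    have := M.isModule.finiteDimensional h
    refine FiniteDimensional.of_injective (K := ℂ) (V₂ := Module.Dual ℂ (wtSpace M.Y h))
      ((LinearMap.lcomp ℂ ℂ (wtSpace M.Y h).subtype) ∘ₗ (restrictedDual M).subtype ∘ₗ
        (wtSpace (contragredientAction M) h).subtype) ?_
    intro f g hfg
    ext1
    rw [← extendDual_domRestrict M f.2, ← extendDual_domRestrict M g.2]
    exact congrArg (extendDual M h) hfg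
  lower_bound h := by
    obtain ⟨N, hN⟩ := M.isModule.lower_bound h
    refine ⟨N, fun n hn => ?_⟩
    rw [eq_bot_iff]
    intro f hf
    rw [Submodule.mem_bot, ← extendDual_domRestrict M hf]
    have : f.1.domRestrict (wtSpace M.Y (h + n)) = 0 := by
      ext ⟨x, hx⟩
      rw [hN n hn, Submodule.mem_bot] at hx
      simp [hx]
    rw [this, map_zero]

end Contragredient

/-! ### Homomorphisms and double duality. -/

section DoubleDual

variable {V : Type u} [AddCommGroup V] [Module ℂ V] [VertexOperatorAlgebra V]

/-- Linear maps commuting with all vertex operators. -/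
def IsHom {M N : Type*} [AddCommGroup M] [Module ℂ M] [AddCommGroup N] [Module ℂ N]
    (YM : ModeMap V M) (YN : ModeMap V N) (φ : M →ₗ[ℂ] N) : Prop :=
  ∀ (a : V) (n : ℤ) (x : M), φ (YM a n x) = YN a n (φ x)

section

variable {M N : Type*} [AddCommGroup M] [Module ℂ M] [AddCommGroup N] [Module ℂ N]
  {YM : ModeMap V M} {YN : ModeMap V N} {φ : M →ₗ[ℂ] N}

theorem IsHom.map_wtSpace (hφ : IsHom YM YN φ) {h : ℂ} {x : M} (hx : x ∈ wtSpace YM h) :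
    φ x ∈ wtSpace YN h := by
  rw [wtSpace, Module.End.mem_eigenspace_iff] at hx ⊢
  have := hφ VertexOperatorAlgebra.omega (0 + 1) x
  rw [L] at hx ⊢
  rw [← this, hx, map_smul]

theorem IsHom.symm {e : M ≃ₗ[ℂ] N} (he : IsHom YM YN e.toLinearMap) :
    IsHom YN YM e.symm.toLinearMap := fun a n x => by
  have := he a n (e.symm x)
  simp only [LinearEquiv.coe_coe, LinearEquiv.apply_symm_apply] at this ⊢
  rw [← this, LinearEquiv.symm_apply_apply]

variable {A B : Type*} [AddCommGroup A] [Module ℂ A] [AddCommGroup B] [Module ℂ B]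
  {YA : ModeMap V A} {YB : ModeMap V B}

/-- The composition of a family of operators with a linear map of the target. -/
def postcomp (φ : M →ₗ[ℂ] N) (I : OperatorSeries A B M) : OperatorSeries A B N where
  toFun u α := φ ∘ₗ I u α
  map_add' u u' := by funext α; simp [LinearMap.comp_add]
  map_smul' c u := by funext α; simp [LinearMap.comp_smul]

theorem postcomp_apply (φ : M →ₗ[ℂ] N) (I : OperatorSeries A B M) (u : A) (α : ℂ) (x : B) :
    postcomp φ I u α x = φ (I u α x) := rfl

theorem Inter.postcomp {I : OperatorSeries A B M} (hI : Inter YA YB YM I)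
    (hφ : IsHom YM YN φ) : Inter YA YB YN (postcomp φ I) where
  truncated u x α := by
    obtain ⟨N, hN⟩ := hI.truncated u x α
    exact ⟨N, fun n hn => by rw [postcomp_apply, hN n hn, map_zero]⟩
  derivative u α := by
    ext x
    simp [postcomp_apply, hI.derivative]
  isJacobi a u x := by
    have := (hI.isJacobi a u x).map φ
    simp only [hφ a] at this
    exact this

theorem Inter.precomp {A' : Type*} [AddCommGroup A'] [Module ℂ A'] {YA' : ModeMap V A'}
    {I : OperatorSeries A B M} (hI : Inter YA YB YM I) {ψ : A' →ₗ[ℂ] A} (hψ : IsHom YA' YA ψ) :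
    Inter YA' YB YM (I ∘ₗ ψ) where
  truncated u x α := hI.truncated (ψ u) x α
  derivative u α := by
    have := hψ VertexOperatorAlgebra.omega (-1 + 1) u
    rw [LinearMap.comp_apply, LinearMap.comp_apply, ← hI.derivative, L, this, L]
  isJacobi a u x := by
    have := hI.isJacobi a (ψ u) x
    simp only [← hψ a] at this
    exact this

end

/-- The contragredient module. -/
noncomputable abbrev dualModule (M : VModule.{u, v} V) : VModule.{u, v} V where
  carrier := restrictedDual M
  Y := contragredientAction M
  isModule := contragredientAction_isModule M

/-- Two operators that are transposes of each other for given pairings have transposed opposites.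
This is used to compute the opposite of an adjoint. -/
theorem opp_pairing {A : VModule.{u, w} V} {B C D E : Type*} [AddCommGroup B] [Module ℂ B]
    [AddCommGroup C] [Module ℂ C] [AddCommGroup D] [Module ℂ D] [AddCommGroup E] [Module ℂ E]
    (κ : ℂ → ℂ) {I : OperatorSeries A B C} {J : OperatorSeries A D E} (b₁ : C →ₗ[ℂ] D →ₗ[ℂ] ℂ)
    (b₂ : B →ₗ[ℂ] E →ₗ[ℂ] ℂ) (h : ∀ u β x y, b₁ (I u β x) y = b₂ x (J u β y)) (u : A) (β : ℂ)
    (x : B) (y : D) : b₁ (opp κ A I u β x) y = b₂ x (opp κ A J u β y) := by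
  induction u using wtSpace_induction A.isModule with
  | mem r u hu =>
    obtain ⟨N, hN⟩ := dpow_L_one_eventually A.isModule hu
    rw [opp_apply_sum κ I β hu hN, opp_apply_sum κ J β hu hN]
    simp only [map_smul, map_sum, LinearMap.smul_apply, LinearMap.sum_apply, h]
  | zero => simp
  | add u u' hu hu' => simp [hu, hu']

theorem evalAt_mem (M : VModule.{u, v} V) (x : M) :
    evalAt M x ∈ restrictedDual (dualModule M) := by
  induction x using wtSpace_induction M.isModule with
  | mem h x hx =>
    refine (Set.finite_singleton h).subset ?_
    rintro h' ⟨f, hf, hne⟩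
    by_contra hh
    exact hne ((mem_wtSpace_contragredient_iff M h' f).mp hf h (fun e => hh e.symm) x hx)
  | zero => rw [map_zero]; exact Submodule.zero_mem _
  | add x y hx hy => rw [map_add]; exact Submodule.add_mem _ hx hy

/-- The canonical map to the double contragredient. -/
noncomputable def toDoubleDual (M : VModule.{u, v} V) : M →ₗ[ℂ] restrictedDual (dualModule M) :=
  LinearMap.codRestrict _ (evalAt M) (evalAt_mem M)

theorem toDoubleDual_apply (M : VModule.{u, v} V) (x : M) (f : restrictedDual M) :
    (toDoubleDual M x).1 f = f.1 x := rfl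

theorem eq_zero_of_restrictedDual (M : VModule.{u, v} V) {x : M}
    (h : ∀ f : restrictedDual M, f.1 x = 0) : x = 0 := by
  obtain ⟨s, hs⟩ := exists_sum_wtComponent M.isModule x
  rw [← hs s subset_rfl]
  refine Finset.sum_eq_zero fun r _ => ?_
  rw [(Module.forall_dual_apply_eq_zero_iff ℂ (wtComponent M.isModule r x)).mp fun g =>
    h (extendDual M r g), Submodule.coe_zero]

/-- For surjectivity, finite-dimensionality of each weight space makes the functional there an
evaluation at a vector, and only finitely many of these vectors are needed. -/
theorem toDoubleDual_bijective (M : VModule.{u, v} V) : Function.Bijective (toDoubleDual M) := by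
  refine ⟨?_, fun F => ?_⟩
  · rw [injective_iff_map_eq_zero]
    intro x hx
    exact eq_zero_of_restrictedDual M fun f => congrArg (fun F => F.1 f) hx
  · have hS : {h : ℂ | ∃ f ∈ wtSpace (contragredientAction M) h, F.1 f ≠ 0}.Finite := F.2
    have hx : ∀ h, ∃ x : wtSpace M.Y h, ∀ g, g x = F.1 (extendDual M h g) := fun h => by
      have := M.isModule.finiteDimensional h
      obtain ⟨x, hx⟩ := (Module.evalEquiv ℂ (wtSpace M.Y h)).surjective (F.1 ∘ₗ extendDual M h)
      exact ⟨x, fun g => congrArg (fun φ => φ g) hx⟩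
    choose x hx using hx
    refine ⟨∑ h ∈ hS.toFinset, (x h : M), ?_⟩
    ext f
    rw [toDoubleDual_apply, map_sum]
    induction f using wtSpace_induction (contragredientAction_isModule M) with
    | mem h f hf =>
      have hfF : F.1 f = f.1 (x h) := by
        conv_lhs => rw [← extendDual_domRestrict M hf, ← hx]
        rfl
      have hf0 := (mem_wtSpace_contragredient_iff M h f).mp hf
      by_cases h0 : F.1 f = 0
      · rw [h0]
        refine Finset.sum_eq_zero fun h' _ => ?_
        by_cases hne : h' = h
        · subst hne
          rw [← hfF, h0]
        · exact hf0 h' hne _ (x h').2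
      · rw [Finset.sum_eq_single_of_mem h (hS.mem_toFinset.mpr ⟨f, hf, h0⟩), hfF]
        intro h' _ hne
        exact hf0 h' hne _ (x h').2
    | zero => simp
    | add f g hf hg =>
      rw [map_add, ← hf, ← hg, ← Finset.sum_add_distrib]
      rfl

/-- The canonical isomorphism to the double contragredient. -/
noncomputable def doubleDualEquiv (M : VModule.{u, v} V) :
    M ≃ₗ[ℂ] restrictedDual (dualModule M) :=
  LinearEquiv.ofBijective (toDoubleDual M) (toDoubleDual_bijective M)

theorem doubleDualEquiv_apply (M : VModule.{u, v} V) (x : M) (f : restrictedDual M) :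
    (doubleDualEquiv M x).1 f = f.1 x := rfl

theorem doubleDualEquiv_symm_apply (M : VModule.{u, v} V) (F : restrictedDual (dualModule M))
    (f : restrictedDual M) : f.1 ((doubleDualEquiv M).symm F) = F.1 f := by
  rw [← doubleDualEquiv_apply, LinearEquiv.apply_symm_apply]

/-- Through the pairing this is a double opposite, which is the identity because the phase `(-1)^p`
squares to one. -/
theorem oppositeMode_dualModule (M : VModule.{u, v} V) (a : V) (n : ℤ) (f : restrictedDual M)
    (x : M) : (oppositeMode (dualModule M) n a f).1 x = f.1 (M.Y a n x) := by
  have h := opp_pairing (A := adjointModule V) phase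
    (I := modeSeries (contragredientAction M))
    (J := opp phase (adjointModule V) (modeSeries M.Y))
    (restrictedDual M).subtype (restrictedDual M).subtype
    (fun a β f x => modeSeries_contragredientAction M a β f x) a n f x
  rw [← opp_modeSeries_intCast (dualModule M)]
  refine h.trans ?_
  rw [← modeSeries_intCast M.Y]
  simp only [Submodule.subtype_apply]
  congr 1
  clear h
  induction a using homogeneous_induction with
  | mem p a ha =>
    rw [opp_opp (A := adjointModule V) phase_add_one (modeSeries M.Y)
      ((mem_homogeneous_iff p a).mp ha), phase_intCast, ← mul_zpow]
    simp
  | zero => simp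
  | add a b ha hb => simp only [map_add, Pi.add_apply, LinearMap.add_apply, ha, hb]

theorem doubleDualEquiv_isHom (M : VModule.{u, v} V) :
    IsHom M.Y (contragredientAction (dualModule M)) (doubleDualEquiv M).toLinearMap :=
  fun a n x => by
    ext f
    exact (oppositeMode_dualModule M a n f x).symm

theorem dual_mem {M N : VModule.{u, v} V} {φ : M →ₗ[ℂ] N} (hφ : IsHom M.Y N.Y φ)
    (f : Module.Dual ℂ N) (hf : f ∈ restrictedDual N) :
    Module.Dual.transpose (R := ℂ) φ f ∈ restrictedDual M := by
  refine Set.Finite.subset hf ?_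
  rintro h ⟨x, hx, hne⟩
  exact ⟨φ x, hφ.map_wtSpace hx, hne⟩

/-- The dual of a homomorphism. -/
noncomputable def dualMap {M N : VModule.{u, v} V} (φ : M →ₗ[ℂ] N) (hφ : IsHom M.Y N.Y φ) :
    restrictedDual N →ₗ[ℂ] restrictedDual M :=
  (Module.Dual.transpose (R := ℂ) φ).restrict (dual_mem hφ)

theorem dualMap_apply {M N : VModule.{u, v} V} (φ : M →ₗ[ℂ] N) (hφ : IsHom M.Y N.Y φ)
    (f : restrictedDual N) (x : M) : (dualMap φ hφ f).1 x = f.1 (φ x) := rfl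

theorem dualMap_isHom {M N : VModule.{u, v} V} (φ : M →ₗ[ℂ] N) (hφ : IsHom M.Y N.Y φ) :
    IsHom (contragredientAction N) (contragredientAction M) (dualMap φ hφ) := fun a n f => by
  ext x
  have : φ (oppositeMode M n a x) = oppositeMode N n a (φ x) := by
    induction a using homogeneous_induction with
    | mem p a ha =>
      obtain ⟨K, hK⟩ := dpow_L_one_eventually_homogeneous ha
      rw [oppositeMode_apply_sum M n p ha hK, oppositeMode_apply_sum N n p ha hK, map_smul,
        map_sum]
      simp only [hφ _ _ _]
    | zero => simp
    | add a b ha hb => simp only [map_add, LinearMap.add_apply, ha, hb]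
  exact congrArg f.1 this.symm

end DoubleDual

/-! ### Multiplication of series by `e^{xT}`. -/

section Expand

variable {C : Type*} [AddCommGroup C] [Module ℂ C]

theorem finsum_finsum_swap {F : ℕ → ℕ → C} {N : ℕ} (h : ∀ i j, N ≤ i + j → F i j = 0) :
    ∑ᶠ i, ∑ᶠ j, F i j = ∑ᶠ j, ∑ᶠ i, F i j := by
  rw [finsum_finsum_antidiagonal h, finsum_finsum_antidiagonal (F := fun j i => F i j) (N := N)
    fun j i hij => h i j (by omega)]
  refine finsum_congr fun s => ?_
  exact (Finset.Nat.sum_antidiagonal_swap (f := fun p => F p.1 p.2)).symm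

/-- A family of vectors indexed by complex numbers that vanishes far up in each coset of `ℤ`. -/
def IsBounded (g : ℂ → C) : Prop := ∀ α : ℂ, ∃ N : ℕ, ∀ k : ℕ, N ≤ k → g (α + k) = 0

/-- The coefficients of `e^{xT} g(x)`. -/
noncomputable def expand (T : Module.End ℂ C) (g : ℂ → C) (α : ℂ) : C :=
  ∑ᶠ k : ℕ, dpow T k (g (α + k))

variable {T : Module.End ℂ C}

theorem IsBounded.exists_dpow {g : ℂ → C} (hg : IsBounded g) (T : Module.End ℂ C) (α : ℂ) :
    ∃ N : ℕ, ∀ k : ℕ, N ≤ k → dpow T k (g (α + k)) = 0 := by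
  obtain ⟨N, hN⟩ := hg α
  exact ⟨N, fun k hk => by rw [hN k hk, map_zero]⟩

theorem IsBounded.mul {g : ℂ → C} (hg : IsBounded g) (c : ℂ → ℂ) :
    IsBounded fun α => c α • g α := fun α => by
  obtain ⟨N, hN⟩ := hg α
  exact ⟨N, fun k hk => by simp only [hN k hk, smul_zero]⟩

theorem expand_add {g g' : ℂ → C} (hg : IsBounded g) (hg' : IsBounded g') (α : ℂ) :
    expand T (fun β => g β + g' β) α = expand T g α + expand T g' α := by
  obtain ⟨N, hN⟩ := hg.exists_dpow T α
  obtain ⟨N', hN'⟩ := hg'.exists_dpow T α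
  rw [expand, expand, expand, ← finsum_add_distrib (finite_support_of_eventually _ N hN)
    (finite_support_of_eventually _ N' hN')]
  simp only [map_add]

theorem expand_periodic (g : ℂ → C) {c : ℂ → ℂ} (hc : ∀ (α : ℂ) (n : ℤ), c (α + n) = c α)
    (hg : IsBounded g) (α : ℂ) : expand T (fun β => c β • g β) α = c α • expand T g α := by
  obtain ⟨N, hN⟩ := hg.exists_dpow T α
  rw [expand, expand, smul_finsum' _ (finite_support_of_eventually _ N hN)]
  refine finsum_congr fun k => ?_
  have := hc α k
  rw [Int.cast_natCast] at this
  rw [this, map_smul]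

/-- The sums over the families that occur in the second and third terms of the Jacobi identity. -/
theorem isBounded_sum {H : ℤ → ℂ → C} {N : ℤ} (hN : ∀ p, N ≤ p → ∀ β, H p β = 0)
    (hH : ∀ p, IsBounded (H p)) (c : ℕ → ℂ) (m n : ℤ) :
    IsBounded fun β => ∑ᶠ i : ℕ, c i • H (m + i) (β + n - i) := fun α => by
  have h1 : ∀ i : ℕ, ∃ K : ℕ, ∀ k : ℕ, K ≤ k → H (m + i) (α + n - i + k) = 0 := fun i => hH _ _
  choose K hK using h1
  refine ⟨(Finset.range (N - m).toNat).sup K, fun k hk => finsum_eq_zero_of_forall_eq_zero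
    fun i => ?_⟩
  by_cases hi : i < (N - m).toNat
  · rw [show α + k + n - i = α + n - i + k by ring,
      hK i k (le_trans (Finset.le_sup (Finset.mem_range.mpr hi)) hk), smul_zero]
  · rw [hN _ (by omega), smul_zero]

theorem sum_expand {H : ℤ → ℂ → C} {N : ℤ} (hN : ∀ p, N ≤ p → ∀ β, H p β = 0)
    (hH : ∀ p, IsBounded (H p)) (c : ℕ → ℂ) (m n : ℤ) (α : ℂ) :
    ∑ᶠ i : ℕ, c i • expand T (H (m + i)) (α + n - i)
      = expand T (fun β => ∑ᶠ i : ℕ, c i • H (m + i) (β + n - i)) α := by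
  have h1 : ∀ i : ℕ, ∃ K : ℕ, ∀ k : ℕ, K ≤ k → H (m + i) (α + n - i + k) = 0 := fun i => hH _ _
  choose K hK using h1
  have h0 : ∀ i k : ℕ, (N - m).toNat + (Finset.range (N - m).toNat).sup K ≤ i + k →
      H (m + i) (α + n - i + k) = 0 := fun i k hik => by
    by_cases hi : i < (N - m).toNat
    · exact hK i k (le_trans (Finset.le_sup (Finset.mem_range.mpr hi)) (by omega))
    · rw [hN _ (by omega)]
  have e1 : ∀ i : ℕ, c i • expand T (H (m + i)) (α + n - i)
      = ∑ᶠ k : ℕ, c i • dpow T k (H (m + i) (α + n - i + k)) := fun i =>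
    smul_finsum' _ (finite_support_of_eventually _
      ((N - m).toNat + (Finset.range (N - m).toNat).sup K) fun k hk => by
        rw [h0 i k (by omega), map_zero])
  rw [finsum_congr e1, finsum_finsum_swap
    (N := (N - m).toNat + (Finset.range (N - m).toNat).sup K) fun i k hik => by
      rw [h0 i k hik, map_zero, smul_zero]]
  refine finsum_congr fun k => ?_
  rw [map_finsum_nat _ ⟨(N - m).toNat, fun i hi => by rw [hN _ (by omega), smul_zero]⟩]
  refine finsum_congr fun i => ?_
  rw [map_smul, show α + k + n - i = α + n - i + k by ring]

/-- The phase `(e^{πi})^{-α-1}` that occurs in the transpose of an intertwining operator. -/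
noncomputable def tphase (α : ℂ) : ℂ := Complex.exp (-(Real.pi * Complex.I * (α + 1)))

theorem tphase_add_int (α : ℂ) (n : ℤ) : tphase (α + n) = (-1) ^ n * tphase α := by
  refine phase_sub_int (κ := tphase) (fun h => ?_) α n
  rw [tphase, tphase, show -((Real.pi : ℂ) * Complex.I * (h + 1 + 1))
    = -(Real.pi * Complex.I * (h + 1)) + -(Real.pi * Complex.I) by ring, Complex.exp_add,
    Complex.exp_neg (Real.pi * Complex.I), Complex.exp_pi_mul_I]
  norm_num

theorem tphase_add_nat (α : ℂ) (n : ℕ) : tphase (α + n) = (-1) ^ n * tphase α := by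
  simpa using tphase_add_int α n

/-- Hence the factor produced by a double transpose can be removed without harming the Jacobi
identity. -/
theorem tphase_sq_add_int (α : ℂ) (n : ℤ) : tphase (α + n) ^ 2 = tphase α ^ 2 := by
  rw [tphase_add_int, mul_pow, ← zpow_natCast, ← zpow_mul, mul_comm n, zpow_mul]
  simp

theorem tphase_ne_zero (α : ℂ) : tphase α ≠ 0 := Complex.exp_ne_zero _

/-- The substitution `x ↦ e^{πi}x` turns one of the two factors `e^{xT}` into `e^{-xT}`, so they
cancel. In coefficients this is again the alternating binomial sum. -/
theorem expand_expand (T : Module.End ℂ C) {g : ℂ → C} (hg : IsBounded g) (α : ℂ) :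
    expand T (fun β => tphase β • expand T (fun γ => tphase γ • g γ) β) α
      = tphase α ^ 2 • g α := by
  obtain ⟨N, hN⟩ := hg α
  have h0 : ∀ k j : ℕ, N ≤ k + j → g (α + k + j) = 0 := fun k j hkj => by
    have := hN _ hkj
    push_cast at this
    rwa [← add_assoc] at this
  have e1 : ∀ k : ℕ, dpow T k (tphase (α + k) • expand T (fun γ => tphase γ • g γ) (α + k))
      = ∑ᶠ j : ℕ, ((-1 : ℂ) ^ k * ((k + j).choose k : ℂ) * tphase α * tphase (α + k + j)) •
        dpow T (k + j) (g (α + k + j)) := fun k => by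
    rw [map_smul, expand, map_finsum_nat _ ⟨N, fun j hj => by
        rw [h0 k j (by omega), smul_zero, map_zero]⟩,
      smul_finsum' _ (finite_support_of_eventually _ N fun j hj => by
        rw [h0 k j (by omega), smul_zero, map_zero, map_zero])]
    refine finsum_congr fun j => ?_
    rw [map_smul, map_smul, dpow_dpow, smul_smul, smul_smul, tphase_add_nat α k]
    congr 1
    ring
  rw [expand, finsum_congr e1, finsum_finsum_antidiagonal (N := N) fun k j hkj => by
    rw [h0 k j hkj, map_zero, smul_zero]]
  have hs : ∀ s : ℕ, ∑ p ∈ Finset.HasAntidiagonal.antidiagonal s,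
      ((-1 : ℂ) ^ p.1 * ((p.1 + p.2).choose p.1 : ℂ) * tphase α * tphase (α + p.1 + p.2)) •
        dpow T (p.1 + p.2) (g (α + p.1 + p.2))
      = ((if s = 0 then 1 else 0) * tphase α * tphase (α + s)) • dpow T s (g (α + s)) :=
    fun s => by
    rw [← neg_one_pow_sum_choose, Finset.sum_mul, Finset.sum_mul, Finset.sum_smul]
    refine Finset.sum_congr rfl fun p hp => ?_
    have hp := Finset.HasAntidiagonal.mem_antidiagonal.mp hp
    rw [Nat.choose_symm_add, add_assoc α, ← Nat.cast_add, hp]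
  rw [finsum_congr hs, finsum_eq_sum_range (N := 1) fun s hs => by
    rw [if_neg (by omega), zero_mul, zero_mul, zero_smul]]
  simp [dpow_zero, pow_two]

end Expand

/-! ### The transpose of an intertwining operator. -/

section Transpose

variable {V : Type u} [AddCommGroup V] [Module ℂ V] [VertexOperatorAlgebra V]
  {A : Type*} [AddCommGroup A] [Module ℂ A] {B : Type*} [AddCommGroup B] [Module ℂ B]

theorem transpose_eq_expand (C : VModule.{u, v} V) (I : OperatorSeries A B C) (hI : IsTruncated I)
    (u₂ : B) (α : ℂ) (u₁ : A) :
    transpose C I hI u₂ α u₁ = expand (L C.Y (-1)) (fun β => tphase β • I u₁ β u₂) α := by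
  rw [transpose_apply]
  refine finsum_congr fun k => ?_
  rw [map_smul, dpow, LinearMap.smul_apply, smul_smul, mul_comm, tphase]

theorem IsTruncated.isBounded {C : Type*} [AddCommGroup C] [Module ℂ C]
    {I : OperatorSeries A B C} (hI : IsTruncated I) (u : A) (x : B) :
    IsBounded fun α => I u α x := fun α => truncated_nat hI u x α

theorem transpose_truncated (C : VModule.{u, v} V) (I : OperatorSeries A B C)
    (hI : IsTruncated I) : IsTruncated (transpose C I hI) := by
  intro u₂ u₁ α
  obtain ⟨N, hN⟩ := hI u₁ u₂ α
  refine ⟨N, fun n hn => ?_⟩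
  rw [transpose_apply]
  refine finsum_eq_zero_of_forall_eq_zero fun k => ?_
  have := hN (n + k) (by omega)
  push_cast at this
  rw [← add_assoc] at this
  rw [this, map_zero, smul_zero]

theorem transpose_transpose (C : VModule.{u, v} V) (I : OperatorSeries A B C)
    (hI : IsTruncated I) (u : A) (α : ℂ) (x : B) :
    transpose C (transpose C I hI) (transpose_truncated C I hI) u α x
      = tphase α ^ 2 • I u α x := by
  rw [transpose_eq_expand]
  simp only [transpose_eq_expand]
  exact expand_expand _ (hI.isBounded u x) α

/-- Multiplication of the modes by a function of their index. -/
def scaleModes {C : Type*} [AddCommGroup C] [Module ℂ C] (c : ℂ → ℂ) (I : OperatorSeries A B C) :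
    OperatorSeries A B C where
  toFun u α := c α • I u α
  map_add' u u' := by funext α; simp
  map_smul' r u := by funext α; simp [smul_comm (c α) r]

theorem scaleModes_apply {C : Type*} [AddCommGroup C] [Module ℂ C] (c : ℂ → ℂ)
    (I : OperatorSeries A B C) (u : A) (α : ℂ) (x : B) :
    scaleModes c I u α x = c α • I u α x := rfl

theorem Inter.scaleModes {C : Type*} [AddCommGroup C] [Module ℂ C] {YA : ModeMap V A}
    {YB : ModeMap V B} {YC : ModeMap V C} {I : OperatorSeries A B C} (hI : Inter YA YB YC I)
    {c : ℂ → ℂ} (hc : ∀ (α : ℂ) (n : ℤ), c (α + n) = c α) :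
    Inter YA YB YC (scaleModes c I) where
  truncated u x α := by
    obtain ⟨N, hN⟩ := hI.truncated u x α
    exact ⟨N, fun n hn => by rw [scaleModes_apply, hN n hn, smul_zero]⟩
  derivative u α := by
    ext x
    have := hc α (-1)
    rw [Int.cast_neg, Int.cast_one, ← sub_eq_add_neg] at this
    rw [scaleModes_apply, hI.derivative, LinearMap.smul_apply, LinearMap.smul_apply,
      scaleModes_apply, this, smul_comm]
  isJacobi a u x := by
    simpa only [scaleModes_apply, map_smul] using (hI.isJacobi a u x).periodic hc

theorem mode_expand {M : Type*} [AddCommGroup M] [Module ℂ M] {Y : ModeMap V M}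
    (hY : IsWeakModule Y) (a : V) (p : ℤ) {g : ℂ → M} (hg : IsBounded g) (α : ℂ) :
    Y a p (expand (L Y (-1)) g α) = expand (L Y (-1)) (fun β => ∑ᶠ j : ℕ,
      ((Ring.choose p j : ℤ) : ℂ) • Y a (p - j) (g (β + j))) α := by
  obtain ⟨N, hN⟩ := hg α
  have h0 : ∀ k j : ℕ, N ≤ k + j → g (α + k + j) = 0 := fun k j hkj => by
    have := hN _ hkj
    push_cast at this
    rwa [← add_assoc] at this
  have e : ∀ k : ℕ, dpow (L Y (-1)) k (∑ᶠ j : ℕ,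
      ((Ring.choose p j : ℤ) : ℂ) • Y a (p - j) (g (α + k + j)))
      = ∑ᶠ j : ℕ, ((Ring.choose p j : ℤ) : ℂ) •
        dpow (L Y (-1)) k (Y a (p - j) (g (α + k + j))) := fun k => by
    rw [map_finsum_nat _ ⟨N, fun j hj => by rw [h0 k j (by omega), map_zero, smul_zero]⟩]
    simp only [map_smul]
  rw [expand, expand, map_finsum_nat _ ⟨N, fun k hk => by rw [hN k hk, map_zero]⟩,
    finsum_congr e, finsum_finsum_antidiagonal (N := N) fun k j hkj => by
      rw [h0 k j hkj, map_zero, map_zero, smul_zero]]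
  refine finsum_congr fun s => ?_
  rw [mode_dpow_L_neg_one hY]
  refine Finset.sum_congr rfl fun r hr => ?_
  have hr := Finset.HasAntidiagonal.mem_antidiagonal.mp hr
  rw [add_assoc α, ← Nat.cast_add, hr]

/-- Conjugation by `e^{x₂L(-1)}` replaces `x₁` by `x₁ - x₂` in the vertex operator. Together with
the substitution `x₂ ↦ -x₂` this exchanges the roles of `x₀` and `x₁`, hence of `l` and `m`; the
coefficients combine by `sum_antidiagonal_choose_mul_choose`. -/
theorem expand_jacobiLeft {M : Type*} [AddCommGroup M] [Module ℂ M] {Y : ModeMap V M}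
    (hY : IsWeakModule Y) (a : V) {g : ℂ → M} (hg : IsBounded g) (l m : ℤ) (α : ℂ) :
    jacobiLeft (fun p β => Y a p (expand (L Y (-1)) (fun β => tphase β • g β) β)) l m α
      = expand (L Y (-1)) (fun β => tphase β • jacobiLeft (fun p β => Y a p (g β)) m l β) α := by
  obtain ⟨N, hN⟩ := hg α
  have h0 : ∀ i k j : ℕ, N ≤ i + (k + j) → g (α + k + i + j) = 0 := fun i k j hkj => by
    have := hN _ hkj
    push_cast at this
    rwa [show α + k + i + j = α + (i + (k + j)) by ring]
  have hin : ∀ k : ℕ, ∑ᶠ i : ℕ, ((-1 : ℂ) ^ i * (Ring.choose l i : ℤ)) • ∑ᶠ j : ℕ,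
      ((Ring.choose (m + l - i) j : ℤ) : ℂ) •
        Y a (m + l - i - j) (tphase (α + k + i + j) • g (α + k + i + j))
      = tphase (α + k) • jacobiLeft (fun p β => Y a p (g β)) m l (α + k) := fun k => by
    have e1 : ∀ i : ℕ, ((-1 : ℂ) ^ i * (Ring.choose l i : ℤ)) • ∑ᶠ j : ℕ,
        ((Ring.choose (m + l - i) j : ℤ) : ℂ) •
          Y a (m + l - i - j) (tphase (α + k + i + j) • g (α + k + i + j))
        = ∑ᶠ j : ℕ, (((-1) ^ i * Ring.choose l i * Ring.choose (m + l - i) j : ℤ) *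
            tphase (α + k + i + j)) • Y a (m + l - i - j) (g (α + k + i + j)) := fun i => by
      rw [smul_finsum' _ (finite_support_of_eventually _ N fun j hj => by
        rw [h0 i k j (by omega), smul_zero, map_zero, smul_zero])]
      refine finsum_congr fun j => ?_
      rw [map_smul, smul_smul, smul_smul]
      push_cast
      rfl
    rw [finsum_congr e1, finsum_finsum_antidiagonal (N := N) fun i j hij => by
      rw [h0 i k j (by omega), map_zero, smul_zero], jacobiLeft,
      smul_finsum' _ (finite_support_of_eventually _ N fun s hs => by
        have := h0 0 k s (by omega)
        rw [Nat.cast_zero, add_zero] at this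
        rw [this, map_zero, smul_zero])]
    refine finsum_congr fun s => ?_
    rw [smul_smul, ← sum_antidiagonal_choose_mul_choose l m s]
    push_cast
    rw [Finset.mul_sum, Finset.mul_sum, Finset.sum_smul]
    refine Finset.sum_congr rfl fun r hr => ?_
    have hr := Finset.HasAntidiagonal.mem_antidiagonal.mp hr
    have h3 : m + l - (r.1 : ℤ) - r.2 = l + m - s := by rw [← hr]; push_cast; ring
    rw [add_assoc (α + (k : ℂ)), ← Nat.cast_add, hr, h3, tphase_add_nat]
    congr 1
    ring
  have e : ∀ i : ℕ, ((-1 : ℂ) ^ i * (Ring.choose l i : ℤ)) •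
      Y a (m + l - i) (expand (L Y (-1)) (fun β => tphase β • g β) (α + i))
      = ∑ᶠ k : ℕ, ((-1 : ℂ) ^ i * (Ring.choose l i : ℤ)) • dpow (L Y (-1)) k (∑ᶠ j : ℕ,
          ((Ring.choose (m + l - i) j : ℤ) : ℂ) •
            Y a (m + l - i - j) (tphase (α + k + i + j) • g (α + k + i + j))) := fun i => by
    rw [mode_expand hY a _ (hg.mul tphase), expand, smul_finsum' _
      (finite_support_of_eventually _ N fun k hk => by
        rw [finsum_eq_zero_of_forall_eq_zero, map_zero]
        intro j
        rw [add_right_comm α, h0 i k j (by omega), smul_zero, map_zero, smul_zero])]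
    refine finsum_congr fun k => ?_
    rw [add_right_comm α]
  rw [jacobiLeft, finsum_congr e, finsum_finsum_swap (N := N) fun i k hik => by
    rw [finsum_eq_zero_of_forall_eq_zero, map_zero, smul_zero]
    intro j
    rw [h0 i k j (by omega), smul_zero, map_zero, smul_zero]]
  refine finsum_congr fun k => ?_
  simp only
  rw [← hin, map_finsum_nat _ ⟨N, fun i hi => by
    rw [finsum_eq_zero_of_forall_eq_zero, smul_zero]
    intro j
    rw [h0 i k j (by omega), smul_zero, map_zero, smul_zero]⟩]
  simp only [map_smul]

/-- The transpose of an intertwining operator is an intertwining operator. -/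
theorem Inter.transpose {C : VModule.{u, v} V} {YA : ModeMap V A} {YB : ModeMap V B}
    {I : OperatorSeries A B C} (hI : Inter YA YB C.Y I) (hA : IsWeakModule YA)
    (hB : IsWeakModule YB) : Inter YB YA C.Y (transpose C I hI.truncated) where
  truncated := transpose_truncated C I hI.truncated
  derivative u₂ α := by
    ext u₁
    obtain ⟨N, hN⟩ := truncated_nat hI.truncated u₁ u₂ (α - 1)
    rw [transpose_eq_expand, LinearMap.smul_apply, transpose_eq_expand, expand, expand,
      smul_finsum' _ (finite_support_of_eventually _ N fun k hk => by
        rw [hN k hk, smul_zero, map_zero])]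
    set g : ℕ → C := fun k => tphase (α - 1 + k) •
      dpow (L C.Y (-1)) k (I u₁ (α - 1 + k) u₂) with hg
    have hg0 : ∀ k, N ≤ k → g k = 0 := fun k hk => by
      rw [hg]; simp only [hN k hk, map_zero, smul_zero]
    -- Moving `L(-1)` out of the argument gives `(k+1) g(k+1) - (α+k) g(k)`. After an index shift
    -- the coefficient of `g(k)` is `k - (α+k) = -α`.
    have e : ∀ k : ℕ, dpow (L C.Y (-1)) k (tphase (α + k) • I u₁ (α + k) (L YB (-1) u₂))
        = (((k + 1 : ℕ) : ℂ) • g (k + 1)) + (-(α + k)) • g k := fun k => by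
      have h1 := hI.L_neg_one u₁ u₂ (α + k)
      have h2 : I u₁ (α + k) (L YB (-1) u₂)
          = L C.Y (-1) (I u₁ (α + k) u₂) + (α + k) • I u₁ (α + k - 1) u₂ := by
        rw [sub_eq_iff_eq_add] at h1
        rw [h1]
        module
      have h3 := tphase_add_nat (α - 1 + k) 1
      rw [show α - 1 + k + ((1 : ℕ) : ℂ) = α + k by push_cast; ring] at h3
      rw [h2, smul_add, map_add, map_smul, dpow_apply, map_smul, map_smul, hg]
      simp only
      rw [show α - 1 + ((k + 1 : ℕ) : ℂ) = α + k by push_cast; ring,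
        show α + k - 1 = α - 1 + k by ring, h3]
      push_cast
      module
    rw [finsum_congr e, finsum_add_distrib
      (finite_support_of_eventually _ N fun k hk => by rw [hg0 _ (by omega), smul_zero])
      (finite_support_of_eventually _ N fun k hk => by rw [hg0 _ (by omega), smul_zero])]
    have h4 := finsum_succ_shift (f := fun k : ℕ => (k : ℂ) • g k)
      ⟨N, fun k hk => by rw [hg0 k hk, smul_zero]⟩
    rw [Nat.cast_zero, zero_smul, zero_add] at h4
    rw [← h4, ← finsum_add_distrib
      (finite_support_of_eventually _ N fun k hk => by rw [hg0 _ (by omega), smul_zero])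
      (finite_support_of_eventually _ N fun k hk => by rw [hg0 _ (by omega), smul_zero])]
    refine finsum_congr fun k => ?_
    rw [map_smul, hg]
    module
  isJacobi a u₂ u₁ := by
    have hS := hI.isJacobi a u₁ u₂
    refine ⟨jacobiSummable_of_truncated hB.truncation hA.truncation
      (transpose_truncated C I hI.truncated) a u₂ u₁, fun l m α => ?_⟩
    simp only [transpose_eq_expand]
    rw [expand_jacobiLeft C.isModule.toIsWeakModule a (hI.truncated.isBounded u₁ u₂)]
    obtain ⟨NA, hNA⟩ := hA.truncation a u₁
    obtain ⟨NB, hNB⟩ := hB.truncation a u₂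
    set HA : ℤ → ℂ → C := fun p β => tphase β • I (YA a p u₁) β u₂ with hHA
    set HB : ℤ → ℂ → C := fun p β => tphase β • I u₁ β (YB a p u₂) with hHB
    have hA0 : ∀ p, NA ≤ p → ∀ β, HA p β = 0 := fun p hp β => by
      rw [hHA]; simp only [hNA p hp, map_zero, Pi.zero_apply, LinearMap.zero_apply, smul_zero]
    have hB0 : ∀ p, NB ≤ p → ∀ β, HB p β = 0 := fun p hp β => by
      rw [hHB]; simp only [hNB p hp, map_zero, smul_zero]
    have hAb : ∀ p, IsBounded (HA p) := fun p => (hI.truncated.isBounded _ _).mul _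
    have hBb : ∀ p, IsBounded (HB p) := fun p => (hI.truncated.isBounded _ _).mul _
    have hmid : jacobiMiddle (fun p β => expand (L C.Y (-1)) (HA p) β) l m α
        = expand (L C.Y (-1)) (fun β => ∑ᶠ i : ℕ,
          ((-1 : ℂ) ^ (l + i) * (Ring.choose l i : ℤ)) • HA (m + i) (β + l - i)) α :=
      sum_expand hA0 hAb _ m l α
    have hright : jacobiRight (fun p β => expand (L C.Y (-1)) (HB p) β) l m α
        = expand (L C.Y (-1)) (fun β => ∑ᶠ i : ℕ,
          ((Ring.choose m i : ℤ) : ℂ) • HB (l + i) (β + m - i)) α :=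
      sum_expand hB0 hBb _ l m α
    rw [hmid, hright, sub_eq_iff_eq_add, ← expand_add (isBounded_sum hB0 hBb _ l m)
      (isBounded_sum hA0 hAb _ m l)]
    congr 1
    funext β
    -- The Jacobi identity of `I` is used with `l` and `m` exchanged. Its middle sum, with `a`
    -- acting on `u₂`, is the right sum of the transpose, and its right sum is the middle one.
    have hj := hS.jacobi m l β
    rw [sub_eq_iff_eq_add'] at hj
    have hsign : ∀ (l : ℤ) (i : ℕ), tphase (β + l - i) = (-1) ^ (l + (i : ℤ)) * tphase β :=
      fun l i => by
        have := tphase_add_int β (l - i)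
        push_cast at this
        rw [add_sub_assoc, this, zpow_sub₀ (by norm_num), zpow_add₀ (by norm_num), div_eq_mul_inv,
          ← inv_zpow, inv_neg, inv_one]
    have hsq : ∀ (l : ℤ) (i : ℕ), (-1 : ℂ) ^ (l + (i : ℤ)) * (-1) ^ (l + (i : ℤ)) = 1 :=
      fun l i => by rw [← mul_zpow]; simp
    rw [hj, smul_add, jacobiMiddle, jacobiRight, smul_finsum' _ (hS.middle_support m l β _),
      smul_finsum' _ (hS.right_support m l β _)]
    congr 1
    · refine finsum_congr fun i => ?_
      rw [hHB]
      simp only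
      rw [hsign, smul_smul, smul_smul]
      congr 1
      ring
    · refine finsum_congr fun i => ?_
      rw [hHA]
      simp only
      rw [hsign, smul_smul, smul_smul]
      congr 1
      linear_combination (-(tphase β * (Ring.choose l i : ℤ))) * hsq l i

theorem transpose_scaleModes (C : VModule.{u, v} V) (I : OperatorSeries A B C)
    (hI : IsTruncated I) {c : ℂ → ℂ} (hc : ∀ (α : ℂ) (n : ℤ), c (α + n) = c α)
    (hI' : IsTruncated (scaleModes c I)) (u : B) (α : ℂ) (x : A) :
    transpose C (scaleModes c I) hI' u α x = c α • transpose C I hI u α x := by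
  rw [transpose_eq_expand, transpose_eq_expand, ← expand_periodic _ hc
    ((hI.isBounded x u).mul _)]
  congr 1
  funext β
  rw [scaleModes_apply, smul_comm]

end Transpose

/-! ### Quotients, direct sums and submodules of modules. -/

section ModuleConstructions

variable {V : Type u} [AddCommGroup V] [Module ℂ V] [VertexOperatorAlgebra V]
  {M N : Type*} [AddCommGroup M] [Module ℂ M] [AddCommGroup N] [Module ℂ N]
  {YM : ModeMap V M} {YN : ModeMap V N}

theorem jacobi_modes_of_isJacobi {a b : V} {x : M}
    (h : IsJacobi (fun p α => YM a p (modeSeries YM b α x))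
      (fun p α => modeSeries YM b α (YM a p x))
      (fun p α => modeSeries YM (VertexOperatorAlgebra.Y a p b) α x)) (l m n : ℤ) :
    (∑ᶠ i : ℕ, ((-1 : ℂ) ^ i * (Ring.choose l i : ℤ)) • YM a (m + l - i) (YM b (n + i) x))
      - (∑ᶠ i : ℕ, ((-1 : ℂ) ^ (l + i) * (Ring.choose l i : ℤ)) •
          YM b (n + l - i) (YM a (m + i) x))
    = ∑ᶠ i : ℕ, ((Ring.choose m i : ℤ) : ℂ) •
        YM (VertexOperatorAlgebra.Y a (l + i) b) (m + n - i) x := by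
  have := jacobi_of_isJacobi h l m n
  simpa only [modeSeries_intCast] using this

theorem IsHom.modeSeries {φ : M →ₗ[ℂ] N} (hφ : IsHom YM YN φ) (a : V) (α : ℂ) (x : M) :
    φ (modeSeries YM a α x) = modeSeries YN a α (φ x) := by
  by_cases hα : ∃ n : ℤ, (n : ℂ) = α
  · obtain ⟨n, rfl⟩ := hα
    rw [modeSeries_intCast, modeSeries_intCast, hφ]
  · have h : ∀ n : ℤ, (n : ℂ) ≠ α := fun n hn => hα ⟨n, hn⟩
    rw [modeSeries_eq_zero _ _ h, modeSeries_eq_zero _ _ h, LinearMap.zero_apply,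
      LinearMap.zero_apply, map_zero]

theorem IsHom.isJacobi {φ : M →ₗ[ℂ] N} (hφ : IsHom YM YN φ) {a b : V} {x : M}
    (h : IsJacobi (fun p α => YM a p (VOA.modeSeries YM b α x))
      (fun p α => VOA.modeSeries YM b α (YM a p x))
      (fun p α => VOA.modeSeries YM (VertexOperatorAlgebra.Y a p b) α x)) :
    IsJacobi (fun p α => YN a p (VOA.modeSeries YN b α (φ x)))
      (fun p α => VOA.modeSeries YN b α (YN a p (φ x)))
      (fun p α => VOA.modeSeries YN (VertexOperatorAlgebra.Y a p b) α (φ x)) := by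
  simpa only [hφ.modeSeries, hφ a] using h.map φ

/-- The image of a module is a module. -/
theorem IsModule.of_surjective (hM : IsModule YM) {φ : M →ₗ[ℂ] N} (hφ : IsHom YM YN φ)
    (hs : Function.Surjective φ) : IsModule YN := by
  have hle : ∀ h, (wtSpace YM h).map φ ≤ wtSpace YN h := fun h => by
    rintro _ ⟨x, hx, rfl⟩
    exact hφ.map_wtSpace hx
  have htop : ⨆ h, (wtSpace YM h).map φ = ⊤ := by
    rw [← Submodule.map_iSup, hM.iSup_wtSpace, Submodule.map_top, LinearMap.range_eq_top.mpr hs]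
  -- The weight spaces of the image are exactly the images of weight spaces, so
  -- finite-dimensionality and the lower bound descend.
  have heq : ∀ h, wtSpace YN h = (wtSpace YM h).map φ := eigenspace_eq_of_le hle htop
  refine ⟨⟨fun n => ?_, fun a n => ?_, fun a y => ?_, fun a b y l m n => ?_⟩, ?_, fun h => ?_,
    fun h => ?_⟩
  · ext y
    obtain ⟨x, rfl⟩ := hs y
    rw [← hφ, hM.one_mode]
    split_ifs <;> simp
  · ext y
    obtain ⟨x, rfl⟩ := hs y
    rw [LinearMap.smul_apply, ← hφ, ← hφ, hM.derivative, LinearMap.smul_apply, map_smul]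
  · obtain ⟨x, rfl⟩ := hs y
    obtain ⟨K, hK⟩ := hM.truncation a x
    exact ⟨K, fun n hn => by rw [← hφ, hK n hn, map_zero]⟩
  · obtain ⟨x, rfl⟩ := hs y
    exact jacobi_modes_of_isJacobi
      (hφ.isJacobi ((modeSeries_inter hM.toIsWeakModule).isJacobi a b x)) l m n
  · rw [← htop]
    exact iSup_congr heq
  · rw [heq]
    have := hM.finiteDimensional h
    infer_instance
  · obtain ⟨K, hK⟩ := hM.lower_bound h
    exact ⟨K, fun n hn => by rw [heq, hK n hn, Submodule.map_bot]⟩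

/-- The direct sum of two vertex operator maps. -/
def prodAction (YM : ModeMap V M) (YN : ModeMap V N) : ModeMap V (M × N) where
  toFun a n := (YM a n).prodMap (YN a n)
  map_add' a b := by funext n; ext <;> simp
  map_smul' c a := by funext n; ext <;> simp

theorem prodAction_apply (a : V) (n : ℤ) (x : M × N) :
    prodAction YM YN a n x = (YM a n x.1, YN a n x.2) := rfl

theorem IsModule.prod (hM : IsModule YM) (hN : IsModule YN) : IsModule (prodAction YM YN) := by
  have hfst : IsHom (prodAction YM YN) YM (LinearMap.fst ℂ M N) := fun _ _ _ => rfl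
  have hsnd : IsHom (prodAction YM YN) YN (LinearMap.snd ℂ M N) := fun _ _ _ => rfl
  have hinl : IsHom YM (prodAction YM YN) (LinearMap.inl ℂ M N) := fun _ _ _ => by
    simp [prodAction_apply]
  have hinr : IsHom YN (prodAction YM YN) (LinearMap.inr ℂ M N) := fun _ _ _ => by
    simp [prodAction_apply]
  refine ⟨⟨fun n => ?_, fun a n => ?_, fun a x => ?_, fun a b x l m n => ?_⟩, ?_, fun h => ?_,
    fun h => ?_⟩
  · refine LinearMap.ext fun x => ?_
    rw [prodAction_apply, hM.one_mode, hN.one_mode]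
    split_ifs <;> simp
  · refine LinearMap.ext fun x => ?_
    rw [prodAction_apply, hM.derivative, hN.derivative]
    rfl
  · obtain ⟨K, hK⟩ := hM.truncation a x.1
    obtain ⟨K', hK'⟩ := hN.truncation a x.2
    exact ⟨max K K', fun n hn => by
      rw [prodAction_apply, hK n (le_trans (le_max_left _ _) hn),
        hK' n (le_trans (le_max_right _ _) hn)]
      rfl⟩
  · refine jacobi_modes_of_isJacobi ?_ l m n
    have h1 := hinl.isJacobi ((modeSeries_inter hM.toIsWeakModule).isJacobi a b x.1)
    have h2 := hinr.isJacobi ((modeSeries_inter hN.toIsWeakModule).isJacobi a b x.2)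
    have hx : LinearMap.inl ℂ M N x.1 + LinearMap.inr ℂ M N x.2 = x := by simp
    rw [← hx]
    simpa only [Pi.add_def, map_add] using h1.add h2
  · rw [eq_top_iff]
    rintro x -
    have hx : LinearMap.inl ℂ M N x.1 + LinearMap.inr ℂ M N x.2 = x := by simp
    rw [← hx]
    refine Submodule.add_mem _ ?_ ?_
    · have : x.1 ∈ ⨆ h, wtSpace YM h := by rw [hM.iSup_wtSpace]; trivial
      have h2 := Submodule.mem_map_of_mem (f := LinearMap.inl ℂ M N) this
      rw [Submodule.map_iSup] at h2
      have hle : ⨆ h, (wtSpace YM h).map (LinearMap.inl ℂ M N) ≤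
          ⨆ h, wtSpace (prodAction YM YN) h := iSup_mono fun h => by
        rintro _ ⟨y, hy, rfl⟩
        exact hinl.map_wtSpace hy
      exact hle h2
    · have : x.2 ∈ ⨆ h, wtSpace YN h := by rw [hN.iSup_wtSpace]; trivial
      have h2 := Submodule.mem_map_of_mem (f := LinearMap.inr ℂ M N) this
      rw [Submodule.map_iSup] at h2
      have hle : ⨆ h, (wtSpace YN h).map (LinearMap.inr ℂ M N) ≤
          ⨆ h, wtSpace (prodAction YM YN) h := iSup_mono fun h => by
        rintro _ ⟨y, hy, rfl⟩
        exact hinr.map_wtSpace hy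
      exact hle h2
  · have := hM.finiteDimensional h
    have := hN.finiteDimensional h
    have hle : wtSpace (prodAction YM YN) h ≤ (wtSpace YM h).prod (wtSpace YN h) := fun x hx =>
      ⟨hfst.map_wtSpace hx, hsnd.map_wtSpace hx⟩
    have hfin : FiniteDimensional ℂ ((wtSpace YM h).prod (wtSpace YN h)) :=
      Module.Finite.iff_fg.mpr (Submodule.FG.prod (Module.Finite.iff_fg.mp ‹_›)
        (Module.Finite.iff_fg.mp ‹_›))
    exact Submodule.finiteDimensional_of_le hle
  · obtain ⟨K, hK⟩ := hM.lower_bound h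
    obtain ⟨K', hK'⟩ := hN.lower_bound h
    refine ⟨min K K', fun n hn => ?_⟩
    rw [eq_bot_iff]
    intro x hx
    have h1 := hfst.map_wtSpace hx
    have h2 := hsnd.map_wtSpace hx
    rw [hK n (lt_of_lt_of_le hn (min_le_left _ _)), Submodule.mem_bot] at h1
    rw [hK' n (lt_of_lt_of_le hn (min_le_right _ _)), Submodule.mem_bot] at h2
    rw [Submodule.mem_bot]
    exact Prod.ext h1 h2

/-- Applying `T - h₀` removes one eigenvector and scales the others by nonzero numbers, so induction
applies. -/
theorem eigenvector_mem_of_sum_mem {T : Module.End ℂ M} {P : Submodule ℂ M}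
    (hP : ∀ x ∈ P, T x ∈ P) (s : Finset ℂ) (x : ℂ → M)
    (hx : ∀ h, x h ∈ Module.End.eigenspace T h) (hs : ∑ h ∈ s, x h ∈ P) :
    ∀ h ∈ s, x h ∈ P := by
  classical
  induction s using Finset.induction_on generalizing x with
  | empty => simp
  | insert h₀ s hh ih =>
    have hT := Submodule.sub_mem _ (hP _ hs) (Submodule.smul_mem _ h₀ hs)
    have hmem : ∀ h ∈ s, (h - h₀) • x h ∈ P := by
      refine ih (fun h => (h - h₀) • x h) (fun h => Submodule.smul_mem _ _ (hx h)) ?_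
      convert hT using 1
      have e : ∀ h, T (x h) = h • x h := fun h => Module.End.mem_eigenspace_iff.mp (hx h)
      rw [map_sum, Finset.smul_sum, ← Finset.sum_sub_distrib, Finset.sum_insert hh]
      simp only [e, ← sub_smul, sub_self, zero_add]
    have hmem' : ∀ h ∈ s, x h ∈ P := fun h hhs => by
      have hne : h - h₀ ≠ 0 := sub_ne_zero.mpr fun e => hh (e ▸ hhs)
      exact (Submodule.smul_mem_iff _ hne).mp (hmem h hhs)
    intro h hhs
    rcases Finset.mem_insert.mp hhs with rfl | hhs
    · rw [Finset.sum_insert hh] at hs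
      exact (Submodule.add_mem_iff_left _ (Submodule.sum_mem _ hmem')).mp hs
    · exact hmem' h hhs

theorem restrictAction_apply (P : Submodule ℂ M) (hP : IsInvariant YM P) (a : V) (n : ℤ) (x : P) :
    (restrictAction YM P hP a n x : M) = YM a n x := rfl

theorem subtype_isHom (P : Submodule ℂ M) (hP : IsInvariant YM P) :
    IsHom (restrictAction YM P hP) YM P.subtype := fun _ _ _ => rfl

/-- An invariant subspace of a module is a module. -/
theorem IsModule.restrict (hM : IsModule YM) (P : Submodule ℂ M) (hP : IsInvariant YM P) :
    IsModule (restrictAction YM P hP) := by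
  have hi := subtype_isHom P hP
  have htr : ∀ a x, ∃ K : ℤ, ∀ n, K ≤ n → restrictAction YM P hP a n x = 0 := fun a x => by
    obtain ⟨K, hK⟩ := hM.truncation a (x : M)
    exact ⟨K, fun n hn => Subtype.ext (hK n hn)⟩
  have hwt : ∀ h (x : P), x ∈ wtSpace (restrictAction YM P hP) h ↔ (x : M) ∈ wtSpace YM h :=
    fun h x => by
      rw [wtSpace, wtSpace, Module.End.mem_eigenspace_iff, Module.End.mem_eigenspace_iff,
        ← Subtype.coe_inj]
      rfl
  have htrunc : IsTruncated (modeSeries (restrictAction YM P hP)) := fun a x α => by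
    obtain ⟨K, hK⟩ := (modeSeries_inter hM.toIsWeakModule).truncated a (x : M) α
    exact ⟨K, fun n hn => Subtype.ext ((hi.modeSeries a _ x).trans (hK n hn))⟩
  refine ⟨⟨fun n => ?_, fun a n => ?_, htr, fun a b x l m n => ?_⟩, ?_, fun h => ?_,
    fun h => ?_⟩
  · ext x
    rw [restrictAction_apply, hM.one_mode]
    split_ifs <;> simp
  · ext x
    rw [restrictAction_apply, hM.derivative]
    rfl
  · refine jacobi_modes_of_isJacobi ?_ l m n
    refine (jacobiSummable_of_truncated adjoint_isWeakModule.truncation htr htrunc a b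
      x).isJacobi_of_separating (fun _ : Unit => P.subtype) (fun x y h => Subtype.ext (h ())) ?_
    intro _
    have := (modeSeries_inter hM.toIsWeakModule).isJacobi a b (x : M)
    simp only [hi.modeSeries, hi a]
    exact this
  · rw [eq_top_iff]
    rintro x -
    obtain ⟨s, hs⟩ := exists_sum_wtComponent hM (x : M)
    have hmem := eigenvector_mem_of_sum_mem (T := L YM 0) (P := P)
      (fun y hy => hP _ _ y hy) s (fun h => (wtComponent hM h (x : M) : M))
      (fun h => (wtComponent hM h (x : M)).2) (by rw [hs s subset_rfl]; exact x.2)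
    have hx : x = ∑ h : s, ⟨(wtComponent hM h (x : M) : M), hmem h h.2⟩ := by
      ext
      rw [AddSubmonoidClass.coe_finsetSum]
      rw [Finset.sum_coe_sort s fun h => (wtComponent hM h (x : M) : M), hs s subset_rfl]
    rw [hx]
    refine Submodule.sum_mem _ fun h _ => Submodule.mem_iSup_of_mem (h : ℂ) ?_
    rw [hwt]
    exact (wtComponent hM h (x : M)).2
  · have := hM.finiteDimensional h
    refine FiniteDimensional.of_injective (K := ℂ) (V₂ := wtSpace YM h)
      (LinearMap.codRestrict _ (P.subtype ∘ₗ (wtSpace (restrictAction YM P hP) h).subtype)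
        fun x => (hwt h x).mp x.2) ?_
    intro x y hxy
    have h1 : ((x : P) : M) = y := congrArg (fun z : wtSpace YM h => (z : M)) hxy
    exact Subtype.ext (Subtype.ext h1)
  · obtain ⟨K, hK⟩ := hM.lower_bound h
    refine ⟨K, fun n hn => ?_⟩
    rw [eq_bot_iff]
    intro x hx
    rw [hwt, hK n hn, Submodule.mem_bot] at hx
    rw [Submodule.mem_bot]
    exact Subtype.ext hx

end ModuleConstructions

/-! ### Fields, modules inside `G(W₁,W₂)`, and the finiteness of their sum. -/

section LargestModule

variable {V : Type u} [AddCommGroup V] [Module ℂ V] [VertexOperatorAlgebra V]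
  {W₁ W₂ : VModule.{u, v} V} {M : Type*} [AddCommGroup M] [Module ℂ M] {YM : ModeMap V M}

theorem circ_eq_jacobi (a : V) (l : ℤ) (Φ : fieldSpace W₁ W₂) (α : ℂ) (w : W₁) :
    (circ W₁ W₂ a l Φ).1 α w = jacobiLeft (fun p β => W₂.Y a p (Φ.1 β w)) l 0 α
      - jacobiMiddle (fun p β => Φ.1 β (W₁.Y a p w)) l 0 α := by
  simp only [circ_apply, jacobiLeft, jacobiMiddle, zero_add]

/-- For a nonnegative exponent both expansions are the same polynomial `(x₁-x₂)^k`; the middle sum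
is read backwards, `i ↦ k - i`. -/
theorem localityDefect_eq_jacobi (a : V) (Φ : ℂ → (W₁ →ₗ[ℂ] W₂)) (k : ℕ) (m : ℤ) (α : ℂ)
    (w : W₁) :
    localityDefect W₁ W₂ a Φ k m α w = jacobiLeft (fun p β => W₂.Y a p (Φ β w)) k m α
      - jacobiMiddle (fun p β => Φ β (W₁.Y a p w)) k m α := by
  have h0 : ∀ i : ℕ, k + 1 ≤ i → ((Ring.choose (k : ℤ) i : ℤ) : ℂ) = 0 := fun i hi => by
    rw [choose_natCast_int, Nat.choose_eq_zero_of_lt (by omega)]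
    simp
  rw [jacobiLeft, jacobiMiddle,
    finsum_eq_sum_range (N := k + 1) fun i hi => by rw [h0 i hi, mul_zero, zero_smul],
    finsum_eq_sum_range (N := k + 1) fun i hi => by rw [h0 i hi, mul_zero, zero_smul],
    ← Finset.sum_range_reflect (fun i : ℕ => ((-1 : ℂ) ^ ((k : ℤ) + i) * _) • _),
    ← Finset.sum_sub_distrib, localityDefect, LinearMap.sum_apply]
  refine Finset.sum_congr rfl fun i hi => ?_
  have hik : i ≤ k := by simpa [Nat.lt_succ_iff] using hi
  obtain ⟨j, rfl⟩ := Nat.exists_eq_add_of_le hik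
  have hj : i + j + 1 - 1 - i = j := by omega
  have hs : (-1 : ℂ) ^ (((i + j : ℕ) : ℤ) + (j : ℕ)) = (-1) ^ i := by
    rw [← Nat.cast_add, zpow_natCast, add_assoc, pow_add, ← two_mul, pow_mul]
    simp
  rw [hj, hs, choose_natCast_int, choose_natCast_int,
    show (i + j).choose j = (i + j).choose i from by
      rw [add_comm i j]; exact (Nat.choose_symm_add).symm ▸ rfl,
    ← smul_sub, LinearMap.smul_apply, LinearMap.sub_apply, LinearMap.comp_apply,
    LinearMap.comp_apply]
  push_cast
  rw [show m + (i + j) - (i : ℤ) = m + j by ring, show α + (i + j) - (j : ℂ) = α + i by ring]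

/-- The fields defined by a family of operators. -/
def toField (I : OperatorSeries M W₁ W₂) (hI : IsTruncated I) : M →ₗ[ℂ] fieldSpace W₁ W₂ :=
  LinearMap.codRestrict _ I fun u α w => hI u w α

theorem toField_apply (I : OperatorSeries M W₁ W₂) (hI : IsTruncated I) (u : M) :
    (toField I hI u).1 = I u := rfl

/-- The residue defining `circ` is the `m = 0` component of the left side of the Jacobi identity. -/
theorem Inter.toField_isHom {I : OperatorSeries M W₁ W₂} (hI : Inter YM W₁.Y W₂.Y I) :
    IsHom YM (circ W₁ W₂) (toField I hI.truncated) := fun a l u => by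
  ext α w
  have := (hI.isJacobi a u w).jacobi l 0 α
  rw [jacobiRight_zero] at this
  rw [circ_eq_jacobi, toField_apply, toField_apply]
  exact this.symm

theorem Inter.toField_mem {I : OperatorSeries M W₁ W₂} (hI : Inter YM W₁.Y W₂.Y I)
    (hM : ∀ a u, ∃ N : ℤ, ∀ n, N ≤ n → YM a n u = 0) (u : M) :
    toField I hI.truncated u ∈ G W₁ W₂ := by
  refine ⟨fun α => ?_, fun a => ?_⟩
  · ext w
    exact hI.L_neg_one u w α
  · obtain ⟨N, hN⟩ := hM a u
    -- From exponent `N` on, every `a_{l+i}u` in the right side of the Jacobi identity vanishes. The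
    -- `1` secures a positive exponent.
    refine ⟨max 1 N.toNat, by simp, fun m α => ?_⟩
    ext w
    rw [localityDefect_eq_jacobi]
    refine ((hI.isJacobi a u w).jacobi _ m α).trans ?_
    rw [jacobiRight]
    refine finsum_eq_zero_of_forall_eq_zero fun i => ?_
    rw [hN _ (by have := le_max_right 1 N.toNat; push_cast; omega)]
    simp

theorem isModuleInsideG_range (hM : IsModule YM) {φ : M →ₗ[ℂ] fieldSpace W₁ W₂}
    (hφ : IsHom YM (circ W₁ W₂) φ) (hle : LinearMap.range φ ≤ G W₁ W₂) :
    IsModuleInsideG W₁ W₂ (LinearMap.range φ) := by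
  have hinv : IsInvariant (circ W₁ W₂) (LinearMap.range φ) := by
    rintro a n _ ⟨u, rfl⟩
    exact ⟨YM a n u, hφ a n u⟩
  exact ⟨hle, hinv, hM.of_surjective (φ := φ.rangeRestrict)
    (fun a n x => Subtype.ext (hφ a n x)) φ.surjective_rangeRestrict⟩

theorem Inter.isModuleInsideG_range (hM : IsModule YM) {I : OperatorSeries M W₁ W₂}
    (hI : Inter YM W₁.Y W₂.Y I) :
    IsModuleInsideG W₁ W₂ (LinearMap.range (toField I hI.truncated)) :=
  VOA.isModuleInsideG_range hM hI.toField_isHom <| by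
    rintro _ ⟨u, rfl⟩
    exact hI.toField_mem hM.truncation u

theorem isModuleInsideG_bot : IsModuleInsideG W₁ W₂ ⊥ := by
  have := isModuleInsideG_range (W₁ := W₁) (W₂ := W₂) W₁.isModule (φ := 0)
    (fun a n x => by simp) (by rw [LinearMap.range_zero]; exact bot_le)
  rwa [LinearMap.range_zero] at this

/-- The sum is the image of the direct sum of the two modules. -/
theorem IsModuleInsideG.sup {N N' : Submodule ℂ (fieldSpace W₁ W₂)}
    (h : IsModuleInsideG W₁ W₂ N) (h' : IsModuleInsideG W₁ W₂ N') :
    IsModuleInsideG W₁ W₂ (N ⊔ N') := by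
  have hr : LinearMap.range (N.subtype.coprod N'.subtype) = N ⊔ N' := by
    rw [LinearMap.range_coprod, Submodule.range_subtype, Submodule.range_subtype]
  rw [← hr]
  refine isModuleInsideG_range (h.isModule.prod h'.isModule) (fun a n x => ?_) ?_
  · rw [prodAction_apply, LinearMap.coprod_apply, LinearMap.coprod_apply, map_add]
    rfl
  · rw [hr]
    exact sup_le h.le h'.le

/-- The operator `Φ ↦ Φ(x)` on a space of fields. -/
def fieldInclusion (N : Submodule ℂ (fieldSpace W₁ W₂)) : OperatorSeries N W₁ W₂ :=
  (fieldSpace W₁ W₂).subtype ∘ₗ N.subtype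

/-- The converse of `Inter.toField_isHom`. Locality makes both sides of the Jacobi identity vanish
for large `l`, the definition of `circ` is its `m = 0` part, and these components suffice. For `a =
ω`, `l = 0`, `circ` is the commutator with `L(-1)`. -/
theorem IsModuleInsideG.inter {N : Submodule ℂ (fieldSpace W₁ W₂)}
    (hN : IsModuleInsideG W₁ W₂ N) :
    Inter (restrictAction (circ W₁ W₂) N hN.invariant) W₁.Y W₂.Y (fieldInclusion N) where
  truncated Φ w α := Φ.1.2 α w
  derivative Φ α := by
    ext w
    have h1 := (hN.le Φ.2).derivative α
    have h2 := circ_eq_jacobi VertexOperatorAlgebra.omega 0 Φ.1 α w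
    rw [jacobiLeft_zero, jacobiMiddle_zero] at h2
    exact h2.trans (congrArg (fun f => f w) h1)
  isJacobi a Φ w := by
    have hS := jacobiSummable_of_truncated (YC := W₂.Y) hN.isModule.truncation
      W₁.isModule.truncation (I := fieldInclusion N) (fun Φ w α => Φ.1.2 α w) a Φ w
    obtain ⟨k, -, hk⟩ := (hN.le Φ.2).locality a
    have hd : ∀ l : ℤ, (k : ℤ) ≤ l → ∀ m α,
        jacobiLeft (fun p β => W₂.Y a p (Φ.1.1 β w)) l m α
          - jacobiMiddle (fun p β => Φ.1.1 β (W₁.Y a p w)) l m α = 0 := fun l hl m α => by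
      obtain ⟨j, rfl⟩ := Int.eq_ofNat_of_zero_le (by omega : 0 ≤ l)
      rw [← localityDefect_eq_jacobi,
        localityDefect_mono W₁ W₂ a Φ.1.1 (by omega : k ≤ j) hk m α, LinearMap.zero_apply]
    refine hS.isJacobi_of_components (K := k) (fun l hl m α => ?_) fun l α => ?_
    · refine (hd l hl m α).trans ?_
      rw [jacobiRight]
      refine (finsum_eq_zero_of_forall_eq_zero fun i => ?_).symm
      have : fieldInclusion N (restrictAction (circ W₁ W₂) N hN.invariant a (l + i) Φ)
          (α + m - i) w = 0 :=
        (circ_eq_jacobi a (l + i) Φ.1 _ w).trans (hd _ (by omega) 0 _)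
      rw [this, smul_zero]
    · rw [jacobiRight_zero]
      exact (circ_eq_jacobi a l Φ.1 α w).symm

/-- An invariant subspace of a module, as a module. -/
noncomputable def subModule (M : VModule.{u, v} V) (P : Submodule ℂ M) (hP : IsInvariant M.Y P) :
    VModule.{u, v} V where
  carrier := P
  Y := restrictAction M.Y P hP
  isModule := M.isModule.restrict P hP

theorem IsIrreducibleSubmodule.isIrreducible {M : VModule.{u, v} V} {P : Submodule ℂ M}
    (hP : IsIrreducibleSubmodule M P) : IsIrreducible (subModule M P hP.1) := by
  refine ⟨fun _ _ _ _ => trivial, fun h => hP.2.1 ?_, fun Q hQ _ => ?_⟩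
  · rw [eq_bot_iff]
    intro x hx
    have : (⟨x, hx⟩ : P) ∈ (⊥ : Submodule ℂ P) := by
      have h' : (⊤ : Submodule ℂ P) = ⊥ := h
      rw [← h']; trivial
    exact congrArg Subtype.val ((Submodule.mem_bot ℂ).mp this)
  · change Submodule ℂ P at Q
    have hmap : IsInvariant M.Y (Q.map P.subtype) := by
      rintro a n _ ⟨x, hx, rfl⟩
      exact ⟨_, hQ a n x hx, rfl⟩
    rcases hP.2.2 _ hmap (Submodule.map_subtype_le P Q) with h | h
    · left
      exact Submodule.map_injective_of_injective P.injective_subtype (h.trans (Submodule.map_bot _).symm)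
    · right
      refine (eq_top_iff.mpr fun x _ => ?_ : Q = ⊤)
      have : (x : M) ∈ Q.map P.subtype := by rw [h]; exact x.2
      obtain ⟨y, hy, e⟩ := this
      rwa [← Subtype.ext (a1 := y) (a2 := x) e]

/-- Under the finiteness hypotheses, the sum of all modules inside `G(W₁,W₂)` is a module. -/
theorem isModuleInsideG_Delta (finitely_many : FinitelyManyIrreducibles.{u, v} V)
    (completely_reducible : ∀ M : VModule.{u, v} V, IsCompletelyReducible M)
    (finite_fusion_rules : ∀ M₁ M₂ M₃ : VModule.{u, v} V,
      FiniteDimensional ℂ (intertwiningSpace M₁ M₂ M₃)) (W₁ W₂ : VModule.{u, v} V) :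
    IsModuleInsideG W₁ W₂ (Delta W₁ W₂) := by
  obtain ⟨n, S, -, hS⟩ := finitely_many
  have := fun i => finite_fusion_rules (S i) W₁ W₂
  choose d b hspan using fun i => Module.Finite.exists_fin (R := ℂ)
    (M := intertwiningSpace (S i) W₁ W₂)
  have hb : ∀ i j, Inter (S i).Y W₁.Y W₂.Y (b i j).1 := fun i j =>
    isIntertwining_iff_inter.mp (b i j).2
  -- The candidate for the largest module: the images of the `S i` under finitely many operators `b
  -- i j` that span the intertwining spaces.
  let R : Submodule ℂ (fieldSpace W₁ W₂) := Finset.univ.sup fun i => Finset.univ.sup fun j =>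
    LinearMap.range (toField (b i j).1 (hb i j).truncated)
  have hR : IsModuleInsideG W₁ W₂ R :=
    Finset.sup_induction isModuleInsideG_bot (fun _ h _ h' => h.sup h') fun i _ =>
      Finset.sup_induction isModuleInsideG_bot (fun _ h _ h' => h.sup h') fun j _ =>
        (hb i j).isModuleInsideG_range (S i).isModule
  have hmem : ∀ i (J : OperatorSeries (S i) W₁ W₂) (hJ : Inter (S i).Y W₁.Y W₂.Y J) s,
      toField J hJ.truncated s ∈ R := fun i J hJ s => by
    obtain ⟨c, hsum⟩ := (Submodule.mem_span_range_iff_exists_fun ℂ).mp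
      (hspan i ▸ Submodule.mem_top : (⟨J, isIntertwining_iff_inter.mpr hJ⟩ :
        intertwiningSpace (S i) W₁ W₂) ∈ Submodule.span ℂ (Set.range (b i)))
    have : toField J hJ.truncated s
        = ∑ j, c j • toField (b i j).1 (hb i j).truncated s := by
      have h1 := congrArg (fun K : intertwiningSpace (S i) W₁ W₂ => K.1 s) hsum
      refine Subtype.ext (h1.symm.trans ?_)
      simp only [AddSubmonoidClass.coe_finsetSum, LinearMap.sum_apply]
      rfl
    rw [this]
    refine Submodule.sum_mem _ fun j _ => Submodule.smul_mem _ _ ?_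
    have h1 : LinearMap.range (toField (b i j).1 (hb i j).truncated) ≤ R :=
      (Finset.le_sup (f := fun j => LinearMap.range (toField (b i j).1 (hb i j).truncated))
        (Finset.mem_univ j)).trans (Finset.le_sup (f := fun i => Finset.univ.sup fun j =>
          LinearMap.range (toField (b i j).1 (hb i j).truncated)) (Finset.mem_univ i))
    exact h1 ⟨s, rfl⟩
  have hle : ∀ N, IsModuleInsideG W₁ W₂ N → N ≤ R := fun N hN => by
    obtain ⟨T, hT, -, htop⟩ := completely_reducible hN.toVModule
    -- The inclusion of an irreducible `P` into fields, transported along `P ≃ S i`, is an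
    -- intertwining operator on `S i`, whose image lies in `R`.
    have hsub : sSup T ≤ R.comap N.subtype := sSup_le fun P hP => by
      obtain ⟨i, e, he⟩ := hS _ (hT P hP).isIrreducible
      have he' : IsHom (subModule hN.toVModule P (hT P hP).1).Y (S i).Y e.toLinearMap := he
      have hJ := (hN.inter.precomp (subtype_isHom P (hT P hP).1)).precomp he'.symm
      refine fun x hx => ?_
      have := hmem i _ hJ (e ⟨x, hx⟩)
      have heq : toField _ hJ.truncated (e ⟨x, hx⟩) = N.subtype x := ?_
      · rw [heq] at this
        exact this
      exact Subtype.ext (congrArg (fun y : P => fieldInclusion N (P.subtype y))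
        (e.symm_apply_apply ⟨x, hx⟩))
    intro x hx
    have : (⟨x, hx⟩ : N) ∈ sSup T := by rw [htop]; trivial
    exact hsub this
  have : Delta W₁ W₂ = R := le_antisymm (sSup_le hle) (le_sSup hR)
  rw [this]
  exact hR

end LargestModule

/-! ### Dualization and the universal property. -/

section TensorProduct

variable {V : Type u} [AddCommGroup V] [Module ℂ V] [VertexOperatorAlgebra V]

theorem opp_opp_of_mul_eq_one {A : VModule.{u, w} V} {B C : Type*} [AddCommGroup B] [Module ℂ B]
    [AddCommGroup C] [Module ℂ C] {κ κ' : ℂ → ℂ} (hκ : ∀ h, κ (h + 1) = -κ h)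
    (hκ' : ∀ h, κ' h * κ h = 1) (I : OperatorSeries A B C) (u : A) (β : ℂ) (x : B) :
    opp κ' A (opp κ A I) u β x = I u β x := by
  induction u using wtSpace_induction A.isModule with
  | mem h u hu => rw [opp_opp hκ I hu, hκ', one_smul]
  | zero => simp
  | add u u' hu hu' => simp [hu, hu']

theorem phase_ne_zero (h : ℂ) : phase h ≠ 0 := Complex.exp_ne_zero _

theorem phase_inv_add_one (h : ℂ) : (phase (h + 1))⁻¹ = -(phase h)⁻¹ := by
  rw [phase_add_one, inv_neg]

theorem eq_of_restrictedDual (M : VModule.{u, v} V) {x y : M}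
    (h : ∀ f : restrictedDual M, f.1 x = f.1 y) : x = y :=
  sub_eq_zero.mp (eq_zero_of_restrictedDual M fun f => by rw [map_sub, h, sub_self])

variable {W₁ W₂ D : VModule.{u, v} V} {F : OperatorSeries D W₁ W₂}

theorem Inter.transpose_vmodule (hF : Inter D.Y W₁.Y W₂.Y F) :
    Inter W₁.Y D.Y W₂.Y (VOA.transpose W₂ F hF.truncated) :=
  hF.transpose D.isModule.toIsWeakModule W₁.isModule.toIsWeakModule

/-- The operator `(F^t)'`. -/
noncomputable def transposeAdjoint (hF : Inter D.Y W₁.Y W₂.Y F) :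
    OperatorSeries W₁ (restrictedDual W₂) (restrictedDual D) :=
  restrictedAdjoint phase hF.transpose_vmodule.isGraded

theorem transposeAdjoint_apply (hF : Inter D.Y W₁.Y W₂.Y F) (u : W₁) (α : ℂ)
    (f : restrictedDual W₂) (d : D) :
    (transposeAdjoint hF u α f).1 d
      = f.1 (opp phase W₁ (VOA.transpose W₂ F hF.truncated) u α d) := rfl

theorem transposeAdjoint_inter (hF : Inter D.Y W₁.Y W₂.Y F) :
    Inter W₁.Y (contragredientAction W₂) (contragredientAction D) (transposeAdjoint hF) :=
  hF.transpose_vmodule.restrictedAdjoint phase_add_one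

theorem transpose_comp {A B E : Type*} [AddCommGroup A] [Module ℂ A] [AddCommGroup B]
    [Module ℂ B] [AddCommGroup E] [Module ℂ E] (C : VModule.{u, v} V)
    {I : OperatorSeries A B C} {J : OperatorSeries E B C} (hI : IsTruncated I)
    (hJ : IsTruncated J) {φ : E → A} (h : ∀ g α w, J g α w = I (φ g) α w) (w : B) (α : ℂ) (g : E) :
    transpose C J hJ w α g = transpose C I hI w α (φ g) := by
  simp only [transpose_apply, h]

/-- Every intertwining operator from `W₁` and `W₂'` to `W` is obtained by dualization from one
from `W'` and `W₁` to `W₂`. -/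
theorem exists_dual_operator {W : VModule.{u, v} V} {I : OperatorSeries W₁ (restrictedDual W₂) W}
    (hI : Inter W₁.Y (contragredientAction W₂) W.Y I) :
    ∃ (J : OperatorSeries (restrictedDual W) W₁ W₂)
      (hJ : Inter (contragredientAction W) W₁.Y W₂.Y J), ∀ u α g (f : restrictedDual W₂),
        f.1 (opp phase W₁ (transpose W₂ J hJ.truncated) u α g) = g.1 (I u α f) := by
  have hI' : Inter W₁.Y (dualModule W₂).Y W.Y I := hI
  -- The inverse phase is chosen so that taking the adjoint with `phase` afterwards returns `I`
  -- exactly.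
  let I' := restrictedAdjoint (fun h => (phase h)⁻¹) hI'.isGraded
  have hK : Inter W₁.Y (contragredientAction W) W₂.Y
      (postcomp (doubleDualEquiv W₂).symm.toLinearMap I') :=
    (hI'.restrictedAdjoint phase_inv_add_one).postcomp (doubleDualEquiv_isHom W₂).symm
  -- This cancels the factor of the double transpose, so that the transpose of `J` is exactly the
  -- adjoint of `I`.
  let c : ℂ → ℂ := fun α => (tphase α ^ 2)⁻¹
  have hc : ∀ (α : ℂ) (n : ℤ), c (α + n) = c α := fun α n => by
    simp only [c, tphase_sq_add_int]
  have hJ := (hK.transpose W₁.isModule.toIsWeakModule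
    (contragredientAction_isWeakModule W)).scaleModes hc
  refine ⟨_, hJ, fun u α g f => ?_⟩
  have hJK : transpose W₂ _ hJ.truncated
      = postcomp (doubleDualEquiv W₂).symm.toLinearMap I' := by
    ext u α g
    rw [transpose_scaleModes W₂ _ (transpose_truncated W₂ _ hK.truncated) hc, transpose_transpose, smul_smul,
      inv_mul_cancel₀ (pow_ne_zero 2 (tphase_ne_zero α)), one_smul]
  rw [hJK]
  have h := opp_pairing (A := W₁) phase (I := postcomp (doubleDualEquiv W₂).symm.toLinearMap I')
    (J := opp (fun h => (phase h)⁻¹) W₁ I) (restrictedDual W₂).subtype.flip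
    (restrictedDual W).subtype
    (fun u β g f => doubleDualEquiv_symm_apply W₂ (I' u β g) f) u α g f
  refine h.trans ?_
  rw [opp_opp_of_mul_eq_one phase_inv_add_one fun h => mul_inv_cancel₀ (phase_ne_zero h)]
  rfl

/-- If every intertwining operator of type `(W₂ over W W₁)` factors through `F`, then every
intertwining operator of type `(W over W₁ W₂')` factors through `(F^t)'`. -/
theorem exists_hom_transposeAdjoint (hF : Inter D.Y W₁.Y W₂.Y F)
    (hfac : ∀ (W : VModule.{u, v} V) (J : OperatorSeries W W₁ W₂), Inter W.Y W₁.Y W₂.Y J →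
      ∃ φ : W →ₗ[ℂ] D, IsHom W.Y D.Y φ ∧ ∀ g α w, J g α w = F (φ g) α w)
    {W : VModule.{u, v} V} {I : OperatorSeries W₁ (restrictedDual W₂) W}
    (hI : Inter W₁.Y (contragredientAction W₂) W.Y I) :
    ∃ ψ : restrictedDual D →ₗ[ℂ] W, IsHom (contragredientAction D) W.Y ψ ∧
      ∀ u α f, I u α f = ψ (transposeAdjoint hF u α f) := by
  obtain ⟨J, hJ, hJI⟩ := exists_dual_operator hI
  obtain ⟨φ, hφ, hφJ⟩ := hfac (dualModule W) J hJ
  -- The factorization `φ : W' → D` dualizes to `D' → W''`, and `W''` is identified with `W`.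
  refine ⟨(doubleDualEquiv W).symm.toLinearMap ∘ₗ dualMap φ hφ, fun a n x => ?_,
    fun u α f => eq_of_restrictedDual W fun g => ?_⟩
  · have := (doubleDualEquiv_isHom W).symm a n (dualMap φ hφ x)
    rw [LinearMap.comp_apply, LinearMap.comp_apply, ← this]
    exact congrArg _ (dualMap_isHom φ hφ a n x)
  · refine Eq.trans ?_ (doubleDualEquiv_symm_apply W (dualMap φ hφ (transposeAdjoint hF u α f))
      g).symm
    rw [dualMap_apply, transposeAdjoint_apply, ← hJI]
    exact congrArg f.1 (opp_comp phase (transpose W₂ J hJ.truncated)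
      (transpose W₂ F hF.truncated) φ LinearMap.id
      (fun u β x => transpose_comp W₂ hF.truncated hJ.truncated hφJ u β x) u α g)

/-- The modes of `(F^t)'` separate homomorphisms if `F` is injective. -/
theorem eq_zero_of_transposeAdjoint (hF : Inter D.Y W₁.Y W₂.Y F)
    (hinj : ∀ d, (∀ α w, F d α w = 0) → d = 0) {W : VModule.{u, v} V}
    {ψ : restrictedDual D →ₗ[ℂ] W} (hψ : IsHom (contragredientAction D) W.Y ψ)
    (h0 : ∀ u α f, ψ (transposeAdjoint hF u α f) = 0) : ψ = 0 := by
  ext x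
  refine eq_zero_of_restrictedDual W fun g => ?_
  have hψ' : IsHom (dualModule D).Y W.Y ψ := hψ
  -- By double duality the functional `g ∘ ψ` on `D'` is evaluation at a vector `d`. It is enough to
  -- prove `d = 0`, by undoing the adjoint and then the transpose at `d`.
  obtain ⟨d, hd⟩ : ∃ d : D, ∀ y : restrictedDual D, y.1 d = g.1 (ψ y) :=
    ⟨(doubleDualEquiv D).symm (dualMap ψ hψ' g), fun y => doubleDualEquiv_symm_apply D _ y⟩
  have hopp : ∀ u α, opp phase W₁ (transpose W₂ F hF.truncated) u α d = 0 := fun u α =>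
    eq_zero_of_restrictedDual W₂ fun f => by
      rw [← transposeAdjoint_apply hF, hd, h0, map_zero]
  have htr : ∀ u α, transpose W₂ F hF.truncated u α d = 0 := fun u α => by
    rw [← opp_opp_of_mul_eq_one phase_add_one (fun h => inv_mul_cancel₀ (phase_ne_zero h))
      (transpose W₂ F hF.truncated)]
    -- Vanishing at the single vector `d` is expressed as agreement with the zero operator along `ℂ
    -- → D`, `1 ↦ d`, so that naturality of `opp` carries it over to the double opposite.
    have := opp_comp (fun h => (phase h)⁻¹) (0 : OperatorSeries W₁ ℂ W₂)
      (opp phase W₁ (transpose W₂ F hF.truncated)) (LinearMap.toSpanSingleton ℂ D d)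
      (0 : W₂ →ₗ[ℂ] W₂) (fun u β c => by
        rw [LinearMap.toSpanSingleton_apply, map_smul, hopp, smul_zero]; rfl) u α 1
    rw [LinearMap.toSpanSingleton_apply, one_smul] at this
    exact this.symm
  have hd0 : d = 0 := hinj d fun α w => by
    have := transpose_transpose W₂ F hF.truncated d α w
    rw [transpose_apply] at this
    simp only [htr, map_zero, smul_zero, finsum_zero] at this
    exact (smul_eq_zero.mp this.symm).resolve_left (pow_ne_zero 2 (tphase_ne_zero α))
  rw [← hd, hd0, map_zero]

theorem isTensorProduct_transposeAdjoint (hF : Inter D.Y W₁.Y W₂.Y F)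
    (hinj : ∀ d, (∀ α w, F d α w = 0) → d = 0)
    (hfac : ∀ (W : VModule.{u, v} V) (J : OperatorSeries W W₁ W₂), Inter W.Y W₁.Y W₂.Y J →
      ∃ φ : W →ₗ[ℂ] D, IsHom W.Y D.Y φ ∧ ∀ g α w, J g α w = F (φ g) α w) :
    IsTensorProduct W₁ (dualModule W₂) (dualModule D) (transposeAdjoint hF) where
  isIntertwining := isIntertwining_iff_inter.mpr (transposeAdjoint_inter hF)
  universal W I hI := by
    obtain ⟨ψ, hψ, hψI⟩ := exists_hom_transposeAdjoint hF hfac (isIntertwining_iff_inter.mp hI)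
    refine ⟨ψ, ⟨hψ, hψI⟩, ?_⟩
    rintro ψ' ⟨hψ', hψI'⟩
    refine sub_eq_zero.mp (eq_zero_of_transposeAdjoint hF hinj (fun a n x => ?_) fun u α f => ?_)
    · rw [LinearMap.sub_apply, LinearMap.sub_apply, map_sub, hψ]
      exact congrArg (· - _) (hψ' a n x)
    · rw [LinearMap.sub_apply, ← hψI]
      exact sub_eq_zero.mpr (hψI' u α f).symm

/-- The image of `W` in fields is a module inside `G(W₁,W₂)`, hence one of the summands of `Delta`.
-/
theorem exists_hom_Delta (hΔ : IsModuleInsideG W₁ W₂ (Delta W₁ W₂)) (W : VModule.{u, v} V)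
    (J : OperatorSeries W W₁ W₂) (hJ : Inter W.Y W₁.Y W₂.Y J) :
    ∃ φ : W →ₗ[ℂ] hΔ.toVModule, IsHom W.Y hΔ.toVModule.Y φ ∧
      ∀ g α w, J g α w = barF W₁ W₂ (φ g) α w := by
  have hle : ∀ g, toField J hJ.truncated g ∈ Delta W₁ W₂ := fun g =>
    le_sSup (a := LinearMap.range (toField J hJ.truncated))
      (hJ.isModuleInsideG_range W.isModule) ⟨g, rfl⟩
  exact ⟨LinearMap.codRestrict (Delta W₁ W₂) (toField J hJ.truncated) hle,
    fun a n g => Subtype.ext (hJ.toField_isHom a n g), fun _ _ _ => rfl⟩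

end TensorProduct
end VOA

theorem theorem4p10 {V : Type u} [AddCommGroup V] [Module ℂ V]
    [VOA.VertexOperatorAlgebra V]
    (finitely_many : VOA.FinitelyManyIrreducibles.{u, v} V)
    (completely_reducible : ∀ M : VOA.VModule.{u, v} V, VOA.IsCompletelyReducible M)
    (finite_fusion_rules : ∀ M₁ M₂ M₃ : VOA.VModule.{u, v} V,
      FiniteDimensional ℂ (VOA.intertwiningSpace M₁ M₂ M₃))
    (W₁ W₂ : VOA.VModule.{u, v} V) :
    -- `Δ(W₁,W₂)` is a `V`-module inside `G(W₁,W₂)`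
    ∃ (hΔ : VOA.IsModuleInsideG W₁ W₂ (VOA.Delta W₁ W₂))
      -- the contragredients `W₂'` and `Δ(W₁,W₂)'` are `V`-modules
      (hW₂ : VOA.IsModule (VOA.contragredientAction W₂))
      (hΔ' : VOA.IsModule (VOA.contragredientAction hΔ.toVModule))
      -- the operator `T = (F̄^t)'` from `W₁` to `Hom(W₂', Δ(W₁,W₂)'){x}`
      (T : VOA.OperatorSeries W₁ (VOA.restrictedDual W₂) (VOA.restrictedDual hΔ.toVModule)),
      (∀ (u : W₁) (β : ℂ) (f : VOA.restrictedDual W₂),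
        (T u β f).1 =
          VOA.adjointOperator W₁
            (VOA.transpose W₂ (VOA.barF W₁ W₂) (VOA.barF_truncated W₁ W₂)) u β
            f.1) ∧
      VOA.IsTensorProduct W₁ (VOA.contragredient W₂ hW₂)
        (VOA.contragredient hΔ.toVModule hΔ') T := by
  have hΔ := VOA.isModuleInsideG_Delta finitely_many completely_reducible finite_fusion_rules
    W₁ W₂
  have hF : VOA.Inter hΔ.toVModule.Y W₁.Y W₂.Y (VOA.barF W₁ W₂) := hΔ.inter
  -- The definition of `opp phase` unfolds to `oppositeOperator`, so the formula prescribed for `T`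
  -- holds by `rfl`.
  refine ⟨hΔ, VOA.contragredientAction_isModule W₂, VOA.contragredientAction_isModule _,
    VOA.transposeAdjoint hF, fun _ _ _ => rfl, ?_⟩
  refine VOA.isTensorProduct_transposeAdjoint hF (fun d hd => ?_) (VOA.exists_hom_Delta hΔ)
  -- Injectivity of `barF`: an element of `Delta` is the family of its coefficients.
  exact Subtype.ext (Subtype.ext (funext fun α => LinearMap.ext fun w => hd α w))
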